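/- Let $A$ be a quantum system whose Hilbert space has an orthonormal (Fock) basis $|0\rangle,|1\rangle,|2\rangle,\dots$, with number operator $\hat n_A|n\rangle=n|n\rangle$, and let $B_1,\dots,B_N$ be quantum systems with arbitrary (possibly infinite-dimensional) Hilbert spaces. For $\omega>0$ and $\Omega>1$, the exponential cut-off diamond norm of a linear map $\Phi$ from the trace class operators of $A$ to those of a system $B$ is $$\|\Phi\|_{\diamond\omega,\Omega}=\sup_{C,\rho}\bigl\|(\Phi\otimes\mathrm{id}_C)[\rho]\bigr\|_1 ,$$ where the supremum is over all ancillary systems $C$ and all density operators $\rho$ on $A\otimes C$ with $\mathrm{Tr}[\rho\,e^{\omega\hat n_A}]\le\Omega$, and $\|\cdot\|_1$ is the trace norm. Put $$\tilde n=\frac1{e^{\omega}-1},\qquad \tilde d=\frac{\Omega e^{\omega}}{e^{\omega}-1},\qquad s=(\tilde n+1)\ln(\tilde n+1)-\tilde n\ln\tilde n,\qquad \varsigma=\frac{s}{\ln 2},$$ $$\gamma_1=\frac{2\tilde d^{\,2}s}{3\omega^4},\qquad \gamma_2=\frac{3\tilde d\,\omega^4}{16\,s},\qquad \zeta(d)=\Bigl(\frac{27\ln(2)\,\tilde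 d^{\,2}d^4\varsigma}{N}\Bigr)^{1/3}+4\sqrt{\frac{\tilde d^{\,2}}{e^{\omega d}}} .$$ **Theorem.** Let $\Lambda$ be a completely positive trace-preserving map from $A$ to $B_1\otimes\dots\otimes B_N$, let $\Lambda_j=\mathrm{Tr}_{\backslash B_j}\circ\Lambda$ be its effective dynamics from $A$ to $B_j$ (the partial trace is over all fragments except $B_j$), and let $0<\delta<1$, $\omega>0$, $\Omega>1$. Then there exist a POVM $\{M_k\}$ on $A$ (with finitely many outcomes) and a set $S\subseteq\{1,\dots,N\}$ with $|S|\ge(1-\delta)N$ such that for every $j\in S$ there are states $\sigma_{j,k}$ of $B_j$ for which the measure-and-prepare channel $\mathcal E_j(X)=\sum_k\mathrm{Tr}(M_kX)\,\sigma_{j,k}$ satisfies $$\|\Lambda_j-\mathcal E_j\|_{\diamond\omega,\Omega}\le\frac8\delta\Bigl(\frac{\gamma_1}{N}\Bigr)^{1/3}\Bigl[1+\tfrac14\,\bigl|\ln(\gamma_2N)\bigr|^{4/3}\Bigr].$$ Moreover, for every truncation dimension $d\in\{1,2,3,\dots\}$ there exist a POVM $\{M_k\}$ and a set $S$ with $|S|\ge(1-\delta)N$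 (both may depend on $d$) such that for every $j\in S$ there are states $\sigma_{j,k}$ of $B_j$ with $$\|\Lambda_j-\mathcal E_j\|_{\diamond\omega,\Omega}\le\frac{\zeta(d)}{\delta}.$$ -/

import Mathlib

open scoped ENNReal InnerProductSpace ComplexOrder

universe u v w

noncomputable section

namespace QDarwin

/-- The complex Hilbert space with an orthonormal basis indexed by `ι`. Every Hilbert space is of
this form up to a unitary; the Hilbert tensor product of `Hilb ι` and `Hilb κ` is `Hilb (ι × κ)`,
and that of a finite family `Hilb (β j)` is `Hilb (∀ j, β j)`. -/
def Hilb (ι : Type u) : Type u := lp (fun _ : ι => ℂ) 2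

instance (ι : Type u) : NormedAddCommGroup (Hilb ι) :=
  inferInstanceAs (NormedAddCommGroup (lp (fun _ : ι => ℂ) 2))

instance (ι : Type u) : InnerProductSpace ℂ (Hilb ι) :=
  inferInstanceAs (InnerProductSpace ℂ (lp (fun _ : ι => ℂ) 2))

instance (ι : Type u) : CompleteSpace (Hilb ι) :=
  inferInstanceAs (CompleteSpace (lp (fun _ : ι => ℂ) 2))

/-- The coordinates of a vector. -/
def coord {ι : Type u} (x : Hilb ι) : ι → ℂ := fun i => (show lp (fun _ : ι => ℂ) 2 from x) i

/-- Bounded operators on `Hilb ι`. -/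
abbrev Op (ι : Type u) : Type u := Hilb ι →L[ℂ] Hilb ι

open Classical in
/-- The basis vector `|i⟩`. -/
def ket {ι : Type u} (i : ι) : Hilb ι := lp.single 2 i (1 : ℂ)

theorem inner_ket {ι : Type u} (i : ι) (x : Hilb ι) : ⟪ket i, x⟫_ℂ = coord x i := by
  classical
  refine (lp.inner_single_left (G := fun _ : ι => ℂ) (𝕜 := ℂ) i 1 x).trans ?_
  simp [coord]

theorem parseval {ι : Type u} (x : Hilb ι) :
    ∑' i, ENNReal.ofReal (‖coord x i‖ ^ 2) = ENNReal.ofReal (‖x‖ ^ 2) := by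
  have h : HasSum (fun i => ‖coord x i‖ ^ 2) (‖x‖ ^ 2) := by
    have h := lp.hasSum_norm (E := fun _ : ι => ℂ) (p := 2) (by norm_num) x
    simp only [ENNReal.toReal_ofNat, Real.rpow_ofNat] at h
    exact h
  rw [← h.tsum_eq, ENNReal.ofReal_tsum_of_nonneg (fun i => by positivity) h.summable]

/-! ### Trace class operators -/

/-- The trace `∑ᵢ ⟨i|T|i⟩ ∈ [0, ∞]` of a positive operator. -/
def posTrace {ι : Type u} (T : Op ι) : ℝ≥0∞ :=
  ∑' i, ENNReal.ofReal (⟪ket i, T (ket i)⟫_ℂ).re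

/-- The trace class operators: the linear span of the positive operators of finite trace. -/
def TraceClass (ι : Type u) : Submodule ℂ (Op ι) :=
  Submodule.span ℂ {T | T.IsPositive ∧ posTrace T ≠ ∞}

/-- The trace norm `‖T‖₁ = Tr |T|`, where `|T| = (T† T)^{1/2}`. -/
def traceNorm {ι : Type u} (T : Op ι) : ℝ≥0∞ := posTrace (CFC.abs T)

/-- The trace `∑ᵢ ⟨i|T|i⟩`. -/
def tr {ι : Type u} (T : Op ι) : ℂ := ∑' i, ⟪ket i, T (ket i)⟫_ℂ

/-- Density operators. -/
structure IsState {ι : Type u} (ρ : TraceClass ι) : Prop where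
  pos : (ρ : Op ι).IsPositive
  trace_one : tr (ρ : Op ι) = 1

theorem exists_sqrt {ι : Type u} {X : Op ι} (hX : X.IsPositive) :
    ∃ R : Op ι, ContinuousLinearMap.adjoint R = R ∧ R ∘L R = X := by
  have h0 : (0 : Op ι) ≤ X := (ContinuousLinearMap.nonneg_iff_isPositive X).2 hX
  refine ⟨CFC.sqrt X, ?_, CFC.sqrt_mul_sqrt_self X h0⟩
  exact (CFC.sqrt_nonneg X).isSelfAdjoint.star_eq

theorem re_inner_sq {ι : Type u} {R : Op ι} (hR : ContinuousLinearMap.adjoint R = R) (x : Hilb ι) :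
    (⟪x, (R ∘L R) x⟫_ℂ).re = ‖R x‖ ^ 2 := by
  rw [ContinuousLinearMap.comp_apply]
  nth_rewrite 1 [← hR]
  rw [ContinuousLinearMap.adjoint_inner_right, inner_self_eq_norm_sq_to_K]
  norm_cast

theorem posTrace_sq {ι : Type u} {R : Op ι} (hR : ContinuousLinearMap.adjoint R = R) :
    posTrace (R ∘L R) = ∑' i, ENNReal.ofReal (‖R (ket i)‖ ^ 2) := by
  unfold posTrace
  exact tsum_congr fun i => by rw [re_inner_sq hR]

theorem posTrace_conj_le {ι : Type u} {κ : Type v} {X : Op ι} (hX : X.IsPositive)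
    (W : Hilb ι →L[ℂ] Hilb κ) :
    posTrace (W ∘L X ∘L ContinuousLinearMap.adjoint W) ≤
      ENNReal.ofReal (‖W‖ ^ 2) * posTrace X := by
  obtain ⟨R, hR, rfl⟩ := exists_sqrt hX
  have h1 : posTrace (W ∘L (R ∘L R) ∘L ContinuousLinearMap.adjoint W) =
      ∑' k, ∑' i, ENNReal.ofReal (‖coord (W (R (ket i))) k‖ ^ 2) := by
    unfold posTrace
    refine tsum_congr fun k => ?_
    rw [ContinuousLinearMap.comp_apply, ContinuousLinearMap.comp_apply,
      ← ContinuousLinearMap.adjoint_inner_left, re_inner_sq hR, ← parseval]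
    refine tsum_congr fun i => ?_
    congr 2
    rw [← inner_ket i, ← hR, ContinuousLinearMap.adjoint_inner_right, hR,
      ContinuousLinearMap.adjoint_inner_right, ← norm_inner_symm, inner_ket]
  rw [h1, ENNReal.tsum_comm, posTrace_sq hR, ← ENNReal.tsum_mul_left]
  refine ENNReal.tsum_le_tsum fun i => ?_
  rw [parseval, ← ENNReal.ofReal_mul (by positivity), ← mul_pow]
  exact ENNReal.ofReal_le_ofReal (pow_le_pow_left₀ (norm_nonneg _) (W.le_opNorm _) 2)

theorem conj_mem {ι : Type u} {κ : Type v} {X : Op ι} (hX : X.IsPositive) (hf : posTrace X ≠ ∞)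
    (W : Hilb ι →L[ℂ] Hilb κ) : W ∘L X ∘L ContinuousLinearMap.adjoint W ∈ TraceClass κ :=
  Submodule.subset_span ⟨hX.conj_adjoint W,
    ne_top_of_le_ne_top (ENNReal.mul_ne_top ENNReal.ofReal_ne_top hf) (posTrace_conj_le hX W)⟩

theorem compress_mem {ι : Type u} {κ : Type v} (W V : Hilb ι →L[ℂ] Hilb κ) {X : Op ι}
    (hX : X ∈ TraceClass ι) : W ∘L X ∘L ContinuousLinearMap.adjoint V ∈ TraceClass κ := by
  induction hX using Submodule.span_induction with
  | zero => simp
  | add x y _ _ hx hy => simpa using add_mem hx hy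
  | smul a x _ hx => simpa using Submodule.smul_mem _ a hx
  | mem X hX =>
    have key : W ∘L X ∘L ContinuousLinearMap.adjoint V = (1 / 4 : ℂ) •
        (((W + V) ∘L X ∘L ContinuousLinearMap.adjoint (W + V)
          - (W - V) ∘L X ∘L ContinuousLinearMap.adjoint (W - V))
        + Complex.I • ((W + Complex.I • V) ∘L X ∘L ContinuousLinearMap.adjoint (W + Complex.I • V)
          - (W - Complex.I • V) ∘L X ∘L ContinuousLinearMap.adjoint (W - Complex.I • V))) := by
      ext1 x
      have hI : Complex.I * Complex.I = -1 := Complex.I_mul_I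
      simp only [map_add, map_sub, map_smulₛₗ, ContinuousLinearMap.comp_apply,
        add_apply, sub_apply, smul_apply, Complex.conj_I, smul_add, smul_sub, smul_smul,
        RingHom.id_apply]
      match_scalars <;> ring_nf <;> simp <;> norm_num
    rw [key]
    exact Submodule.smul_mem _ _ (add_mem (sub_mem (conj_mem hX.1 hX.2 _) (conj_mem hX.1 hX.2 _))
      (Submodule.smul_mem _ _ (sub_mem (conj_mem hX.1 hX.2 _) (conj_mem hX.1 hX.2 _))))

/-- `X ↦ W X V†` as a linear map between spaces of trace class operators. -/
def compress {ι : Type u} {κ : Type v} (W V : Hilb ι →L[ℂ] Hilb κ) :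
    TraceClass ι →ₗ[ℂ] TraceClass κ where
  toFun X := ⟨W ∘L (X : Op ι) ∘L ContinuousLinearMap.adjoint V, compress_mem W V X.2⟩
  map_add' X Y := by ext1; simp
  map_smul' a X := by ext1; simp

theorem diag_nonneg {ι : Type u} {X : Op ι} (hX : X.IsPositive) (i : ι) :
    0 ≤ (⟪ket i, X (ket i)⟫_ℂ).re := hX.re_inner_nonneg_right (ket i)

theorem summable_diag {ι : Type u} {X : Op ι} (hX : X ∈ TraceClass ι) :
    Summable fun i => ⟪ket i, X (ket i)⟫_ℂ := by
  induction hX using Submodule.span_induction with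
  | zero => simp
  | add x y _ _ hx hy => simpa [inner_add_right] using hx.add hy
  | smul a x _ hx => simpa [inner_smul_right] using hx.mul_left a
  | mem X hX =>
    have h : Summable fun i => (⟪ket i, X (ket i)⟫_ℂ).re := by
      have := ENNReal.summable_toReal hX.2
      refine this.congr fun i => ENNReal.toReal_ofReal (diag_nonneg hX.1 i)
    refine (Complex.hasSum_ofReal.2 h.hasSum).summable.congr fun i => ?_
    have h0 := hX.1.inner_nonneg_right (ket i)
    exact (Complex.eq_re_of_ofReal_le (r := 0) (by simpa using h0)).symm

/-- The functional `X ↦ Tr(M X)` on trace class operators, for a bounded operator `M`. -/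
def trMul {ι : Type u} (M : Op ι) : TraceClass ι →ₗ[ℂ] ℂ where
  toFun X := tr (M ∘L (X : Op ι))
  map_add' X Y := by
    have h (Z : TraceClass ι) := summable_diag (X := M ∘L (Z : Op ι))
      (by
        have h0 := compress_mem M (.id ℂ _) Z.2
        rwa [ContinuousLinearMap.adjoint_id, ContinuousLinearMap.comp_id] at h0)
    have := (h X).tsum_add (h Y)
    simpa [tr, inner_add_right] using this
  map_smul' a X := by simp [tr, tsum_mul_left]

/-! ### Restriction to blocks and partial trace -/

/-- For an injective `f : ι ↪ κ`, the co-isometry `Hilb κ → Hilb ι`, `|f i⟩ ↦ |i⟩`, which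
annihilates the other basis vectors; its adjoint is the isometry `|i⟩ ↦ |f i⟩`. -/
def restrict {ι : Type u} {κ : Type v} (f : ι ↪ κ) : Hilb κ →L[ℂ] Hilb ι :=
  LinearMap.mkContinuous
    { toFun := fun x => (⟨fun i => coord x (f i), by
        have h : Memℓp (coord x) 2 := lp.memℓp (show lp (fun _ : κ => ℂ) 2 from x)
        rw [memℓp_gen_iff (by norm_num)] at h
        exact memℓp_gen (h.comp_injective f.injective)⟩ : lp (fun _ : ι => ℂ) 2)
      map_add' := fun _ _ => rfl
      map_smul' := fun _ _ => rfl } 1 (fun x => by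
        rw [one_mul]
        refine lp.norm_le_of_tsum_le (E := fun _ : ι => ℂ) (p := 2) (by norm_num)
          (norm_nonneg _) ?_
        have h : Summable fun i => ‖coord x i‖ ^ (2 : ℝ≥0∞).toReal :=
          (lp.memℓp (show lp (fun _ : κ => ℂ) 2 from x)).summable (by norm_num)
        refine (tsum_comp_le_tsum_of_inj h (fun i => by positivity) f.injective).trans ?_
        exact (lp.norm_rpow_eq_tsum (E := fun _ : κ => ℂ) (p := 2) (by norm_num) x).ge)

theorem coord_restrict {ι : Type u} {κ : Type v} (f : ι ↪ κ) (x : Hilb κ) (i : ι) :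
    coord (restrict f x) i = coord x (f i) := rfl

theorem adjoint_restrict_ket {ι : Type u} {κ : Type v} (f : ι ↪ κ) (i : ι) :
    ContinuousLinearMap.adjoint (restrict f) (ket i) = ket (f i) := by
  refine ext_inner_right ℂ fun y => ?_
  rw [ContinuousLinearMap.adjoint_inner_left, inner_ket, inner_ket, coord_restrict]

/-- `i ↦ (i, c)`. -/
def inLeft {ι : Type u} {κ : Type v} (c : κ) : ι ↪ ι × κ :=
  ⟨fun i => (i, c), fun _ _ h => congrArg Prod.fst h⟩

/-- The block `(1 ⊗ ⟨c|) X (1 ⊗ |c'⟩)` of an operator on `Hilb ι ⊗ Hilb κ`. -/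
def opBlock {ι : Type u} {κ : Type v} (c c' : κ) (X : Op (ι × κ)) : Op ι :=
  restrict (inLeft c) ∘L X ∘L ContinuousLinearMap.adjoint (restrict (inLeft c'))

/-- The block `(1 ⊗ ⟨c|) X (1 ⊗ |c'⟩)` of a trace class operator, which is trace class. -/
def block {ι : Type u} {κ : Type v} (c c' : κ) : TraceClass (ι × κ) →ₗ[ℂ] TraceClass ι :=
  compress (restrict (inLeft c)) (restrict (inLeft c'))

theorem posTrace_opBlock {ι : Type u} {κ : Type v} (X : Op (ι × κ)) :
    ∑' c, posTrace (opBlock c c X) = posTrace X := by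
  unfold posTrace
  rw [ENNReal.tsum_comm, ← ENNReal.tsum_prod]
  refine tsum_congr fun p => ?_
  simp only [opBlock, ContinuousLinearMap.comp_apply, adjoint_restrict_ket, inner_ket,
    coord_restrict]
  rfl

theorem opBlock_isPositive {ι : Type u} {κ : Type v} {X : Op (ι × κ)} (hX : X.IsPositive) (c : κ) :
    (opBlock c c X).IsPositive := hX.conj_adjoint _

theorem norm_le_posTrace {ι : Type u} {X : Op ι} (hX : X.IsPositive) (hf : posTrace X ≠ ∞) :
    ‖X‖ ≤ (posTrace X).toReal := by
  obtain ⟨R, hR, rfl⟩ := exists_sqrt hX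
  have hR' : ‖R ∘L R‖ = ‖R‖ * ‖R‖ := by
    nth_rewrite 1 [← hR]
    exact ContinuousLinearMap.norm_adjoint_comp_self R
  have h2 : ‖R‖ ≤ Real.sqrt (posTrace (R ∘L R)).toReal := by
    refine R.opNorm_le_bound (Real.sqrt_nonneg _) fun x => ?_
    refine abs_le_of_sq_le_sq' ?_ (by positivity) |>.2
    rw [mul_pow, Real.sq_sqrt ENNReal.toReal_nonneg,
      ← ENNReal.ofReal_le_ofReal_iff (by positivity), ← parseval,
      ENNReal.ofReal_mul ENNReal.toReal_nonneg, ENNReal.ofReal_toReal hf, posTrace_sq hR,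
      ← ENNReal.tsum_mul_right]
    refine ENNReal.tsum_le_tsum fun i => ?_
    rw [← ENNReal.ofReal_mul (by positivity), ← mul_pow, ← inner_ket, ← hR,
      ContinuousLinearMap.adjoint_inner_right, hR]
    exact ENNReal.ofReal_le_ofReal (pow_le_pow_left₀ (norm_nonneg _) (norm_inner_le_norm _ _) 2)
  rw [hR']
  calc ‖R‖ * ‖R‖ ≤ _ := mul_self_le_mul_self (norm_nonneg _) h2
    _ = _ := Real.mul_self_sqrt ENNReal.toReal_nonneg

theorem summable_opBlock {ι : Type u} {κ : Type v} {X : Op (ι × κ)}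
    (hX : X ∈ TraceClass (ι × κ)) : Summable fun c => opBlock c c X := by
  induction hX using Submodule.span_induction with
  | zero => simp [opBlock]
  | add x y _ _ hx hy => simpa [opBlock] using hx.add hy
  | smul a x _ hx => simpa [opBlock] using hx.const_smul a
  | mem X hX =>
    have h := hX.2
    rw [← posTrace_opBlock] at h
    refine Summable.of_norm_bounded (ENNReal.summable_toReal h) fun c => ?_
    exact norm_le_posTrace (opBlock_isPositive hX.1 c) (ENNReal.ne_top_of_tsum_ne_top h c)

theorem ptrace_mem {ι : Type u} {κ : Type v} {X : Op (ι × κ)}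
    (hX : X ∈ TraceClass (ι × κ)) : ∑' c, opBlock c c X ∈ TraceClass ι := by
  induction hX using Submodule.span_induction with
  | zero => simp [opBlock]
  | add x y hx hy hx' hy' =>
    have := (summable_opBlock hx).tsum_add (summable_opBlock hy)
    have h2 : (∑' c, opBlock c c (x + y)) = ∑' c, (opBlock c c x + opBlock c c y) :=
      tsum_congr fun c => by simp [opBlock]
    rw [h2, this]
    exact add_mem hx' hy'
  | smul a x hx hx' =>
    have h2 : (∑' c, opBlock c c (a • x)) = ∑' c, a • opBlock c c x :=
      tsum_congr fun c => by simp [opBlock]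
    rw [h2, (summable_opBlock hx).tsum_const_smul a]
    exact Submodule.smul_mem _ _ hx'
  | mem X hX =>
    have hs := summable_opBlock (Submodule.subset_span hX : X ∈ TraceClass (ι × κ))
    have hin (x y : Hilb ι) : HasSum (fun c => ⟪x, opBlock c c X y⟫_ℂ)
        ⟪x, (∑' c, opBlock c c X) y⟫_ℂ := by
      have h1 := hs.hasSum.mapL (ContinuousLinearMap.apply ℂ (Hilb ι) y)
      exact h1.mapL (innerSL ℂ x)
    refine Submodule.subset_span ⟨?_, ?_⟩
    · rw [← ContinuousLinearMap.nonneg_iff_isPositive]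
      exact tsum_nonneg fun c =>
        (ContinuousLinearMap.nonneg_iff_isPositive _).2 (opBlock_isPositive hX.1 c)
    · refine ne_top_of_le_ne_top hX.2 ?_
      rw [← posTrace_opBlock]
      unfold posTrace
      rw [ENNReal.tsum_comm]
      refine ENNReal.tsum_le_tsum fun i => ?_
      have h := (hin (ket i) (ket i)).mapL Complex.reCLM
      simp only [Complex.reCLM_apply] at h
      rw [← h.tsum_eq, ENNReal.ofReal_tsum_of_nonneg
        (fun c => diag_nonneg (opBlock_isPositive hX.1 c) i) h.summable]

/-- The partial trace `X ↦ ∑_c (1 ⊗ ⟨c|) X (1 ⊗ |c⟩)` over the second factor. -/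
def ptrace (ι : Type u) (κ : Type v) : TraceClass (ι × κ) →ₗ[ℂ] TraceClass ι where
  toFun X := ⟨∑' c, opBlock c c (X : Op (ι × κ)), ptrace_mem X.2⟩
  map_add' X Y := by
    ext1
    have := (summable_opBlock X.2).tsum_add (summable_opBlock Y.2)
    simpa [opBlock] using this
  map_smul' a X := by
    ext1
    have := (summable_opBlock X.2).tsum_const_smul a
    simpa [opBlock] using this

/-- The identification of `Hilb κ` with `Hilb ι` along a bijection of the basis labels, on the
level of trace class operators. -/
def relabel {ι : Type u} {κ : Type v} (e : ι ≃ κ) : TraceClass κ →ₗ[ℂ] TraceClass ι :=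
  compress (restrict e.toEmbedding) (restrict e.toEmbedding)

/-- The partial trace `B₁ ⊗ ⋯ ⊗ B_N → B_j` over all the fragments except the `j`-th one. -/
def traceAllBut {N : ℕ} (β : Fin N → Type u) (j : Fin N) :
    TraceClass (∀ i, β i) →ₗ[ℂ] TraceClass (β j) :=
  ptrace (β j) (∀ i : {i // i ≠ j}, β i) ∘ₗ relabel (Equiv.piSplitAt j β).symm

/-! ### Channels -/

/-- Complete positivity: for every `n`, the map `Λ ⊗ id` on `n × n` block matrices preserves
positivity. -/
def IsCompletelyPositive {ι : Type u} {κ : Type v} (Λ : TraceClass ι →ₗ[ℂ] TraceClass κ) : Prop :=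
  ∀ (n : ℕ) (X : Fin n → Fin n → TraceClass ι),
    (∀ x : Fin n → Hilb ι, 0 ≤ ∑ a, ∑ b, ⟪x a, (X a b : Op ι) (x b)⟫_ℂ) →
      ∀ y : Fin n → Hilb κ, 0 ≤ ∑ a, ∑ b, ⟪y a, (Λ (X a b) : Op κ) (y b)⟫_ℂ

/-- Completely positive trace-preserving maps. -/
structure IsChannel {ι : Type u} {κ : Type v} (Λ : TraceClass ι →ₗ[ℂ] TraceClass κ) : Prop where
  completelyPositive : IsCompletelyPositive Λ
  tracePreserving : ∀ X : TraceClass ι, tr (Λ X : Op κ) = tr (X : Op ι)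

/-- A discrete POVM with finitely many outcomes. -/
structure IsPOVM {ι : Type u} {K : ℕ} (M : Fin K → Op ι) : Prop where
  pos : ∀ k, (M k).IsPositive
  sum_eq_one : ∑ k, M k = 1

/-- The measure-and-prepare map `X ↦ ∑_k Tr(M_k X) σ_k`. -/
def measurePrepare {ι : Type u} {κ : Type v} {K : ℕ} (M : Fin K → Op ι)
    (σ : Fin K → TraceClass κ) : TraceClass ι →ₗ[ℂ] TraceClass κ :=
  ∑ k, (trMul (M k)).smulRight (σ k)

/-! ### The exponential cut-off diamond norm -/

/-- `Y = (Φ ⊗ id_C)[X]` for `C = Hilb κ`: this means that the blocks of `Y` with respect to `C` are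
the images under `Φ` of the blocks of `X`. There is at most one such bounded operator `Y`. -/
def IsAmpliation {ι : Type u} {ι' : Type v} {κ : Type w} (Φ : TraceClass ι →ₗ[ℂ] TraceClass ι')
    (X : TraceClass (ι × κ)) (Y : Op (ι' × κ)) : Prop :=
  ∀ c c' : κ, opBlock c c' Y = (Φ (block c c' X) : Op ι')

/-- `‖(Φ ⊗ id_C)[X]‖₁`, with value `∞` if `(Φ ⊗ id_C)[X]` is not a bounded operator. -/
def ampliationNorm {ι : Type u} {ι' : Type v} {κ : Type w} (Φ : TraceClass ι →ₗ[ℂ] TraceClass ι')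
    (X : TraceClass (ι × κ)) : ℝ≥0∞ :=
  ⨅ (Y : Op (ι' × κ)) (_ : IsAmpliation Φ X Y), traceNorm Y

/-- `Tr[ρ e^{ω n̂_A}]` for a positive operator `ρ` on `A ⊗ C`, where `A = Hilb ℕ` has the Fock
basis `|0⟩, |1⟩, …` and `n̂_A |n⟩ = n |n⟩`. -/
def expEnergy {κ : Type w} (ω : ℝ) (ρ : TraceClass (ℕ × κ)) : ℝ≥0∞ :=
  ∑' p : ℕ × κ, ENNReal.ofReal (Real.exp (ω * p.1) * (⟪ket p, (ρ : Op (ℕ × κ)) (ket p)⟫_ℂ).re)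

/-- The exponential cut-off diamond norm: the supremum of `‖(Φ ⊗ id_C)[ρ]‖₁` over all ancillas `C`
and all states `ρ` of `A ⊗ C` with `Tr[ρ e^{ω n̂_A}] ≤ Ω`. -/
def expDiamondNorm {ι : Type u} (ω Ω : ℝ) (Φ : TraceClass ℕ →ₗ[ℂ] TraceClass ι) : ℝ≥0∞ :=
  ⨆ (κ : Type w) (ρ : TraceClass (ℕ × κ)) (_ : IsState ρ)
    (_ : expEnergy ω ρ ≤ ENNReal.ofReal Ω), ampliationNorm Φ ρ

/-! ### The objectivity statement and the constants -/

/-- There are a POVM `{M_k}` on `A` and a set `S` of at least `(1 - δ) N` fragments such that, for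
every `j ∈ S`, the effective channel `Λ_j = Tr_{∖ B_j} ∘ Λ` is within `ε` of a measure-and-prepare
channel `X ↦ ∑_k Tr(M_k X) σ_{j,k}`, in the exponential cut-off diamond norm. -/
def ObjectiveWithin {N : ℕ} {β : Fin N → Type u} (Λ : TraceClass ℕ →ₗ[ℂ] TraceClass (∀ j, β j))
    (ω Ω δ ε : ℝ) : Prop :=
  ∃ (K : ℕ) (M : Fin K → Op ℕ) (S : Finset (Fin N)),
    IsPOVM M ∧ (1 - δ) * (N : ℝ) ≤ (S.card : ℝ) ∧
      ∀ j ∈ S, ∃ σ : Fin K → TraceClass (β j), (∀ k, IsState (σ k)) ∧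
        expDiamondNorm.{u, w} ω Ω (traceAllBut β j ∘ₗ Λ - measurePrepare M σ) ≤ ENNReal.ofReal ε

/-- `ñ = 1 / (e^ω - 1)`. -/
def nTilde (ω : ℝ) : ℝ := 1 / (Real.exp ω - 1)

/-- `d̃ = Ω e^ω / (e^ω - 1)`. -/
def dTilde (ω Ω : ℝ) : ℝ := Ω * Real.exp ω / (Real.exp ω - 1)

/-- `s = (ñ + 1) ln (ñ + 1) - ñ ln ñ`, the entropy (in nats) of the Gibbs state of mean `ñ`. -/
def thermalEntropy (ω : ℝ) : ℝ :=
  (nTilde ω + 1) * Real.log (nTilde ω + 1) - nTilde ω * Real.log (nTilde ω)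

/-- `ς = (ñ + 1) log₂ (ñ + 1) - ñ log₂ ñ`, the same entropy in bits. -/
def thermalEntropyBits (ω : ℝ) : ℝ :=
  (nTilde ω + 1) * Real.logb 2 (nTilde ω + 1) - nTilde ω * Real.logb 2 (nTilde ω)

/-- `γ₁ = 2 d̃² s / (3 ω⁴)`. -/
def gamma₁ (ω Ω : ℝ) : ℝ := 2 * dTilde ω Ω ^ 2 * thermalEntropy ω / (3 * ω ^ 4)

/-- `γ₂ = 3 d̃ ω⁴ / (16 s)`. -/
def gamma₂ (ω Ω : ℝ) : ℝ := 3 * dTilde ω Ω * ω ^ 4 / (16 * thermalEntropy ω)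

/-- `ζ(d) = (27 ln 2 · d̃² d⁴ ς / N)^{1/3} + 4 √(d̃² / e^{ω d})`. -/
def zeta (ω Ω : ℝ) (N d : ℕ) : ℝ :=
  (27 * Real.log 2 * dTilde ω Ω ^ 2 * (d : ℝ) ^ 4 * thermalEntropyBits ω / N) ^ (1 / 3 : ℝ)
    + 4 * Real.sqrt (dTilde ω Ω ^ 2 / Real.exp (ω * d))

end QDarwin

end

open QDarwin

noncomputable section

namespace QDarwin

open ContinuousLinearMap (adjoint)

/-! ### Matrix elements -/

/-! Quantum information about the input cannot spread into many fragments: once the record held by a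
few fragments has been read out, the other fragments depend on the input only through that record.
The proof measures fragments greedily and controls the process by a potential.

Weight the Fock states by the thermal law `lam n = (1 - e^{-ω}) e^{-ωn}`, `n < d`. A projective
measurement `E z` of some fragments splits this weighted input into conditional pieces; the
potential is the sum over `z` of `purity`, the average purity of the pieces. It is at most `1`
(`purity_le_mass`) and, with no measurement, at least `(1 - e^{-ω})^2` (`purity_one_ge`), so at most
`2 e^{-ω}` can be gained. Measuring one more fragment, by a projection that may depend on `z`, never
lowers it, and `purity_gain` gives the increase exactly, as a variance of matrix elements. If no
fragment outside the measured set `J` can gain more than `κ^2`, the effects `Λ†(E z)` (truncated)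
form a POVM that serves all the fragments outside `J`. The choice `κ^2 = 2 e^{-ω} / (δN)` makes this
happen while `|J| ≤ δN` (`objectiveWithin_truncation`).

The link between purity and distance is `exists_refinement`. The Jordan projection of the residual,
the conditional dynamics minus preparation of the conditional state, is itself a legitimate
measurement of the fragment. Its outcomes deviate from independence by at least a fixed multiple of
the trace norm of the residual, and Cauchy–Schwarz turns this deviation into a purity gain. Small
gains thus force small residuals on all truncated matrix units.

From matrix units to the cut-off diamond norm, everything passes through `Dominated`: a difference
of two completely positive maps has ampliated trace norm at most the sum of the two traces, and a
diagonal weight `α + β e^{ωn}` on these traces costs `α + βΩ`. Truncation at `d` costs `4 √(Ω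
e^{-ωd})`, the matrix units cost `√2 κ d d̃` (`expDiamondNorm_sub_le`).

The entropy `s` enters only through `2 e^{-ω} ≤ s`. The stated bounds then follow by choosing `d`;
whenever they reach `2`, the diameter of the set of channels, there is nothing to prove. -/

theorem inner_ket_right {ι : Type u} (i : ι) (x : Hilb ι) :
    ⟪x, ket i⟫_ℂ = (starRingEnd ℂ) (coord x i) := by
  rw [← inner_ket, inner_conj_symm]

theorem hilb_ext {ι : Type u} {x y : Hilb ι} (h : ∀ i, coord x i = coord y i) : x = y :=
  lp.ext (funext h)

open Classical in
theorem coord_ket {ι : Type u} (i j : ι) : coord (ket j) i = if i = j then 1 else 0 := by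
  simp [coord, ket, lp.single_apply, Pi.single_apply]

theorem hasSum_inner_coord {ι : Type u} (x y : Hilb ι) :
    HasSum (fun i => (starRingEnd ℂ) (coord x i) * coord y i) ⟪x, y⟫_ℂ := by
  have h := lp.hasSum_inner (𝕜 := ℂ) (G := fun _ : ι => ℂ) x y
  refine h.congr_fun fun i => ?_
  simp [coord, mul_comm]

theorem norm_ket {ι : Type u} (i : ι) : ‖ket i‖ = 1 := by
  have h : (‖ket i‖ : ℂ) ^ 2 = 1 := by
    rw [← Complex.coe_algebraMap, ← inner_self_eq_norm_sq_to_K, inner_ket, coord_ket, if_pos rfl]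
  have h' : ‖ket i‖ ^ 2 = 1 := by exact_mod_cast h
  exact (pow_eq_one_iff_of_nonneg (norm_nonneg _) two_ne_zero).1 h'

/-- Operators with the same matrix elements are equal. -/
theorem op_ext {ι : Type u} {κ : Type v} {S T : Hilb ι →L[ℂ] Hilb κ}
    (h : ∀ k i, ⟪ket k, S (ket i)⟫_ℂ = ⟪ket k, T (ket i)⟫_ℂ) : S = T := by
  have h1 (i : ι) : S (ket i) = T (ket i) :=
    hilb_ext fun k => by rw [← inner_ket, ← inner_ket, h]
  have h2 (k : κ) : adjoint S (ket k) = adjoint T (ket k) := by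
    refine hilb_ext fun i => ?_
    rw [← inner_ket, ← inner_ket, ContinuousLinearMap.adjoint_inner_right,
      ContinuousLinearMap.adjoint_inner_right, h1]
  ext1 x
  refine hilb_ext fun k => ?_
  rw [← inner_ket, ← inner_ket, ← ContinuousLinearMap.adjoint_inner_left, h2,
    ContinuousLinearMap.adjoint_inner_left]

/-! ### Traces of products -/

theorem isPositive_of_inner_nonneg {ι : Type u} {T : Op ι} (h : ∀ x, 0 ≤ ⟪x, T x⟫_ℂ) :
    T.IsPositive := by
  rw [ContinuousLinearMap.isPositive_iff_complex]
  intro x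
  have h0 := h x
  rw [← inner_conj_symm] at h0
  have h1 : 0 ≤ ⟪T x, x⟫_ℂ := by simpa using star_nonneg_iff.2 h0
  obtain ⟨hre, him⟩ := Complex.nonneg_iff.1 h1
  exact ⟨Complex.ext (by simp) (by simpa using him), hre⟩

theorem summable_sq_coord {ι : Type u} {κ : Type v} (S : Hilb ι →L[ℂ] Hilb κ)
    (hS : ∑' i, ENNReal.ofReal (‖S (ket i)‖ ^ 2) ≠ ∞) :
    Summable fun p : ι × κ => ‖⟪ket p.2, S (ket p.1)⟫_ℂ‖ ^ 2 := by
  have h : ∑' p : ι × κ, ENNReal.ofReal (‖⟪ket p.2, S (ket p.1)⟫_ℂ‖ ^ 2) ≠ ∞ := by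
    rw [ENNReal.tsum_prod' (f := fun p : ι × κ => ENNReal.ofReal (‖⟪ket p.2, S (ket p.1)⟫_ℂ‖ ^ 2))]
    simpa only [inner_ket, parseval] using hS
  exact (ENNReal.summable_toReal h).congr fun p => ENNReal.toReal_ofReal (by positivity)

theorem inner_comp_ket {ι : Type u} {κ : Type v} {μ : Type w} (S : Hilb ι →L[ℂ] Hilb κ)
    (T : Hilb μ →L[ℂ] Hilb ι) (k : κ) (m : μ) :
    HasSum (fun i => ⟪ket k, S (ket i)⟫_ℂ * ⟪ket i, T (ket m)⟫_ℂ) ⟪ket k, (S ∘L T) (ket m)⟫_ℂ := by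
  rw [ContinuousLinearMap.comp_apply, ← ContinuousLinearMap.adjoint_inner_left]
  refine (hasSum_inner_coord _ _).congr_fun fun i => ?_
  rw [← inner_ket_right, ContinuousLinearMap.adjoint_inner_left, ← inner_ket i]

/-- Both factors are Hilbert–Schmidt, so `2|ab| ≤ |a|² + |b|²` makes the double series of matrix
elements absolutely summable and the order of summation can be exchanged. -/
theorem tr_comp_comm {ι : Type u} {κ : Type v} (S : Hilb ι →L[ℂ] Hilb κ) (T : Hilb κ →L[ℂ] Hilb ι)
    (hS : ∑' i, ENNReal.ofReal (‖S (ket i)‖ ^ 2) ≠ ∞)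
    (hT : ∑' k, ENNReal.ofReal (‖T (ket k)‖ ^ 2) ≠ ∞) : tr (S ∘L T) = tr (T ∘L S) := by
  have hsum : Summable (Function.uncurry
      fun (i : ι) (k : κ) => ⟪ket k, S (ket i)⟫_ℂ * ⟪ket i, T (ket k)⟫_ℂ) := by
    have h1 := summable_sq_coord S hS
    have h2 := (Equiv.prodComm ι κ).summable_iff.2 (summable_sq_coord T hT)
    refine Summable.of_norm_bounded (h1.add h2) fun p => ?_
    simp only [Function.uncurry, norm_mul, Function.comp, Equiv.prodComm_apply, Prod.fst_swap,
      Prod.snd_swap]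
    nlinarith [sq_nonneg (‖⟪ket p.2, S (ket p.1)⟫_ℂ‖ - ‖⟪ket p.1, T (ket p.2)⟫_ℂ‖),
      sq_nonneg ‖⟪ket p.2, S (ket p.1)⟫_ℂ‖, sq_nonneg ‖⟪ket p.1, T (ket p.2)⟫_ℂ‖]
  unfold tr
  calc _ = ∑' k, ∑' i, ⟪ket k, S (ket i)⟫_ℂ * ⟪ket i, T (ket k)⟫_ℂ :=
        tsum_congr fun k => (inner_comp_ket S T k k).tsum_eq.symm
    _ = ∑' i, ∑' k, ⟪ket k, S (ket i)⟫_ℂ * ⟪ket i, T (ket k)⟫_ℂ := hsum.tsum_comm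
    _ = _ := tsum_congr fun i => by
        rw [← (inner_comp_ket T S i i).tsum_eq]
        exact tsum_congr fun k => mul_comm _ _

theorem posTrace_ne_top {ι : Type u} {X : Op ι} (h : X ∈ TraceClass ι) :
    posTrace X ≠ ∞ := by
  have h1 := (summable_diag h).mapL Complex.reCLM
  exact h1.tsum_ofReal_ne_top

theorem tr_eq_posTrace {ι : Type u} {X : Op ι} (hX : X.IsPositive) (h : X ∈ TraceClass ι) :
    tr X = ((posTrace X).toReal : ℂ) := by
  have h1 := (summable_diag h).mapL Complex.reCLM
  have h2 : (posTrace X).toReal = ∑' i, (⟪ket i, X (ket i)⟫_ℂ).re := by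
    unfold posTrace
    rw [← ENNReal.ofReal_tsum_of_nonneg (fun i => diag_nonneg hX i) h1,
      ENNReal.toReal_ofReal (tsum_nonneg fun i => diag_nonneg hX i)]
  rw [h2, tr, Complex.ofReal_tsum]
  refine tsum_congr fun i => ?_
  exact (Complex.eq_re_of_ofReal_le (r := 0) (by simpa using hX.inner_nonneg_right (ket i)))

theorem sum_sq_comp_ne_top {ι : Type u} {κ : Type v} {μ : Type w} (S : Hilb κ →L[ℂ] Hilb μ)
    {R : Hilb ι →L[ℂ] Hilb κ} (hR : ∑' i, ENNReal.ofReal (‖R (ket i)‖ ^ 2) ≠ ∞) :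
    ∑' i, ENNReal.ofReal (‖(S ∘L R) (ket i)‖ ^ 2) ≠ ∞ := by
  refine ne_top_of_le_ne_top
    (ENNReal.mul_ne_top (a := ENNReal.ofReal (‖S‖ ^ 2)) ENNReal.ofReal_ne_top hR) ?_
  rw [← ENNReal.tsum_mul_left]
  refine ENNReal.tsum_le_tsum fun i => ?_
  rw [← ENNReal.ofReal_mul (by positivity), ← mul_pow]
  exact ENNReal.ofReal_le_ofReal (pow_le_pow_left₀ (norm_nonneg _) (S.le_opNorm _) 2)

/-- Writing `X = R R` with `R` Hilbert–Schmidt, both sides rotate to the trace of `R V† W R`. -/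
theorem tr_compress_of_isPositive {ι : Type u} {κ : Type v} (W V : Hilb ι →L[ℂ] Hilb κ) {X : Op ι}
    (hX : X.IsPositive) (hf : posTrace X ≠ ∞) :
    tr (W ∘L X ∘L adjoint V) = tr ((adjoint V ∘L W) ∘L X) := by
  obtain ⟨R, hR, rfl⟩ := exists_sqrt hX
  have hR2 := hf
  rw [posTrace_sq hR] at hR2
  have hright : ∑' k, ENNReal.ofReal (‖(R ∘L adjoint V) (ket k)‖ ^ 2) ≠ ∞ := by
    have h := ne_top_of_le_ne_top
      (ENNReal.mul_ne_top ENNReal.ofReal_ne_top hf) (posTrace_conj_le hX V)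
    convert h using 1
    unfold posTrace
    refine tsum_congr fun k => ?_
    rw [ContinuousLinearMap.comp_apply, ContinuousLinearMap.comp_apply V,
      ← ContinuousLinearMap.adjoint_inner_left V, ContinuousLinearMap.comp_apply, re_inner_sq hR]
  have e1 := tr_comp_comm (W ∘L R) (R ∘L adjoint V) (sum_sq_comp_ne_top W hR2) hright
  have e2 := tr_comp_comm ((adjoint V ∘L W) ∘L R) R (sum_sq_comp_ne_top _ hR2) hR2
  exact e1.trans e2.symm

theorem comp_mem {ι : Type u} (M : Op ι) {X : Op ι} (hX : X ∈ TraceClass ι) :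
    M ∘L X ∈ TraceClass ι := by
  have h0 := compress_mem M (.id ℂ _) hX
  rwa [ContinuousLinearMap.adjoint_id, ContinuousLinearMap.comp_id] at h0

theorem tr_add {ι : Type u} {X Y : Op ι} (hX : X ∈ TraceClass ι) (hY : Y ∈ TraceClass ι) :
    tr (X + Y) = tr X + tr Y := by
  have := (summable_diag hX).tsum_add (summable_diag hY)
  simpa [tr, inner_add_right] using this

theorem tr_smul {ι : Type u} (a : ℂ) (X : Op ι) : tr (a • X) = a * tr X := by
  simp [tr, tsum_mul_left]

/-- Cyclicity of the trace. -/
theorem tr_compress {ι : Type u} {κ : Type v} (W V : Hilb ι →L[ℂ] Hilb κ) {X : Op ι}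
    (hX : X ∈ TraceClass ι) :
    tr (W ∘L X ∘L adjoint V) = tr ((adjoint V ∘L W) ∘L X) := by
  induction hX using Submodule.span_induction with
  | zero => simp [tr]
  | add x y hx hy hx' hy' =>
    rw [ContinuousLinearMap.add_comp, ContinuousLinearMap.comp_add, ContinuousLinearMap.comp_add,
      tr_add (compress_mem _ _ hx) (compress_mem _ _ hy), tr_add (comp_mem _ hx) (comp_mem _ hy),
      hx', hy']
  | smul a x hx hx' =>
    rw [ContinuousLinearMap.smul_comp, ContinuousLinearMap.comp_smul,
      ContinuousLinearMap.comp_smul, tr_smul, tr_smul, hx']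
  | mem X hX => exact tr_compress_of_isPositive W V hX.1 hX.2

theorem trMul_apply {ι : Type u} (M : Op ι) (X : TraceClass ι) :
    trMul M X = tr (M ∘L (X : Op ι)) := rfl

theorem trMul_one {ι : Type u} (X : TraceClass ι) : trMul 1 X = tr (X : Op ι) := rfl

theorem trMul_compress {ι : Type u} {κ : Type v} (Q : Op κ) (W V : Hilb ι →L[ℂ] Hilb κ)
    (X : TraceClass ι) : trMul Q (compress W V X) = trMul (adjoint V ∘L Q ∘L W) X :=
  tr_compress (Q ∘L W) V X.2

theorem trMul_add {ι : Type u} (M M' : Op ι) (X : TraceClass ι) :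
    trMul (M + M') X = trMul M X + trMul M' X := by
  simp only [trMul_apply, ContinuousLinearMap.add_comp]
  exact tr_add (comp_mem _ X.2) (comp_mem _ X.2)

theorem trMul_sum {ι : Type u} {α : Type*} (s : Finset α) (M : α → Op ι) (X : TraceClass ι) :
    trMul (∑ a ∈ s, M a) X = ∑ a ∈ s, trMul (M a) X := by
  classical
  induction s using Finset.induction_on with
  | empty => simp [trMul_apply, tr]
  | insert a s ha ih => rw [Finset.sum_insert ha, Finset.sum_insert ha, trMul_add, ih]

theorem tr_nonneg {ι : Type u} {X : Op ι} (hX : X.IsPositive) (h : X ∈ TraceClass ι) :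
    0 ≤ tr X := by
  rw [tr_eq_posTrace hX h]
  exact_mod_cast ENNReal.toReal_nonneg

theorem posTrace_eq_ofReal {ι : Type u} {X : Op ι} (hX : X.IsPositive) (h : X ∈ TraceClass ι) :
    posTrace X = ENNReal.ofReal (tr X).re := by
  rw [tr_eq_posTrace hX h, Complex.ofReal_re, ENNReal.ofReal_toReal (posTrace_ne_top h)]

/-- With `M = R R`, cyclicity turns `Tr(M X)` into `Tr(R X R)`. -/
theorem trMul_nonneg {ι : Type u} {M : Op ι} (hM : M.IsPositive) {X : TraceClass ι}
    (hX : (X : Op ι).IsPositive) : 0 ≤ trMul M X := by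
  obtain ⟨R, hR, rfl⟩ := exists_sqrt hM
  have h := trMul_compress 1 R R X
  have h2 : adjoint R ∘L 1 ∘L R = R ∘L R := by rw [hR]; rfl
  rw [h2] at h
  rw [← h, trMul_one]
  exact tr_nonneg (hX.conj_adjoint R) (compress R R X).2

/-- `⟨x|X|y⟩ = Tr(|y⟩⟨x| X)`. -/
theorem trMul_rankOne {ι : Type u} (x y : Hilb ι) (X : TraceClass ι) :
    trMul (InnerProductSpace.rankOne ℂ y x) X = ⟪x, (X : Op ι) y⟫_ℂ := by
  rw [trMul_apply, tr, ← ContinuousLinearMap.adjoint_inner_left, ← (hasSum_inner_coord _ _).tsum_eq]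
  refine tsum_congr fun i => ?_
  rw [ContinuousLinearMap.comp_apply, InnerProductSpace.rankOne_apply, inner_smul_right,
    ← inner_ket_right, ContinuousLinearMap.adjoint_inner_left, inner_ket]

theorem traceClass_ext {ι : Type u} {X Y : TraceClass ι} (h : ∀ Q, trMul Q X = trMul Q Y) :
    X = Y := by
  refine Subtype.ext (op_ext fun k i => ?_)
  rw [← trMul_rankOne, ← trMul_rankOne, h]

/-! ### Jordan decomposition and the trace norm -/

/-- `Q` projects onto the closed range of `T⁺`, which lies in the kernel of `T⁻` because `T⁻ T⁺ =
0`. An honest projection is needed, and not just the two parts: it later becomes the measurement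
made on a fragment. -/
theorem exists_jordan_projection {ι : Type u} {T : Op ι} (hT : IsSelfAdjoint T) :
    ∃ Q : Op ι, IsStarProjection Q ∧ Q * T = T⁺ ∧ (1 - Q) * T = -T⁻ ∧
      Q * T * Q = T⁺ ∧ (1 - Q) * T * (1 - Q) = -T⁻ := by
  let K : Submodule ℂ (Hilb ι) := (LinearMap.range (T⁺ : Op ι).toLinearMap).topologicalClosure
  have : CompleteSpace K := (Submodule.isClosed_topologicalClosure _).completeSpace_coe
  let Q : Op ι := K.starProjection
  have hQ : IsStarProjection Q := isStarProjection_starProjection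
  have hp : IsSelfAdjoint (T⁺ : Op ι) := (CFC.posPart_nonneg T).isSelfAdjoint
  have hn : IsSelfAdjoint (T⁻ : Op ι) := (CFC.negPart_nonneg T).isSelfAdjoint
  have h1 : Q * T⁺ = T⁺ := by
    ext1 x
    exact Submodule.starProjection_eq_self_iff.2 (Submodule.le_topologicalClosure _ ⟨x, rfl⟩)
  have h2 : T⁻ * Q = 0 := by
    have hK : K ≤ LinearMap.ker (T⁻ : Op ι).toLinearMap := by
      refine Submodule.topologicalClosure_minimal _ ?_ (ContinuousLinearMap.isClosed_ker _)
      rintro _ ⟨x, rfl⟩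
      exact congrArg (fun S : Op ι => S x) (CFC.negPart_mul_posPart T)
    ext1 x
    exact hK (Submodule.starProjection_apply_mem K x)
  have h3 : T⁺ * Q = T⁺ := by
    have := congrArg star h1
    rwa [star_mul, hp.star_eq, hQ.isSelfAdjoint.star_eq] at this
  have h4 : Q * T⁻ = 0 := by
    have := congrArg star h2
    rwa [star_mul, hn.star_eq, hQ.isSelfAdjoint.star_eq, star_zero] at this
  have e := CFC.posPart_sub_negPart T hT
  have e1 : Q * T = T⁺ := by nth_rewrite 1 [← e]; rw [mul_sub, h1, h4, sub_zero]
  have e2 : (1 - Q) * T = -T⁻ := by rw [sub_mul, one_mul, e1]; nth_rewrite 1 [← e]; abel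
  refine ⟨Q, hQ, e1, e2, by rw [e1, h3], ?_⟩
  rw [e2, mul_sub, mul_one, neg_mul, h2, neg_zero, sub_zero]

theorem posTrace_add {ι : Type u} {X Y : Op ι} (hX : X.IsPositive) (hY : Y.IsPositive) :
    posTrace (X + Y) = posTrace X + posTrace Y := by
  unfold posTrace
  rw [← ENNReal.tsum_add]
  refine tsum_congr fun i => ?_
  rw [← ENNReal.ofReal_add (diag_nonneg hX i) (diag_nonneg hY i)]
  simp

theorem posTrace_mono {ι : Type u} {X Y : Op ι} (h : X ≤ Y) : posTrace X ≤ posTrace Y := by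
  refine ENNReal.tsum_le_tsum fun i => ENNReal.ofReal_le_ofReal ?_
  have := diag_nonneg h i
  simp only [sub_apply, inner_sub_right, Complex.sub_re] at this
  linarith

theorem posTrace_projection_conj_le {ι : Type u} {X Q : Op ι} (hX : X.IsPositive)
    (hQ : IsStarProjection Q) : posTrace (Q * X * Q) ≤ posTrace X := by
  have h := posTrace_conj_le hX Q
  rw [show adjoint Q = Q from hQ.isSelfAdjoint.star_eq] at h
  refine h.trans ?_
  have h1 : ‖Q‖ ≤ 1 := hQ.norm_le
  calc _ ≤ ENNReal.ofReal 1 * posTrace X := by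
        gcongr
        exact pow_le_one₀ (norm_nonneg _) h1
    _ = posTrace X := by simp

/-- The trace norm of a difference of positive operators. -/
theorem traceNorm_sub_le {ι : Type u} {P R : Op ι} (hP : P.IsPositive) (hR : R.IsPositive) :
    traceNorm (P - R) ≤ posTrace P + posTrace R := by
  have hT : IsSelfAdjoint (P - R) := hP.isSelfAdjoint.sub hR.isSelfAdjoint
  obtain ⟨Q, hQ, -, -, h1, h2⟩ := exists_jordan_projection hT
  have hconj {S X : Op ι} (hS : IsStarProjection S) (hX : X.IsPositive) : 0 ≤ S * X * S := by
    have := hX.conj_adjoint S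
    rw [show adjoint S = S from hS.isSelfAdjoint.star_eq] at this
    exact (ContinuousLinearMap.nonneg_iff_isPositive _).2 this
  rw [traceNorm, ← CFC.posPart_add_negPart _ hT, posTrace_add
    ((ContinuousLinearMap.nonneg_iff_isPositive _).1 (CFC.posPart_nonneg (P - R)))
    ((ContinuousLinearMap.nonneg_iff_isPositive _).1 (CFC.negPart_nonneg (P - R)))]
  -- Compression by `Q` gives the positive part as `Q P Q - Q R Q`; the subtracted term is dropped.
  -- The negative part is treated in the same way with `1 - Q`.
  have e1 : (P - R)⁺ ≤ Q * P * Q := by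
    have : (P - R)⁺ = Q * P * Q - Q * R * Q := by rw [← h1]; noncomm_ring
    rw [this]
    exact sub_le_self _ (hconj hQ hR)
  have e2 : (P - R)⁻ ≤ (1 - Q) * R * (1 - Q) := by
    have : (P - R)⁻ = (1 - Q) * R * (1 - Q) - (1 - Q) * P * (1 - Q) := by
      rw [← neg_neg (P - R)⁻, ← h2]; noncomm_ring
    rw [this]
    exact sub_le_self _ (hconj hQ.one_sub hP)
  exact add_le_add ((posTrace_mono e1).trans (posTrace_projection_conj_le hP hQ))
    ((posTrace_mono e2).trans (posTrace_projection_conj_le hR hQ.one_sub))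

/-- The Jordan decomposition of a self-adjoint trace class operator. -/
theorem exists_jordan {ι : Type u} (A : TraceClass ι) (hA : IsSelfAdjoint (A : Op ι)) :
    ∃ (Q : Op ι) (P R : TraceClass ι), IsStarProjection Q ∧ (P : Op ι).IsPositive ∧
      (R : Op ι).IsPositive ∧ A = P - R ∧ tr (P : Op ι) = trMul Q A ∧
      tr (R : Op ι) = -trMul (1 - Q) A := by
  obtain ⟨Q, hQ, h1, h2, -, -⟩ := exists_jordan_projection hA
  refine ⟨Q, ⟨Q ∘L A, comp_mem Q A.2⟩, -⟨(1 - Q) ∘L A, comp_mem _ A.2⟩, hQ, ?_, ?_, ?_, rfl, ?_⟩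
  · exact (ContinuousLinearMap.nonneg_iff_isPositive _).1
      ((CFC.posPart_nonneg (A : Op ι)).trans_eq h1.symm)
  · refine (ContinuousLinearMap.nonneg_iff_isPositive _).1
      ((CFC.negPart_nonneg (A : Op ι)).trans_eq ?_)
    exact (neg_eq_iff_eq_neg.2 h2).symm
  · refine Subtype.ext ?_
    ext1 x
    simp
  · rw [trMul_apply, ← neg_one_mul, ← tr_smul, neg_one_smul]
    rfl

/-! ### Operators with prescribed blocks -/

open Classical in
theorem restrict_comp_adjoint {ι : Type u} {κ : Type v} (c c' : κ) :
    restrict (inLeft (ι := ι) c) ∘L adjoint (restrict (inLeft c')) = if c = c' then 1 else 0 := by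
  refine op_ext fun k i => ?_
  rw [ContinuousLinearMap.comp_apply, adjoint_restrict_ket, inner_ket, coord_restrict, coord_ket]
  have e : inLeft (ι := ι) c k = inLeft c' i ↔ k = i ∧ c = c' := Prod.mk_inj
  simp only [e]
  by_cases h : c = c'
  · rw [if_pos h, show (1 : Op ι) (ket i) = ket i from rfl, inner_ket, coord_ket]
    simp [h]
  · simp [h]

theorem ket_eq_adjoint_restrict {ι : Type u} {κ : Type v} (p : ι × κ) :
    ket p = adjoint (restrict (inLeft p.2)) (ket p.1) := by
  rw [adjoint_restrict_ket]; rfl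

theorem inner_opBlock {ι : Type u} {κ : Type v} (c c' : κ) (X : Op (ι × κ)) (x y : Hilb ι) :
    ⟪x, opBlock c c' X y⟫_ℂ =
      ⟪adjoint (restrict (inLeft c)) x, X (adjoint (restrict (inLeft c')) y)⟫_ℂ := by
  rw [ContinuousLinearMap.adjoint_inner_left]; rfl

theorem opBlock_ext {ι : Type u} {κ : Type v} {X Y : Op (ι × κ)}
    (h : ∀ c c', opBlock c c' X = opBlock c c' Y) : X = Y := by
  refine op_ext fun p p' => ?_
  rw [ket_eq_adjoint_restrict p, ket_eq_adjoint_restrict p', ← inner_opBlock, ← inner_opBlock, h]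

/-- The projection onto the blocks in `F`. -/
def blockProj {ι : Type u} {κ : Type v} (F : Finset κ) : Op (ι × κ) :=
  ∑ c ∈ F, adjoint (restrict (inLeft c)) ∘L restrict (inLeft c)

open Classical in
theorem restrict_comp_blockProj {ι : Type u} {κ : Type v} (F : Finset κ) (c : κ) :
    restrict (inLeft (ι := ι) c) ∘L blockProj F = if c ∈ F then restrict (inLeft c) else 0 := by
  rw [blockProj, ContinuousLinearMap.comp_finsetSum]
  simp_rw [← ContinuousLinearMap.comp_assoc, restrict_comp_adjoint]
  rw [Finset.sum_congr rfl (g := fun c' => if c = c' then restrict (inLeft c) else 0)]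
  · simp
  · intro c' _
    split_ifs with h
    · rw [h]; exact ContinuousLinearMap.id_comp _
    · exact ContinuousLinearMap.zero_comp _

theorem adjoint_blockProj {ι : Type u} {κ : Type v} (F : Finset κ) :
    adjoint (blockProj (ι := ι) F) = blockProj F := by
  simp [blockProj, ContinuousLinearMap.adjoint_comp]

open Classical in
theorem blockProj_comp_adjoint {ι : Type u} {κ : Type v} (F : Finset κ) (c : κ) :
    blockProj F ∘L adjoint (restrict (inLeft (ι := ι) c)) =
      if c ∈ F then adjoint (restrict (inLeft c)) else 0 := by
  have := congrArg adjoint (restrict_comp_blockProj (ι := ι) F c)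
  rw [ContinuousLinearMap.adjoint_comp, adjoint_blockProj] at this
  rw [this]
  split_ifs <;> simp

theorem isStarProjection_blockProj {ι : Type u} {κ : Type v} (F : Finset κ) :
    IsStarProjection (blockProj (ι := ι) F) := by
  refine ⟨?_, adjoint_blockProj F⟩
  change blockProj F ∘L blockProj F = blockProj F
  nth_rewrite 1 [blockProj]
  nth_rewrite 2 [blockProj]
  rw [ContinuousLinearMap.finsetSum_comp]
  refine Finset.sum_congr rfl fun c hc => ?_
  rw [ContinuousLinearMap.comp_assoc, restrict_comp_blockProj, if_pos hc]

open Classical in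
theorem opBlock_compl_blockProj {ι : Type u} {κ : Type v} (F : Finset κ) (A : Op (ι × κ)) (c : κ) :
    opBlock c c ((1 - blockProj F) * A * (1 - blockProj F)) =
      if c ∈ F then 0 else opBlock c c A := by
  have h1 : restrict (inLeft (ι := ι) c) ∘L (1 - blockProj F) =
      if c ∈ F then 0 else restrict (inLeft c) := by
    rw [ContinuousLinearMap.comp_sub, restrict_comp_blockProj,
      show restrict (inLeft c) ∘L (1 : Op (ι × κ)) = restrict (inLeft c) from rfl]
    split_ifs <;> simp
  have h2 : (1 - blockProj F) ∘L adjoint (restrict (inLeft (ι := ι) c)) =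
      if c ∈ F then 0 else adjoint (restrict (inLeft c)) := by
    rw [ContinuousLinearMap.sub_comp, blockProj_comp_adjoint, show
      (1 : Op (ι × κ)) ∘L adjoint (restrict (inLeft c)) = adjoint (restrict (inLeft c)) from rfl]
    split_ifs <;> simp
  change (restrict (inLeft c) ∘L (1 - blockProj F)) ∘L A ∘L
    ((1 - blockProj F) ∘L adjoint (restrict (inLeft c))) = _
  rw [h1, h2]
  split_ifs
  · simp
  · rfl

/-- The operator whose blocks are `Z c c'` for `c, c' ∈ F`, and vanish otherwise. -/
def blockSum {ι : Type u} {κ : Type v} (Z : κ → κ → Op ι) (F : Finset κ) : Op (ι × κ) :=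
  ∑ c ∈ F, ∑ c' ∈ F, adjoint (restrict (inLeft c)) ∘L Z c c' ∘L restrict (inLeft c')

open Classical in
theorem opBlock_blockSum {ι : Type u} {κ : Type v} (Z : κ → κ → Op ι) (F : Finset κ) (c c' : κ) :
    opBlock c c' (blockSum Z F) = if c ∈ F ∧ c' ∈ F then Z c c' else 0 := by
  have h (a b : κ) : restrict (inLeft (ι := ι) c) ∘L
      (adjoint (restrict (inLeft a)) ∘L Z a b ∘L restrict (inLeft b)) ∘L
      adjoint (restrict (inLeft c')) = if a = c then if b = c' then Z c c' else 0 else 0 := by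
    have e : restrict (inLeft (ι := ι) c) ∘L
      (adjoint (restrict (inLeft a)) ∘L Z a b ∘L restrict (inLeft b)) ∘L
      adjoint (restrict (inLeft c')) = (restrict (inLeft (ι := ι) c) ∘L
        adjoint (restrict (inLeft a))) ∘L Z a b ∘L (restrict (inLeft (ι := ι) b) ∘L
        adjoint (restrict (inLeft c'))) := rfl
    rw [e, restrict_comp_adjoint, restrict_comp_adjoint]
    by_cases h1 : c = a <;> by_cases h2 : b = c'
    · subst h1 h2; simp only [if_true]; rfl
    · simp [h2]
    · simp [h1, Ne.symm h1]
    · simp [h2]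
  simp only [opBlock, blockSum, ContinuousLinearMap.finsetSum_comp,
    ContinuousLinearMap.comp_finsetSum, h]
  by_cases h1 : c ∈ F <;> by_cases h2 : c' ∈ F <;> simp [h1, h2]

theorem blockSum_isPositive {ι : Type u} {κ : Type v} {Z : κ → κ → Op ι} {F : Finset κ}
    (hZ : ∀ y : κ → Hilb ι, 0 ≤ ∑ c ∈ F, ∑ c' ∈ F, ⟪y c, Z c c' (y c')⟫_ℂ) :
    (blockSum Z F).IsPositive := by
  refine isPositive_of_inner_nonneg fun x => ?_
  refine (hZ fun c => restrict (inLeft c) x).trans_eq ?_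
  simp only [blockSum, FunLike.coe_sum, Finset.sum_apply, inner_sum,
    ContinuousLinearMap.comp_apply, ContinuousLinearMap.adjoint_inner_right]

/-- A gentle-measurement estimate. With `A = R R` and `S = 1 - P`, the difference is `S R R + P R R
S`, where `‖R‖²` and `‖R S‖²` are at most the traces of `A` and of `S A S`. It will make finite
block sums converge in operator norm. -/
theorem norm_sub_compression_sq_le {ι : Type u} {A P : Op ι} (hA : A.IsPositive)
    (hP : IsStarProjection P) (hf : posTrace A ≠ ∞) :
    ‖A - P * A * P‖ ^ 2 ≤
      4 * ((posTrace A).toReal * (posTrace ((1 - P) * A * (1 - P))).toReal) := by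
  obtain ⟨R, hR, rfl⟩ := exists_sqrt hA
  have hS := hP.one_sub
  set S := 1 - P with hSdef
  have hSs : adjoint S = S := hS.isSelfAdjoint.star_eq
  have h1 : ‖R‖ * ‖R‖ ≤ (posTrace (R ∘L R)).toReal := by
    have := norm_le_posTrace hA hf
    rwa [show ‖R ∘L R‖ = ‖R‖ * ‖R‖ from by
      nth_rewrite 1 [← hR]; exact ContinuousLinearMap.norm_adjoint_comp_self R] at this
  have hpos : (S * (R ∘L R) * S).IsPositive := by
    have := hA.conj_adjoint S
    rwa [hSs] at this
  have h2 : ‖R * S‖ * ‖R * S‖ ≤ (posTrace (S * (R ∘L R) * S)).toReal := by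
    have := norm_le_posTrace hpos
      (ne_top_of_le_ne_top hf (posTrace_projection_conj_le hA hS))
    have e : S * (R ∘L R) * S = adjoint (R * S) ∘L (R * S) := by
      change _ = adjoint (R ∘L S) ∘L (R ∘L S)
      rw [ContinuousLinearMap.adjoint_comp, hR, hSs]; rfl
    rwa [e, ContinuousLinearMap.norm_adjoint_comp_self, ← e] at this
  have h3 : ‖S * R‖ = ‖R * S‖ := by
    rw [← norm_star (R * S), star_mul, show star R = R from hR, show star S = S from hSs]
  have e : R ∘L R - P * (R ∘L R) * P = (S * R) * R + P * (R * (R * S)) := by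
    change R * R - P * (R * R) * P = _
    rw [hSdef]; noncomm_ring
  have h4 : ‖R ∘L R - P * (R ∘L R) * P‖ ≤ 2 * (‖R‖ * ‖R * S‖) := by
    rw [e]
    have h5 : ‖P‖ ≤ 1 := hP.norm_le
    calc _ ≤ ‖S * R‖ * ‖R‖ + ‖P‖ * (‖R‖ * ‖R * S‖) :=
          (norm_add_le _ _).trans (add_le_add (norm_mul_le _ _) ((norm_mul_le _ _).trans
            (mul_le_mul_of_nonneg_left (norm_mul_le _ _) (norm_nonneg _))))
      _ ≤ ‖S * R‖ * ‖R‖ + 1 * (‖R‖ * ‖R * S‖) := by gcongr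
      _ = _ := by rw [h3]; ring
  calc _ ≤ (2 * (‖R‖ * ‖R * S‖)) ^ 2 := pow_le_pow_left₀ (norm_nonneg _) h4 2
    _ = 4 * ((‖R‖ * ‖R‖) * (‖R * S‖ * ‖R * S‖)) := by ring
    _ ≤ _ := by gcongr

/-- A positive semidefinite family of blocks of finite total trace is the family of blocks of a
positive operator. -/
theorem exists_isPositive_opBlock {ι : Type u} {κ : Type v} (Z : κ → κ → Op ι)
    (hZ : ∀ (F : Finset κ) (y : κ → Hilb ι), 0 ≤ ∑ c ∈ F, ∑ c' ∈ F, ⟪y c, Z c c' (y c')⟫_ℂ)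
    (hf : ∑' c, posTrace (Z c c) ≠ ∞) :
    ∃ Y : Op (ι × κ), Y.IsPositive ∧ ∀ c c', opBlock c c' Y = Z c c' := by
  classical
  set t : κ → ℝ := fun c => (posTrace (Z c c)).toReal with ht
  have hts : Summable t := ENNReal.summable_toReal hf
  have ht0 (c) : 0 ≤ t c := ENNReal.toReal_nonneg
  have htop (c) : posTrace (Z c c) ≠ ∞ := ENNReal.ne_top_of_tsum_ne_top hf c
  have hpos (F) : (blockSum Z F).IsPositive := blockSum_isPositive (hZ F)
  have htr (F H : Finset κ) : posTrace ((1 - blockProj F) * blockSum Z H * (1 - blockProj F)) =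
      ∑ c ∈ H \ F, posTrace (Z c c) := by
    rw [← posTrace_opBlock, tsum_eq_sum (s := H \ F)]
    · refine Finset.sum_congr rfl fun c hc => ?_
      obtain ⟨hcH, hcF⟩ := Finset.mem_sdiff.1 hc
      rw [opBlock_compl_blockProj, if_neg hcF, opBlock_blockSum, if_pos ⟨hcH, hcH⟩]
    · intro c hc
      rw [opBlock_compl_blockProj, opBlock_blockSum]
      by_cases hcF : c ∈ F
      · simp [posTrace, hcF]
      · have hcH : c ∉ H := fun h => hc (Finset.mem_sdiff.2 ⟨h, hcF⟩)
        simp [posTrace, hcH]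
  have htr0 (H : Finset κ) : posTrace (blockSum Z H) = ∑ c ∈ H, posTrace (Z c c) := by
    have := htr ∅ H
    simpa [blockProj] using this
  have hcomp {F H : Finset κ} (hFH : F ⊆ H) :
      blockProj F * blockSum Z H * blockProj F = blockSum Z F := by
    refine opBlock_ext fun c c' => ?_
    change (restrict (inLeft c) ∘L blockProj F) ∘L blockSum Z H ∘L
      (blockProj F ∘L adjoint (restrict (inLeft c'))) = _
    rw [restrict_comp_blockProj, blockProj_comp_adjoint, opBlock_blockSum]
    by_cases h1 : c ∈ F <;> by_cases h2 : c' ∈ F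
    · simp only [h1, h2, if_true, and_self]
      exact (opBlock_blockSum Z H c c').trans (if_pos ⟨hFH h1, hFH h2⟩)
    all_goals simp [h1, h2]
  -- The block sum over `F` is the compression of the one over `H`, so their distance is governed by
  -- the trace of the blocks outside `F`, a tail of a convergent series.
  have hnorm {F H : Finset κ} (hFH : F ⊆ H) :
      ‖blockSum Z H - blockSum Z F‖ ^ 2 ≤ 4 * ((∑' c, t c) * ((∑' c, t c) - ∑ c ∈ F, t c)) := by
    have h := norm_sub_compression_sq_le (hpos H) (isStarProjection_blockProj F)
      (by rw [htr0]; exact ENNReal.sum_ne_top.2 fun c _ => htop c)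
    rw [hcomp hFH, htr, htr0, ENNReal.toReal_sum fun c _ => htop c,
      ENNReal.toReal_sum fun c _ => htop c] at h
    have e : ∑ c ∈ H \ F, t c = ∑ c ∈ H, t c - ∑ c ∈ F, t c :=
      eq_sub_of_add_eq (Finset.sum_sdiff hFH)
    have hH : ∑ c ∈ H, t c ≤ ∑' c, t c := hts.sum_le_tsum H fun c _ => ht0 c
    refine h.trans ?_
    change 4 * ((∑ c ∈ H, t c) * ∑ c ∈ H \ F, t c) ≤ _
    have h0 : 0 ≤ ∑ c ∈ H \ F, t c := Finset.sum_nonneg fun c _ => ht0 c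
    have h0' : 0 ≤ ∑' c, t c := tsum_nonneg ht0
    gcongr
    linarith
  have hcauchy : CauchySeq (blockSum Z) := by
    refine Metric.cauchySeq_iff'.2 fun ε hε => ?_
    have hlim : Filter.Tendsto (fun F : Finset κ =>
        4 * ((∑' c, t c) * ((∑' c, t c) - ∑ c ∈ F, t c))) Filter.atTop (nhds 0) := by
      have := ((tendsto_const_nhds (x := ∑' c, t c)).sub hts.hasSum).const_mul (∑' c, t c)
      simpa using this.const_mul 4
    obtain ⟨F, hF⟩ := (hlim.eventually (gt_mem_nhds (pow_pos hε 2))).exists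
    refine ⟨F, fun H hH => ?_⟩
    rw [dist_eq_norm]
    exact lt_of_pow_lt_pow_left₀ 2 hε.le ((hnorm hH).trans_lt hF)
  obtain ⟨Y, hY⟩ := cauchySeq_tendsto_of_complete hcauchy
  refine ⟨Y, isPositive_of_inner_nonneg fun x => ?_, fun c c' => ?_⟩
  · have h1 : Filter.Tendsto (fun F => ⟪x, blockSum Z F x⟫_ℂ) Filter.atTop (nhds ⟪x, Y x⟫_ℂ) :=
      ((innerSL ℂ x).continuous.tendsto _).comp
        (((ContinuousLinearMap.apply ℂ (Hilb (ι × κ)) x).continuous.tendsto Y).comp hY)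
    exact ge_of_tendsto' h1 fun F => (hpos F).inner_nonneg_right x
  · have hc : Continuous fun X : Op (ι × κ) => opBlock c c' X := by
      unfold opBlock; fun_prop
    refine tendsto_nhds_unique ((hc.tendsto Y).comp hY) (tendsto_const_nhds.congr' ?_)
    filter_upwards [Filter.eventually_ge_atTop {c, c'}] with F hF
    rw [Function.comp_apply, opBlock_blockSum, if_pos]
    exact ⟨hF (by simp), hF (by simp)⟩

/-! ### Completely positive maps -/

namespace IsCompletelyPositive

variable {ι : Type u} {κ : Type v}

theorem finset {Θ : TraceClass ι →ₗ[ℂ] TraceClass κ} (hΘ : IsCompletelyPositive Θ) {α : Type*}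
    (F : Finset α) (X : α → α → TraceClass ι)
    (hX : ∀ x : α → Hilb ι, 0 ≤ ∑ a ∈ F, ∑ b ∈ F, ⟪x a, (X a b : Op ι) (x b)⟫_ℂ)
    (y : α → Hilb κ) : 0 ≤ ∑ a ∈ F, ∑ b ∈ F, ⟪y a, (Θ (X a b) : Op κ) (y b)⟫_ℂ := by
  classical
  have hsum (g : α → α → ℂ) : ∑ a ∈ F, ∑ b ∈ F, g a b =
      ∑ a, ∑ b, g (F.equivFin.symm a) (F.equivFin.symm b) := by
    rw [← Finset.sum_coe_sort, ← Equiv.sum_comp F.equivFin.symm]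
    refine Finset.sum_congr rfl fun a _ => ?_
    rw [← Finset.sum_coe_sort, ← Equiv.sum_comp F.equivFin.symm]
  rw [hsum]
  refine hΘ _ (fun a b => X (F.equivFin.symm a) (F.equivFin.symm b)) (fun x => ?_) _
  have h := hX fun a => if ha : a ∈ F then x (F.equivFin ⟨a, ha⟩) else 0
  rw [hsum] at h
  simpa using h

theorem isPositive {Θ : TraceClass ι →ₗ[ℂ] TraceClass κ} (hΘ : IsCompletelyPositive Θ)
    {X : TraceClass ι} (hX : (X : Op ι).IsPositive) : (Θ X : Op κ).IsPositive := by
  refine isPositive_of_inner_nonneg fun y => ?_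
  have := hΘ 1 (fun _ _ => X) (fun x => by simpa using hX.inner_nonneg_right (x 0)) fun _ => y
  simpa using this

theorem add {Θ Θ' : TraceClass ι →ₗ[ℂ] TraceClass κ} (h : IsCompletelyPositive Θ)
    (h' : IsCompletelyPositive Θ') : IsCompletelyPositive (Θ + Θ') := by
  intro n X hX y
  have := add_nonneg (h n X hX y) (h' n X hX y)
  simpa [inner_add_right, Finset.sum_add_distrib] using this

theorem sum {α : Type*} (s : Finset α) {Θ : α → TraceClass ι →ₗ[ℂ] TraceClass κ}
    (h : ∀ a ∈ s, IsCompletelyPositive (Θ a)) : IsCompletelyPositive (∑ a ∈ s, Θ a) := by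
  classical
  induction s using Finset.induction_on with
  | empty => intro n X hX y; simp
  | insert a s ha ih =>
    rw [Finset.sum_insert ha]
    exact (h a (Finset.mem_insert_self a s)).add
      (ih fun b hb => h b (Finset.mem_insert_of_mem hb))

theorem comp {μ : Type w} {Θ : TraceClass ι →ₗ[ℂ] TraceClass κ}
    {Θ' : TraceClass κ →ₗ[ℂ] TraceClass μ} (h' : IsCompletelyPositive Θ')
    (h : IsCompletelyPositive Θ) : IsCompletelyPositive (Θ' ∘ₗ Θ) :=
  fun n X hX => h' n _ (h n X hX)

theorem compress (V : Hilb ι →L[ℂ] Hilb κ) : IsCompletelyPositive (compress V V) := by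
  intro n X hX y
  refine (hX fun a => adjoint V (y a)).trans_eq ?_
  refine Finset.sum_congr rfl fun a _ => Finset.sum_congr rfl fun b _ => ?_
  rw [ContinuousLinearMap.adjoint_inner_left]
  rfl

/-- With `P = R R`, expand the trace over basis vectors `ket i` and `⟪R y_a, R y_b⟫` over
coordinates `k`. Each term of the double series is the quadratic form of the block matrix `X` at the
vectors `coord (R y_a) k • ket i`, hence nonnegative. -/
theorem tr_smulRight {P : TraceClass κ} (hP : (P : Op κ).IsPositive) :
    IsCompletelyPositive ((trMul (1 : Op ι)).smulRight P) := by
  intro n X hX y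
  obtain ⟨R, hR, hRP⟩ := exists_sqrt hP
  have e (a b : Fin n) : ⟪y a, (P : Op κ) (y b)⟫_ℂ = ⟪R (y a), R (y b)⟫_ℂ := by
    rw [← hRP, ContinuousLinearMap.comp_apply, ← ContinuousLinearMap.adjoint_inner_left, hR]
  have h1 : HasSum (fun i => ∑ a, ∑ b, ⟪ket i, (X a b : Op ι) (ket i)⟫_ℂ * ⟪R (y a), R (y b)⟫_ℂ)
      (∑ a, ∑ b, tr (X a b : Op ι) * ⟪R (y a), R (y b)⟫_ℂ) :=
    hasSum_sum fun a _ => hasSum_sum fun b _ => (summable_diag (X a b).2).hasSum.mul_right _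
  have h2 (i : ι) : 0 ≤ ∑ a, ∑ b, ⟪ket i, (X a b : Op ι) (ket i)⟫_ℂ * ⟪R (y a), R (y b)⟫_ℂ := by
    have h3 := hasSum_sum fun a (_ : a ∈ Finset.univ) => hasSum_sum fun b
      (_ : b ∈ Finset.univ) => (hasSum_inner_coord (R (y a)) (R (y b))).mul_left
        ⟪ket i, (X a b : Op ι) (ket i)⟫_ℂ
    refine h3.nonneg fun k => ?_
    refine (hX fun a => coord (R (y a)) k • ket i).trans_eq ?_
    refine Finset.sum_congr rfl fun a _ => Finset.sum_congr rfl fun b _ => ?_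
    rw [map_smul, inner_smul_left, inner_smul_right]
    ring
  refine (h1.nonneg h2).trans_eq ?_
  refine Finset.sum_congr rfl fun a _ => Finset.sum_congr rfl fun b _ => ?_
  rw [LinearMap.smulRight_apply, trMul_one, ← e]
  simp

theorem trMul_smulRight {M : Op ι} (hM : M.IsPositive) {P : TraceClass κ}
    (hP : (P : Op κ).IsPositive) : IsCompletelyPositive ((trMul M).smulRight P) := by
  obtain ⟨R, hR, hRM⟩ := exists_sqrt hM
  have e : (trMul M).smulRight P = (trMul (1 : Op ι)).smulRight P ∘ₗ QDarwin.compress R R := by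
    refine LinearMap.ext fun X => ?_
    rw [LinearMap.comp_apply, LinearMap.smulRight_apply, LinearMap.smulRight_apply,
      trMul_compress, hR, ← hRM]
    rfl
  rw [e]
  exact (tr_smulRight hP).comp (compress R)

end IsCompletelyPositive

/-! ### Ampliations of completely positive maps and the cut-off diamond norm. -/

theorem inner_block_ket {ι : Type u} {κ : Type v} (c : κ) (X : TraceClass (ι × κ)) (i : ι) :
    ⟪ket i, (block c c X : Op ι) (ket i)⟫_ℂ = ⟪ket (i, c), (X : Op (ι × κ)) (ket (i, c))⟫_ℂ := by
  refine (inner_opBlock c c (X : Op (ι × κ)) (ket i) (ket i)).trans ?_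
  rw [adjoint_restrict_ket]
  rfl

theorem block_isPositive {ι : Type u} {κ : Type v} {X : TraceClass (ι × κ)}
    (hX : (X : Op (ι × κ)).IsPositive) (c : κ) : (block c c X : Op ι).IsPositive :=
  opBlock_isPositive hX c

/-- A completely positive map has a positive ampliation on every positive operator for which its
trace is finite. -/
theorem exists_ampliation {ι : Type u} {ι' : Type v} {κ : Type w}
    {Θ : TraceClass ι →ₗ[ℂ] TraceClass ι'} (hΘ : IsCompletelyPositive Θ) {X : TraceClass (ι × κ)}
    (hX : (X : Op (ι × κ)).IsPositive) (hf : ∑' c, posTrace (Θ (block c c X) : Op ι') ≠ ∞) :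
    ∃ Y : Op (ι' × κ), Y.IsPositive ∧ IsAmpliation Θ X Y := by
  refine exists_isPositive_opBlock (fun c c' => (Θ (block c c' X) : Op ι')) (fun F y => ?_) hf
  refine hΘ.finset F (fun c c' => block c c' X) (fun x => ?_) y
  refine (hX.inner_nonneg_right (∑ c ∈ F, adjoint (restrict (inLeft c)) (x c))).trans_eq ?_
  rw [map_sum, sum_inner]
  refine Finset.sum_congr rfl fun a _ => ?_
  rw [inner_sum]
  exact Finset.sum_congr rfl fun b _ => (inner_opBlock a b (X : Op (ι × κ)) _ _).symm

/-- The ampliation of `Θ - Θ'` is a difference of two positive operators, so its trace norm is at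
most the sum of their traces, and these are determined by the diagonal blocks alone. The ancilla
thereby disappears from all later estimates. -/
theorem ampliationNorm_le {ι : Type u} {ι' : Type v} {κ : Type w}
    {Φ Θ Θ' : TraceClass ι →ₗ[ℂ] TraceClass ι'} (hΘ : IsCompletelyPositive Θ)
    (hΘ' : IsCompletelyPositive Θ') (hΦ : Φ = Θ - Θ') {X : TraceClass (ι × κ)}
    (hX : (X : Op (ι × κ)).IsPositive) {C : ℝ≥0∞} (hC : C ≠ ∞)
    (h : ∑' c, (posTrace (Θ (block c c X) : Op ι') + posTrace (Θ' (block c c X) : Op ι')) ≤ C) :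
    ampliationNorm Φ X ≤ C := by
  rw [ENNReal.tsum_add] at h
  have hfin := ENNReal.add_ne_top.1 (ne_top_of_le_ne_top hC h)
  obtain ⟨Y, hY, hYa⟩ := exists_ampliation hΘ hX hfin.1
  obtain ⟨Y', hY', hYa'⟩ := exists_ampliation hΘ' hX hfin.2
  refine (iInf₂_le (Y - Y') ?_).trans ((traceNorm_sub_le hY hY').trans ?_)
  · intro c c'
    have e : opBlock c c' (Y - Y') = opBlock c c' Y - opBlock c c' Y' := by simp [opBlock]
    rw [e, hYa, hYa', hΦ]
    rfl
  · rw [← posTrace_opBlock Y, ← posTrace_opBlock Y']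
    simpa only [hYa _ _, hYa' _ _] using h

/-- A bound on the exponential cut-off diamond norm of a difference of completely positive maps. -/
theorem expDiamondNorm_le {ι : Type u} {ω Ω α β : ℝ} (hα : 0 ≤ α) (hβ : 0 ≤ β) (hΩ : 0 ≤ Ω)
    {Φ Θ Θ' : TraceClass ℕ →ₗ[ℂ] TraceClass ι} (hΘ : IsCompletelyPositive Θ)
    (hΘ' : IsCompletelyPositive Θ') (hΦ : Φ = Θ - Θ')
    (h : ∀ X : TraceClass ℕ, (X : Op ℕ).IsPositive →
      posTrace (Θ X : Op ι) + posTrace (Θ' X : Op ι) ≤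
        ∑' n : ℕ, ENNReal.ofReal ((α + β * Real.exp (ω * n)) *
          (⟪ket n, (X : Op ℕ) (ket n)⟫_ℂ).re)) :
    expDiamondNorm.{u, w} ω Ω Φ ≤ ENNReal.ofReal (α + β * Ω) := by
  refine iSup_le fun κ => iSup_le fun ρ => iSup_le fun hρ => iSup_le fun hE => ?_
  refine ampliationNorm_le hΘ hΘ' hΦ hρ.pos ENNReal.ofReal_ne_top ?_
  refine (ENNReal.tsum_le_tsum fun c => h _ (block_isPositive hρ.pos c)).trans ?_
  rw [ENNReal.tsum_comm, ← ENNReal.tsum_prod' (f := fun p : ℕ × κ => ENNReal.ofReal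
    ((α + β * Real.exp (ω * p.1)) * (⟪ket p.1, (block p.2 p.2 ρ : Op ℕ) (ket p.1)⟫_ℂ).re))]
  -- The constant part of the weight is paid for by the unit trace of `ρ`, the exponential part by
  -- the energy constraint.
  have e (p : ℕ × κ) : ENNReal.ofReal ((α + β * Real.exp (ω * p.1)) *
      (⟪ket p.1, (block p.2 p.2 ρ : Op ℕ) (ket p.1)⟫_ℂ).re) =
      ENNReal.ofReal α * ENNReal.ofReal (⟪ket p, (ρ : Op (ℕ × κ)) (ket p)⟫_ℂ).re +
      ENNReal.ofReal β * ENNReal.ofReal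
        (Real.exp (ω * p.1) * (⟪ket p, (ρ : Op (ℕ × κ)) (ket p)⟫_ℂ).re) := by
    have h0 := diag_nonneg hρ.pos p
    rw [inner_block_ket, ← ENNReal.ofReal_mul hα, ← ENNReal.ofReal_mul hβ, ← ENNReal.ofReal_add
      (by positivity) (by positivity)]
    congr 1
    ring
  simp_rw [e]
  rw [ENNReal.tsum_add, ENNReal.tsum_mul_left, ENNReal.tsum_mul_left, ENNReal.ofReal_add hα
    (by positivity), ENNReal.ofReal_mul hβ]
  have h1 : posTrace (ρ : Op (ℕ × κ)) = 1 := by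
    rw [posTrace_eq_ofReal hρ.pos ρ.2, hρ.trace_one]; simp
  refine add_le_add (le_of_eq ?_) (mul_le_mul_right hE _)
  exact (congrArg _ h1).trans (mul_one _)

/-! ### Operators acting on one tensor factor -/

/-- The vector with given square-summable coordinates. -/
def ofCoord {ι : Type u} (g : ι → ℂ) (h : ∑' i, ENNReal.ofReal (‖g i‖ ^ 2) ≠ ∞) : Hilb ι :=
  (⟨g, memℓp_gen (by
    simpa using (ENNReal.summable_toReal h).congr fun i =>
      ENNReal.toReal_ofReal (sq_nonneg ‖g i‖))⟩ :
      lp (fun _ : ι => ℂ) 2)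

theorem coord_ofCoord {ι : Type u} (g : ι → ℂ) (h) (i : ι) : coord (ofCoord g h) i = g i := rfl

theorem parseval_restrict {ι : Type u} {κ : Type v} (x : Hilb (ι × κ)) :
    ∑' c, ENNReal.ofReal (‖restrict (inLeft (ι := ι) c) x‖ ^ 2) = ENNReal.ofReal (‖x‖ ^ 2) := by
  rw [← parseval x, ENNReal.tsum_prod', ENNReal.tsum_comm]
  exact tsum_congr fun c => (parseval _).symm

theorem tsum_sq_ampLeft_le {ι : Type u} {κ : Type v} (Q : Op ι) (x : Hilb (ι × κ)) :
    ∑' p : ι × κ, ENNReal.ofReal (‖coord (Q (restrict (inLeft p.2) x)) p.1‖ ^ 2) ≤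
      ENNReal.ofReal ((‖Q‖ * ‖x‖) ^ 2) := by
  rw [ENNReal.tsum_prod' (f := fun p : ι × κ =>
    ENNReal.ofReal (‖coord (Q (restrict (inLeft p.2) x)) p.1‖ ^ 2)), ENNReal.tsum_comm]
  simp only [parseval]
  rw [mul_pow, ENNReal.ofReal_mul (by positivity), ← parseval_restrict, ← ENNReal.tsum_mul_left]
  refine ENNReal.tsum_le_tsum fun c => ?_
  rw [← ENNReal.ofReal_mul (by positivity), ← mul_pow]
  exact ENNReal.ofReal_le_ofReal (pow_le_pow_left₀ (norm_nonneg _) (Q.le_opNorm _) 2)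

/-- The operator `Q ⊗ 1`. -/
def ampLeft {ι : Type u} (κ : Type v) (Q : Op ι) : Op (ι × κ) :=
  LinearMap.mkContinuous
    { toFun := fun x => ofCoord (fun p : ι × κ => coord (Q (restrict (inLeft p.2) x)) p.1)
        (ne_top_of_le_ne_top ENNReal.ofReal_ne_top (tsum_sq_ampLeft_le Q x))
      map_add' := fun x y => hilb_ext fun p => by
        simp only [coord_ofCoord, map_add]; rfl
      map_smul' := fun a x => hilb_ext fun p => by
        simp only [coord_ofCoord, map_smul]; rfl } ‖Q‖ (fun x => by
      refine abs_le_of_sq_le_sq' ?_ (by positivity) |>.2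
      rw [← ENNReal.ofReal_le_ofReal_iff (by positivity), ← parseval]
      exact tsum_sq_ampLeft_le Q x)

theorem restrict_comp_ampLeft {ι : Type u} {κ : Type v} (Q : Op ι) (c : κ) :
    restrict (inLeft c) ∘L ampLeft κ Q = Q ∘L restrict (inLeft c) :=
  ContinuousLinearMap.ext fun _ => hilb_ext fun _ => rfl

theorem restrict_ext {ι : Type u} {κ : Type v} {S T : Op (ι × κ)}
    (h : ∀ c, restrict (inLeft c) ∘L S = restrict (inLeft c) ∘L T) : S = T := by
  ext1 x
  refine hilb_ext fun p => ?_
  exact congrArg (fun A : Hilb (ι × κ) →L[ℂ] Hilb ι => coord (A x) p.1) (h p.2)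

theorem ampLeft_one {ι : Type u} {κ : Type v} : ampLeft κ (1 : Op ι) = 1 :=
  restrict_ext fun c => by rw [restrict_comp_ampLeft]; rfl

theorem ampLeft_add {ι : Type u} {κ : Type v} (Q Q' : Op ι) :
    ampLeft κ (Q + Q') = ampLeft κ Q + ampLeft κ Q' :=
  restrict_ext fun c => by
    simp only [ContinuousLinearMap.comp_add, restrict_comp_ampLeft, ContinuousLinearMap.add_comp]

theorem ampLeft_mul {ι : Type u} {κ : Type v} (Q Q' : Op ι) :
    ampLeft κ (Q * Q') = ampLeft κ Q * ampLeft κ Q' :=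
  restrict_ext fun c => by
    change _ = (restrict (inLeft c) ∘L ampLeft κ Q) ∘L ampLeft κ Q'
    rw [restrict_comp_ampLeft, restrict_comp_ampLeft, ContinuousLinearMap.comp_assoc,
      restrict_comp_ampLeft]
    rfl

open Classical in
theorem inner_ampLeft {ι : Type u} {κ : Type v} (Q : Op ι) (p p' : ι × κ) :
    ⟪ket p, ampLeft κ Q (ket p')⟫_ℂ =
      if p.2 = p'.2 then ⟪ket p.1, Q (ket p'.1)⟫_ℂ else 0 := by
  have h : restrict (inLeft p.2) (ampLeft κ Q (ket p')) =
      Q ((restrict (inLeft p.2) ∘L adjoint (restrict (inLeft p'.2))) (ket p'.1)) := by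
    rw [ContinuousLinearMap.comp_apply, ← ket_eq_adjoint_restrict]
    exact congrArg (fun A : Hilb (ι × κ) →L[ℂ] Hilb ι => A (ket p')) (restrict_comp_ampLeft Q p.2)
  nth_rewrite 1 [ket_eq_adjoint_restrict p]
  rw [ContinuousLinearMap.adjoint_inner_left, h, restrict_comp_adjoint]
  split_ifs <;> simp

theorem adjoint_ampLeft {ι : Type u} {κ : Type v} (Q : Op ι) :
    adjoint (ampLeft κ Q) = ampLeft κ (adjoint Q) := by
  classical
  refine op_ext fun p p' => ?_
  rw [ContinuousLinearMap.adjoint_inner_right, ← inner_conj_symm, inner_ampLeft, inner_ampLeft,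
    ContinuousLinearMap.adjoint_inner_right, ← inner_conj_symm (Q (ket p.1))]
  by_cases h : p.2 = p'.2
  · rw [if_pos h, if_pos h.symm]
  · rw [if_neg h, if_neg (Ne.symm h), map_zero]

theorem trMul_ptrace {ι : Type u} {κ : Type v} (Q : Op ι) (X : TraceClass (ι × κ)) :
    trMul Q (ptrace ι κ X) = trMul (ampLeft κ Q) X := by
  rw [trMul_apply, trMul_apply, tr, tr, (summable_diag (comp_mem _ X.2)).tsum_prod]
  refine tsum_congr fun i => ?_
  have h1 := (((summable_opBlock X.2).hasSum.mapL
    (ContinuousLinearMap.apply ℂ (Hilb ι) (ket i))).mapL Q).mapL (innerSL ℂ (ket i))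
  refine h1.tsum_eq.symm.trans (tsum_congr fun c => ?_)
  have e := congrArg (fun A : Hilb (ι × κ) →L[ℂ] Hilb ι => A ((X : Op (ι × κ)) (ket (i, c))))
    (restrict_comp_ampLeft Q c)
  simp only [ContinuousLinearMap.comp_apply] at e
  rw [ket_eq_adjoint_restrict (i, c), ContinuousLinearMap.adjoint_inner_left,
    ContinuousLinearMap.comp_apply, ← ket_eq_adjoint_restrict (i, c), e,
    ket_eq_adjoint_restrict (i, c)]
  rfl

theorem IsCompletelyPositive.ptrace (ι : Type u) (κ : Type v) :
    IsCompletelyPositive (ptrace ι κ) := by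
  intro n X hX y
  have h1 := hasSum_sum fun a (_ : a ∈ Finset.univ) => hasSum_sum fun b (_ : b ∈ Finset.univ) =>
    ((summable_opBlock (X a b).2).hasSum.mapL
      (ContinuousLinearMap.apply ℂ (Hilb ι) (y b))).mapL (innerSL ℂ (y a))
  refine h1.nonneg fun c => ?_
  refine (hX fun a => adjoint (restrict (inLeft c)) (y a)).trans_eq ?_
  exact Finset.sum_congr rfl fun a _ => Finset.sum_congr rfl fun b _ =>
    (inner_opBlock c c (X a b : Op (ι × κ)) _ _).symm

/-! ### Operators acting on one fragment -/

theorem restrict_equiv_ket {ι : Type u} {κ : Type v} (e : ι ≃ κ) (i : ι) :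
    restrict e.toEmbedding (ket (e i)) = ket i := by
  classical
  refine hilb_ext fun k => ?_
  rw [coord_restrict, coord_ket, coord_ket]
  simp

theorem restrict_equiv_comp_adjoint {ι : Type u} {κ : Type v} (e : ι ≃ κ) :
    restrict e.toEmbedding ∘L adjoint (restrict e.toEmbedding) = 1 := by
  refine op_ext fun k i => ?_
  rw [ContinuousLinearMap.comp_apply, adjoint_restrict_ket]
  exact congrArg _ (restrict_equiv_ket e i)

theorem adjoint_comp_restrict_equiv {ι : Type u} {κ : Type v} (e : ι ≃ κ) :
    adjoint (restrict e.toEmbedding) ∘L restrict e.toEmbedding = 1 := by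
  refine op_ext fun k i => ?_
  obtain ⟨i, rfl⟩ := e.surjective i
  rw [ContinuousLinearMap.comp_apply, restrict_equiv_ket, adjoint_restrict_ket]
  rfl

section Fragments

variable {N : ℕ} {β : Fin N → Type u}

/-- The operator on `B₁ ⊗ ⋯ ⊗ B_N` acting as `Q` on the `j`-th fragment and trivially on the
others. -/
def lift (j : Fin N) (Q : Op (β j)) : Op (∀ i, β i) :=
  adjoint (restrict (Equiv.piSplitAt j β).symm.toEmbedding) ∘L
    ampLeft (∀ i : {i // i ≠ j}, β i) Q ∘L restrict (Equiv.piSplitAt j β).symm.toEmbedding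

theorem lift_one (j : Fin N) : lift (β := β) j 1 = 1 := by
  rw [lift, ampLeft_one]
  exact adjoint_comp_restrict_equiv _

theorem lift_add (j : Fin N) (Q Q' : Op (β j)) : lift j (Q + Q') = lift j Q + lift j Q' := by
  rw [lift, ampLeft_add, ContinuousLinearMap.add_comp, ContinuousLinearMap.comp_add]
  rfl

theorem lift_mul (j : Fin N) (Q Q' : Op (β j)) : lift j (Q * Q') = lift j Q * lift j Q' := by
  have h := restrict_equiv_comp_adjoint (Equiv.piSplitAt j β).symm
  rw [lift, ampLeft_mul]
  change _ = adjoint (restrict (Equiv.piSplitAt j β).symm.toEmbedding) ∘L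
    ampLeft _ Q ∘L (restrict (Equiv.piSplitAt j β).symm.toEmbedding ∘L
    adjoint (restrict (Equiv.piSplitAt j β).symm.toEmbedding)) ∘L ampLeft _ Q' ∘L
    restrict (Equiv.piSplitAt j β).symm.toEmbedding
  rw [h]
  rfl

theorem adjoint_lift (j : Fin N) (Q : Op (β j)) : adjoint (lift j Q) = lift j (adjoint Q) := by
  rw [lift, ContinuousLinearMap.adjoint_comp, ContinuousLinearMap.adjoint_comp,
    ContinuousLinearMap.adjoint_adjoint, adjoint_ampLeft]
  rfl

theorem isStarProjection_lift (j : Fin N) {Q : Op (β j)} (hQ : IsStarProjection Q) :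
    IsStarProjection (lift j Q) := by
  refine ⟨?_, ?_⟩
  · change lift j Q * lift j Q = lift j Q
    rw [← lift_mul, hQ.isIdempotentElem.eq]
  · exact (adjoint_lift j Q).trans (congrArg _ hQ.isSelfAdjoint.star_eq)

open Classical in
theorem inner_lift (j : Fin N) (Q : Op (β j)) (f g : ∀ i, β i) :
    ⟪ket f, lift j Q (ket g)⟫_ℂ =
      if ∀ i, i ≠ j → f i = g i then ⟪ket (f j), Q (ket (g j))⟫_ℂ else 0 := by
  have hk (f : ∀ i, β i) : restrict (Equiv.piSplitAt j β).symm.toEmbedding (ket f) =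
      ket (Equiv.piSplitAt j β f) := by
    conv_lhs => rw [← (Equiv.piSplitAt j β).symm_apply_apply f]
    exact restrict_equiv_ket _ _
  rw [lift, ContinuousLinearMap.comp_apply, ContinuousLinearMap.comp_apply,
    ContinuousLinearMap.adjoint_inner_right, hk, hk, inner_ampLeft]
  congr 1
  simp [Equiv.piSplitAt, funext_iff]

open Classical in
-- Only one intermediate basis vector survives: `f` with its `i`-th entry replaced by that of `g`.
-- The resulting expression is symmetric in the two fragments, which is why the operators commute.
theorem inner_lift_mul_lift {i j : Fin N} (hij : i ≠ j) (Q : Op (β i)) (Q' : Op (β j))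
    (f g : ∀ i, β i) : ⟪ket f, (lift i Q * lift j Q') (ket g)⟫_ℂ =
      if ∀ k, k ≠ i → k ≠ j → f k = g k then
        ⟪ket (f i), Q (ket (g i))⟫_ℂ * ⟪ket (f j), Q' (ket (g j))⟫_ℂ else 0 := by
  refine (inner_comp_ket (lift i Q) (lift j Q') f g).tsum_eq.symm.trans ?_
  rw [tsum_eq_single (Function.update f i (g i))]
  · rw [inner_lift, inner_lift, if_pos fun k hk => by rw [Function.update_of_ne hk],
      Function.update_self, Function.update_of_ne hij.symm, mul_ite, mul_zero]
    congr 1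
    refine propext ⟨fun h k hki hkj => ?_, fun h k hk => ?_⟩
    · have := h k hkj
      rwa [Function.update_of_ne hki] at this
    · by_cases hki : k = i
      · subst hki; simp
      · rw [Function.update_of_ne hki, h k hki hk]
  · intro h hh
    rw [inner_lift, inner_lift]
    by_cases h1 : ∀ k, k ≠ i → f k = h k
    · have h2 : ¬ ∀ k, k ≠ j → h k = g k := by
        intro h2
        refine hh (funext fun k => ?_)
        by_cases hki : k = i
        · subst hki; rw [Function.update_self, h2 _ hij]
        · rw [Function.update_of_ne hki, h1 k hki]
      rw [if_neg h2, mul_zero]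
    · rw [if_neg h1, zero_mul]

theorem lift_commute {i j : Fin N} (hij : i ≠ j) (Q : Op (β i)) (Q' : Op (β j)) :
    Commute (lift i Q) (lift j Q') := by
  classical
  refine op_ext fun f g => ?_
  rw [inner_lift_mul_lift hij, inner_lift_mul_lift hij.symm, mul_comm]
  congr 1
  exact propext ⟨fun h k h1 h2 => h k h2 h1, fun h k h1 h2 => h k h2 h1⟩

/-- The Heisenberg picture of the partial trace: tests of the effective dynamics become tests of `Λ`
itself by operators on one fragment. -/
theorem trMul_traceAllBut (j : Fin N) (Q : Op (β j)) (X : TraceClass (∀ i, β i)) :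
    trMul Q (traceAllBut β j X) = trMul (lift j Q) X := by
  rw [traceAllBut, LinearMap.comp_apply, trMul_ptrace, relabel, trMul_compress]
  rfl

theorem tr_traceAllBut (j : Fin N) (X : TraceClass (∀ i, β i)) :
    tr (traceAllBut β j X : Op (β j)) = tr (X : Op (∀ i, β i)) := by
  rw [← trMul_one, trMul_traceAllBut, lift_one, trMul_one]

theorem IsCompletelyPositive.traceAllBut (j : Fin N) : IsCompletelyPositive (traceAllBut β j) :=
  (IsCompletelyPositive.ptrace _ _).comp (IsCompletelyPositive.compress _)

theorem IsChannel.traceAllBut_comp {ι : Type v} {Λ : TraceClass ι →ₗ[ℂ] TraceClass (∀ i, β i)}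
    (hΛ : IsChannel Λ) (j : Fin N) : IsChannel (traceAllBut β j ∘ₗ Λ) :=
  ⟨(IsCompletelyPositive.traceAllBut j).comp hΛ.completelyPositive,
    fun X => (tr_traceAllBut j _).trans (hΛ.tracePreserving X)⟩

end Fragments

/-! ### Maps dominated by a weight on the Fock basis -/

/-- `Φ` is a difference of two completely positive maps whose total trace on a positive operator is
at most the trace of that operator against the diagonal weight `v`. -/
def Dominated {ι : Type u} (Φ : TraceClass ℕ →ₗ[ℂ] TraceClass ι) (v : ℕ → ℝ) : Prop :=
  ∃ Θ Θ' : TraceClass ℕ →ₗ[ℂ] TraceClass ι, IsCompletelyPositive Θ ∧ IsCompletelyPositive Θ' ∧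
    Φ = Θ - Θ' ∧ ∀ X : TraceClass ℕ, (X : Op ℕ).IsPositive →
      posTrace (Θ X : Op ι) + posTrace (Θ' X : Op ι) ≤
        ∑' n : ℕ, ENNReal.ofReal (v n * (⟪ket n, (X : Op ℕ) (ket n)⟫_ℂ).re)

namespace Dominated

variable {ι : Type u} {Φ Φ' : TraceClass ℕ →ₗ[ℂ] TraceClass ι} {v v' : ℕ → ℝ}

theorem mono (h : Dominated Φ v) (hv : ∀ n, v n ≤ v' n) : Dominated Φ v' := by
  obtain ⟨Θ, Θ', h1, h2, h3, h4⟩ := h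
  refine ⟨Θ, Θ', h1, h2, h3, fun X hX => (h4 X hX).trans (ENNReal.tsum_le_tsum fun n => ?_)⟩
  exact ENNReal.ofReal_le_ofReal (mul_le_mul_of_nonneg_right (hv n) (diag_nonneg hX n))

theorem zero : Dominated (0 : TraceClass ℕ →ₗ[ℂ] TraceClass ι) 0 :=
  ⟨0, 0, fun n X _ y => by simp, fun n X _ y => by simp,
    LinearMap.ext fun _ => (sub_self _).symm,
    fun X _ => by simp [posTrace]⟩

theorem add (h : Dominated Φ v) (h' : Dominated Φ' v') (hv : ∀ n, 0 ≤ v n) (hv' : ∀ n, 0 ≤ v' n) :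
    Dominated (Φ + Φ') (v + v') := by
  obtain ⟨Θ₁, Θ₁', h1, h2, rfl, h4⟩ := h
  obtain ⟨Θ₂, Θ₂', k1, k2, rfl, k4⟩ := h'
  refine ⟨Θ₁ + Θ₂, Θ₁' + Θ₂', h1.add k1, h2.add k2, by abel, fun X hX => ?_⟩
  have e1 : posTrace ((Θ₁ + Θ₂) X : Op ι) = posTrace (Θ₁ X : Op ι) + posTrace (Θ₂ X : Op ι) :=
    posTrace_add (h1.isPositive hX) (k1.isPositive hX)
  have e2 : posTrace ((Θ₁' + Θ₂') X : Op ι) = posTrace (Θ₁' X : Op ι) + posTrace (Θ₂' X : Op ι) :=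
    posTrace_add (h2.isPositive hX) (k2.isPositive hX)
  have e3 : ∑' n : ℕ, ENNReal.ofReal ((v + v') n * (⟪ket n, (X : Op ℕ) (ket n)⟫_ℂ).re) =
      ∑' n : ℕ, ENNReal.ofReal (v n * (⟪ket n, (X : Op ℕ) (ket n)⟫_ℂ).re) +
      ∑' n : ℕ, ENNReal.ofReal (v' n * (⟪ket n, (X : Op ℕ) (ket n)⟫_ℂ).re) := by
    rw [← ENNReal.tsum_add]
    refine tsum_congr fun n => ?_
    have h0 := diag_nonneg hX n
    rw [← ENNReal.ofReal_add (mul_nonneg (hv n) h0) (mul_nonneg (hv' n) h0), Pi.add_apply, add_mul]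
  rw [e1, e2, e3, add_add_add_comm]
  exact add_le_add (h4 X hX) (k4 X hX)

theorem sum {α : Type*} (s : Finset α) {Φ : α → TraceClass ℕ →ₗ[ℂ] TraceClass ι} {v : α → ℕ → ℝ}
    (h : ∀ a ∈ s, Dominated (Φ a) (v a)) (hv : ∀ a ∈ s, ∀ n, 0 ≤ v a n) :
    Dominated (∑ a ∈ s, Φ a) (∑ a ∈ s, v a) := by
  classical
  induction s using Finset.induction_on with
  | empty => exact zero
  | insert a s ha ih =>
    rw [Finset.sum_insert ha, Finset.sum_insert ha]
    refine (h a (Finset.mem_insert_self a s)).add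
      (ih (fun b hb => h b (Finset.mem_insert_of_mem hb))
        fun b hb => hv b (Finset.mem_insert_of_mem hb)) (hv a (Finset.mem_insert_self a s)) ?_
    intro n
    rw [Finset.sum_apply]
    exact Finset.sum_nonneg fun b hb => hv b (Finset.mem_insert_of_mem hb) n

theorem expDiamondNorm_le {ω Ω α β : ℝ} (h : Dominated Φ v) (hα : 0 ≤ α) (hβ : 0 ≤ β) (hΩ : 0 ≤ Ω)
    (hv : ∀ n : ℕ, v n ≤ α + β * Real.exp (ω * n)) :
    expDiamondNorm.{u, w} ω Ω Φ ≤ ENNReal.ofReal (α + β * Ω) := by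
  obtain ⟨Θ, Θ', h1, h2, h3, h4⟩ := h.mono hv
  exact QDarwin.expDiamondNorm_le hα hβ hΩ h1 h2 h3 h4

end Dominated

theorem IsChannel.posTrace_eq {ι : Type u} {κ : Type v} {Λ : TraceClass ι →ₗ[ℂ] TraceClass κ}
    (hΛ : IsChannel Λ) {X : TraceClass ι} (hX : (X : Op ι).IsPositive) :
    posTrace (Λ X : Op κ) = posTrace (X : Op ι) := by
  rw [posTrace_eq_ofReal (hΛ.completelyPositive.isPositive hX) (Λ X).2,
    posTrace_eq_ofReal hX X.2, hΛ.tracePreserving]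

/-- The difference of two channels is dominated by the constant weight `2`. -/
theorem IsChannel.dominated_sub {ι : Type u} {Λ E : TraceClass ℕ →ₗ[ℂ] TraceClass ι}
    (hΛ : IsChannel Λ) (hE : IsChannel E) : Dominated (Λ - E) fun _ => 2 := by
  refine ⟨Λ, E, hΛ.completelyPositive, hE.completelyPositive, rfl, fun X hX => ?_⟩
  rw [hΛ.posTrace_eq hX, hE.posTrace_eq hX, posTrace, ← ENNReal.tsum_add]
  refine ENNReal.tsum_le_tsum fun n => ?_
  rw [← ENNReal.ofReal_add (diag_nonneg hX n) (diag_nonneg hX n), two_mul]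

/-! ### Truncation -/

/-- The projection onto the first `d` Fock states. -/
def truncProj (d : ℕ) : Op ℕ := ∑ n ∈ Finset.range d, InnerProductSpace.rankOne ℂ (ket n) (ket n)

theorem truncProj_ket (d n : ℕ) : truncProj d (ket n) = if n < d then ket n else 0 := by
  simp only [truncProj, FunLike.coe_sum, Finset.sum_apply, InnerProductSpace.rankOne_apply,
    inner_ket, coord_ket]
  simp

theorem adjoint_truncProj (d : ℕ) : adjoint (truncProj d) = truncProj d := by
  simp [truncProj]

theorem inner_compress_ket {V : Op ℕ} (hV : adjoint V = V) (X : TraceClass ℕ) {n : ℕ} {r : ℝ}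
    (h : V (ket n) = (r : ℂ) • ket n) :
    (⟪ket n, (compress V V X : Op ℕ) (ket n)⟫_ℂ).re =
      r ^ 2 * (⟪ket n, (X : Op ℕ) (ket n)⟫_ℂ).re := by
  change (⟪ket n, V ((X : Op ℕ) (adjoint V (ket n)))⟫_ℂ).re = _
  rw [← ContinuousLinearMap.adjoint_inner_left, hV, h, map_smul, inner_smul_left, inner_smul_right,
    Complex.conj_ofReal, ← mul_assoc, ← Complex.ofReal_mul, Complex.re_ofReal_mul, sq]

/-- The part of the difference of two channels cut off by the truncation. -/
theorem IsChannel.dominated_tail {ι : Type u} {Λ E : TraceClass ℕ →ₗ[ℂ] TraceClass ι}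
    (hΛ : IsChannel Λ) (hE : IsChannel E) (d : ℕ) {a : ℝ} (ha : 0 < a) :
    Dominated ((Λ - E) ∘ₗ (LinearMap.id - compress (truncProj d) (truncProj d)))
      fun n => if n < d then 4 * a ^ 2 else a ^ 2 + (a⁻¹) ^ 2 := by
  -- `V b` is diagonal, equal to `a` on the first `d` Fock states and to `b` on the others.
  let V : ℝ → Op ℕ := fun b => (b : ℂ) • 1 + ((a - b : ℝ) : ℂ) • truncProj d
  have hVadj (b : ℝ) : adjoint (V b) = V b := by
    have h1 : adjoint (1 : Op ℕ) = 1 := ContinuousLinearMap.adjoint_id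
    simp only [V, map_add, map_smulₛₗ, adjoint_truncProj, h1, Complex.conj_ofReal]
  have hVket (b : ℝ) (n : ℕ) : V b (ket n) = ((if n < d then a else b : ℝ) : ℂ) • ket n := by
    simp only [V, add_apply, smul_apply, truncProj_ket, one_apply_eq_self]
    split_ifs
    · rw [← add_smul]; push_cast; ring_nf
    · simp
  -- Chosen so that `a (b - b') = 1` and `b² - b'² = 1`. In `V b X V b - V b' X V b'` the truncated
  -- block then cancels while the off-diagonal and tail blocks keep coefficient `1`, which exhibits
  -- `X - P X P` as a difference of two completely positive maps. The free parameter `a` trades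
  -- weight between the block and the tail.
  set b : ℝ := (a + a⁻¹) / 2 with hb
  set b' : ℝ := (a - a⁻¹) / 2 with hb'
  have hab : a * b - a * b' = 1 := by rw [hb, hb']; field_simp; ring
  have hbb : b ^ 2 - b' ^ 2 = 1 := by rw [hb, hb']; field_simp; ring
  have hdiff : (LinearMap.id - compress (truncProj d) (truncProj d) :
      TraceClass ℕ →ₗ[ℂ] TraceClass ℕ) = compress (V b) (V b) - compress (V b') (V b') := by
    refine LinearMap.ext fun X => Subtype.ext ?_
    change (X : Op ℕ) - truncProj d * ((X : Op ℕ) * adjoint (truncProj d)) =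
      V b * ((X : Op ℕ) * adjoint (V b)) - V b' * ((X : Op ℕ) * adjoint (V b'))
    rw [hVadj, hVadj, adjoint_truncProj]
    have hab' : (a : ℂ) * b - a * b' = 1 := by exact_mod_cast hab
    have hbb' : (b : ℂ) ^ 2 - b' ^ 2 = 1 := by exact_mod_cast hbb
    simp only [V, add_mul, mul_add, smul_mul_assoc, mul_smul_comm, one_mul, mul_one,
      Complex.ofReal_sub]
    match_scalars
    · linear_combination -hbb'
    · linear_combination 2 * hab' - hbb'
    · linear_combination hbb' - hab'
    · linear_combination hbb' - hab'
  have hpt (b : ℝ) {X : TraceClass ℕ} : posTrace (compress (V b) (V b) X : Op ℕ) =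
      ∑' n : ℕ, ENNReal.ofReal
        ((if n < d then a else b) ^ 2 * (⟪ket n, (X : Op ℕ) (ket n)⟫_ℂ).re) :=
    tsum_congr fun n => by rw [inner_compress_ket (hVadj b) X (hVket b n)]
  have hcp (b : ℝ) := IsCompletelyPositive.compress (V b)
  have hΛc := hΛ.completelyPositive
  have hEc := hE.completelyPositive
  refine ⟨Λ ∘ₗ compress (V b) (V b) + E ∘ₗ compress (V b') (V b'),
    Λ ∘ₗ compress (V b') (V b') + E ∘ₗ compress (V b) (V b),
    (hΛc.comp (hcp b)).add (hEc.comp (hcp b')), (hΛc.comp (hcp b')).add (hEc.comp (hcp b)), ?_,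
    fun X hX => ?_⟩
  · rw [hdiff]
    refine LinearMap.ext fun X => ?_
    simp only [LinearMap.comp_apply, LinearMap.sub_apply, LinearMap.add_apply, map_sub]
    abel
  · have p1 := (hcp b).isPositive hX
    have p2 := (hcp b').isPositive hX
    have e1 : posTrace ((Λ ∘ₗ compress (V b) (V b) + E ∘ₗ compress (V b') (V b')) X : Op ι) =
        posTrace (compress (V b) (V b) X : Op ℕ) + posTrace (compress (V b') (V b') X : Op ℕ) := by
      rw [← hΛ.posTrace_eq p1, ← hE.posTrace_eq p2]
      exact posTrace_add (hΛc.isPositive p1) (hEc.isPositive p2)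
    have e2 : posTrace ((Λ ∘ₗ compress (V b') (V b') + E ∘ₗ compress (V b) (V b)) X : Op ι) =
        posTrace (compress (V b') (V b') X : Op ℕ) + posTrace (compress (V b) (V b) X : Op ℕ) := by
      rw [← hΛ.posTrace_eq p2, ← hE.posTrace_eq p1]
      exact posTrace_add (hΛc.isPositive p2) (hEc.isPositive p1)
    rw [e1, e2, hpt, hpt, ← ENNReal.tsum_add, ← ENNReal.tsum_add, ← ENNReal.tsum_add]
    refine ENNReal.tsum_le_tsum fun n => ?_
    have h0 := diag_nonneg hX n
    rw [← ENNReal.ofReal_add (by positivity) (by positivity),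
      ← ENNReal.ofReal_add (by positivity) (by positivity),
      ← ENNReal.ofReal_add (by positivity) (by positivity)]
    refine ENNReal.ofReal_le_ofReal (le_of_eq ?_)
    by_cases hn : n < d
    · simp only [hn, if_true]; ring
    · simp only [hn, if_false]; rw [hb, hb']; ring

/-! ### Matrix units -/

theorem rankOne_mem (x y : Hilb ℕ) : InnerProductSpace.rankOne ℂ x y ∈ TraceClass ℕ := by
  have h0 : InnerProductSpace.rankOne ℂ (ket (0 : ℕ)) (ket 0) ∈ TraceClass ℕ := by
    refine Submodule.subset_span ⟨isPositive_of_inner_nonneg fun x => ?_, ?_⟩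
    · rw [InnerProductSpace.inner_right_rankOne_apply, ← inner_conj_symm, mul_comm]
      exact mul_star_self_nonneg (⟪ket 0, x⟫_ℂ)
    · rw [posTrace, tsum_eq_single 0]
      · exact ENNReal.ofReal_ne_top
      · intro n hn
        rw [InnerProductSpace.inner_right_rankOne_apply, inner_ket, coord_ket, if_neg hn]
        simp
  have h := compress_mem (InnerProductSpace.rankOne ℂ x (ket (0 : ℕ)))
    (InnerProductSpace.rankOne ℂ y (ket (0 : ℕ))) h0
  convert h using 1
  refine ContinuousLinearMap.ext fun z => ?_
  simp [norm_ket]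

/-- The operator `|x⟩⟨y|`. -/
def ketBra (x y : Hilb ℕ) : TraceClass ℕ := ⟨InnerProductSpace.rankOne ℂ x y, rankOne_mem x y⟩

theorem trMul_ketBra (M : Op ℕ) (x y : Hilb ℕ) : trMul M (ketBra x y) = ⟪y, M x⟫_ℂ := by
  rw [trMul_apply, ketBra, InnerProductSpace.comp_rankOne]
  rw [tr, ← (hasSum_inner_coord y (M x)).tsum_eq]
  refine tsum_congr fun n => ?_
  rw [InnerProductSpace.inner_right_rankOne_apply, inner_ket, inner_ket_right, mul_comm]

theorem ketBra_self_isPositive (x : Hilb ℕ) : (ketBra x x : Op ℕ).IsPositive := by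
  refine isPositive_of_inner_nonneg fun y => ?_
  rw [ketBra, InnerProductSpace.inner_right_rankOne_apply, ← inner_conj_symm, mul_comm]
  exact mul_star_self_nonneg (⟪x, y⟫_ℂ)

/-- The self-adjoint operator `u |n⟩⟨m| + ū |m⟩⟨n|`. -/
def hermUnit (n m : ℕ) (u : ℂ) : TraceClass ℕ :=
  u • ketBra (ket n) (ket m) + (starRingEnd ℂ) u • ketBra (ket m) (ket n)

/-- The functional `X ↦ ū ⟨n|X|m⟩ + u ⟨m|X|n⟩`. -/
def hermCoeff (n m : ℕ) (u : ℂ) : TraceClass ℕ →ₗ[ℂ] ℂ :=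
  (starRingEnd ℂ) u • trMul (InnerProductSpace.rankOne ℂ (ket m) (ket n)) +
    u • trMul (InnerProductSpace.rankOne ℂ (ket n) (ket m))

theorem hermCoeff_apply (n m : ℕ) (u : ℂ) (X : TraceClass ℕ) :
    hermCoeff n m u X = (starRingEnd ℂ) u * ⟪ket n, (X : Op ℕ) (ket m)⟫_ℂ +
      u * ⟪ket m, (X : Op ℕ) (ket n)⟫_ℂ := by
  simp [hermCoeff, trMul_rankOne]

theorem compress_truncProj (d : ℕ) (X : TraceClass ℕ) :
    compress (truncProj d) (truncProj d) X = ∑ n ∈ Finset.range d, ∑ m ∈ Finset.range d,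
      ⟪ket n, (X : Op ℕ) (ket m)⟫_ℂ • ketBra (ket n) (ket m) := by
  refine Subtype.ext ?_
  change truncProj d ∘L (X : Op ℕ) ∘L adjoint (truncProj d) = _
  rw [adjoint_truncProj]
  simp only [Submodule.coe_sum, Submodule.coe_smul, ketBra]
  have h : (X : Op ℕ) ∘L truncProj d =
      ∑ m ∈ Finset.range d, InnerProductSpace.rankOne ℂ ((X : Op ℕ) (ket m)) (ket m) := by
    simp only [truncProj, ContinuousLinearMap.comp_finsetSum, InnerProductSpace.comp_rankOne]
  rw [h, ContinuousLinearMap.comp_finsetSum, Finset.sum_comm]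
  refine Finset.sum_congr rfl fun m _ => ?_
  rw [InnerProductSpace.comp_rankOne, truncProj]
  simp only [FunLike.coe_sum, Finset.sum_apply, InnerProductSpace.rankOne_apply, map_sum, map_smul,
    smul_apply]

/-- The phases `1, i`. -/
def phase : Fin 2 → ℂ := ![1, Complex.I]

theorem norm_phase (b : Fin 2) : ‖phase b‖ = 1 := by fin_cases b <;> simp [phase]

/-- Self-adjoint units are used because a Jordan decomposition will be applied to their images. The
factor `1/4` accounts for two phases and for each pair of indices occurring in both orders. -/
theorem compress_truncProj_eq_hermUnit (d : ℕ) (X : TraceClass ℕ) :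
    compress (truncProj d) (truncProj d) X = ∑ n ∈ Finset.range d, ∑ m ∈ Finset.range d,
      ∑ b, (1 / 4 : ℂ) • hermCoeff n m (phase b) X • hermUnit n m (phase b) := by
  have h (n m : ℕ) : ∑ b, (1 / 4 : ℂ) • hermCoeff n m (phase b) X • hermUnit n m (phase b) =
      (1 / 2 : ℂ) • ⟪ket n, (X : Op ℕ) (ket m)⟫_ℂ • ketBra (ket n) (ket m) +
      (1 / 2 : ℂ) • ⟪ket m, (X : Op ℕ) (ket n)⟫_ℂ • ketBra (ket m) (ket n) := by
    simp only [Fin.sum_univ_two, hermCoeff_apply, hermUnit, phase, Matrix.cons_val_zero,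
      Matrix.cons_val_one, map_one, Complex.conj_I]
    match_scalars <;> ring_nf <;> simp <;> ring
  simp_rw [h, Finset.sum_add_distrib]
  rw [Finset.sum_comm (f := fun n m => (1 / 2 : ℂ) • ⟪ket m, (X : Op ℕ) (ket n)⟫_ℂ •
    ketBra (ket m) (ket n)), ← Finset.sum_add_distrib, compress_truncProj]
  refine Finset.sum_congr rfl fun n _ => ?_
  rw [← Finset.sum_add_distrib]
  refine Finset.sum_congr rfl fun m _ => ?_
  rw [← add_smul]
  norm_num

/-! ### A bound on the diamond norm from matrix units -/

theorem inner_pair (X : TraceClass ℕ) (n m : ℕ) (a c : ℂ) :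
    ⟪a • ket n + c • ket m, (X : Op ℕ) (a • ket n + c • ket m)⟫_ℂ =
      (starRingEnd ℂ) a * a * ⟪ket n, (X : Op ℕ) (ket n)⟫_ℂ +
      (starRingEnd ℂ) c * c * ⟪ket m, (X : Op ℕ) (ket m)⟫_ℂ +
      ((starRingEnd ℂ) a * c * ⟪ket n, (X : Op ℕ) (ket m)⟫_ℂ +
        (starRingEnd ℂ) c * a * ⟪ket m, (X : Op ℕ) (ket n)⟫_ℂ) := by
  simp only [map_add, map_smul, inner_add_left, inner_add_right, inner_smul_left, inner_smul_right]
  ring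

theorem posTrace_smulRight {ι : Type u} (x : Hilb ℕ) {P : TraceClass ι}
    (hP : (P : Op ι).IsPositive) {X : TraceClass ℕ} (hX : (X : Op ℕ).IsPositive) :
    posTrace ((trMul (InnerProductSpace.rankOne ℂ x x)).smulRight P X : Op ι) =
      ENNReal.ofReal ((⟪x, (X : Op ℕ) x⟫_ℂ).re * (tr (P : Op ι)).re) := by
  have hcp := IsCompletelyPositive.trMul_smulRight (ketBra_self_isPositive x) hP
  refine (posTrace_eq_ofReal (hcp.isPositive hX) (Subtype.coe_prop _)).trans ?_
  have e : tr ((trMul (InnerProductSpace.rankOne ℂ x x)).smulRight P X : Op ι) =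
      ⟪x, (X : Op ℕ) x⟫_ℂ * tr (P : Op ι) := by
    rw [LinearMap.smulRight_apply, trMul_rankOne]
    exact tr_smul _ _
  refine (congrArg (fun z : ℂ => ENNReal.ofReal z.re) e).trans ?_
  have h1 := (Complex.nonneg_iff.1 (hX.inner_nonneg_right x)).2
  rw [Complex.mul_re, ← h1]
  simp

/-- The map `X ↦ (ū ⟨n|X|m⟩ + u ⟨m|X|n⟩) A`, for `A = P - R`. -/
theorem dominated_hermCoeff {ι : Type u} (n m : ℕ) {u : ℂ} (hu : ‖u‖ = 1) {P R : TraceClass ι}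
    (hP : (P : Op ι).IsPositive) (hR : (R : Op ι).IsPositive) {s t : ℝ} (hs : 0 < s)
    (ht : (tr (P : Op ι)).re + (tr (R : Op ι)).re ≤ t) :
    Dominated ((hermCoeff n m u).smulRight (P - R))
      fun k => (if k = n then s ^ 2 * t else 0) + (if k = m then (s⁻¹) ^ 2 * t else 0) := by
  -- Polarization: the quadratic forms of `X` at `x` and at `y` differ by `2 * hermCoeff n m u X`,
  -- and their sum has no cross terms. The scale `s` distributes the weight between `n` and `m`.
  let x : Hilb ℕ := (s : ℂ) • ket n + ((starRingEnd ℂ) u * (s⁻¹ : ℝ)) • ket m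
  let y : Hilb ℕ := (s : ℂ) • ket n + (-((starRingEnd ℂ) u * (s⁻¹ : ℝ))) • ket m
  let P' : TraceClass ι := (1 / 2 : ℂ) • P
  let R' : TraceClass ι := (1 / 2 : ℂ) • R
  have hhalf : (0 : ℂ) ≤ 1 / 2 := by
    simp
  have hP' : (P' : Op ι).IsPositive := hP.smul_of_nonneg hhalf
  have hR' : (R' : Op ι).IsPositive := hR.smul_of_nonneg hhalf
  have hs' : (s : ℂ) * ((s⁻¹ : ℝ) : ℂ) = 1 := by
    rw [← Complex.ofReal_mul, mul_inv_cancel₀ hs.ne', Complex.ofReal_one]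
  have huu : (starRingEnd ℂ) u * u = 1 := by
    rw [← Complex.normSq_eq_conj_mul_self, Complex.normSq_eq_norm_sq, hu]; simp
  have ex (X : TraceClass ℕ) : ⟪x, (X : Op ℕ) x⟫_ℂ =
      (s : ℂ) ^ 2 * ⟪ket n, (X : Op ℕ) (ket n)⟫_ℂ + ((s⁻¹ : ℝ) : ℂ) ^ 2 *
        ⟪ket m, (X : Op ℕ) (ket m)⟫_ℂ + hermCoeff n m u X := by
    rw [inner_pair, hermCoeff_apply]
    simp only [map_mul, Complex.conj_conj, Complex.conj_ofReal]
    linear_combination ((s⁻¹ : ℝ) : ℂ) ^ 2 * ⟪ket m, (X : Op ℕ) (ket m)⟫_ℂ * huu +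
      ((starRingEnd ℂ) u * ⟪ket n, (X : Op ℕ) (ket m)⟫_ℂ + u * ⟪ket m, (X : Op ℕ) (ket n)⟫_ℂ) * hs'
  have ey (X : TraceClass ℕ) : ⟪y, (X : Op ℕ) y⟫_ℂ =
      (s : ℂ) ^ 2 * ⟪ket n, (X : Op ℕ) (ket n)⟫_ℂ + ((s⁻¹ : ℝ) : ℂ) ^ 2 *
        ⟪ket m, (X : Op ℕ) (ket m)⟫_ℂ - hermCoeff n m u X := by
    rw [inner_pair, hermCoeff_apply]
    simp only [map_mul, map_neg, Complex.conj_conj, Complex.conj_ofReal]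
    linear_combination ((s⁻¹ : ℝ) : ℂ) ^ 2 * ⟪ket m, (X : Op ℕ) (ket m)⟫_ℂ * huu -
      ((starRingEnd ℂ) u * ⟪ket n, (X : Op ℕ) (ket m)⟫_ℂ + u * ⟪ket m, (X : Op ℕ) (ket n)⟫_ℂ) * hs'
  have hcp (z : Hilb ℕ) {Q : TraceClass ι} (hQ : (Q : Op ι).IsPositive) :=
    IsCompletelyPositive.trMul_smulRight (ketBra_self_isPositive z) hQ
  refine ⟨(trMul (InnerProductSpace.rankOne ℂ x x)).smulRight P' +
      (trMul (InnerProductSpace.rankOne ℂ y y)).smulRight R',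
    (trMul (InnerProductSpace.rankOne ℂ y y)).smulRight P' +
      (trMul (InnerProductSpace.rankOne ℂ x x)).smulRight R',
    (hcp x hP').add (hcp y hR'), (hcp y hP').add (hcp x hR'), ?_, fun X hX => ?_⟩
  · refine LinearMap.ext fun X => ?_
    simp only [LinearMap.sub_apply, LinearMap.add_apply, LinearMap.smulRight_apply, trMul_rankOne,
      ex, ey, P', R']
    module
  · have e1 : posTrace (((trMul (InnerProductSpace.rankOne ℂ x x)).smulRight P' +
        (trMul (InnerProductSpace.rankOne ℂ y y)).smulRight R') X : Op ι) = _ + _ :=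
      posTrace_add ((hcp x hP').isPositive hX) ((hcp y hR').isPositive hX)
    have e2 : posTrace (((trMul (InnerProductSpace.rankOne ℂ y y)).smulRight P' +
        (trMul (InnerProductSpace.rankOne ℂ x x)).smulRight R') X : Op ι) = _ + _ :=
      posTrace_add ((hcp y hP').isPositive hX) ((hcp x hR').isPositive hX)
    have hxn := (Complex.nonneg_iff.1 (hX.inner_nonneg_right x)).1
    have hyn := (Complex.nonneg_iff.1 (hX.inner_nonneg_right y)).1
    have hPn := (Complex.nonneg_iff.1 (tr_nonneg hP P.2)).1
    have hRn := (Complex.nonneg_iff.1 (tr_nonneg hR R.2)).1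
    have hPn' := (Complex.nonneg_iff.1 (tr_nonneg hP' P'.2)).1
    have hRn' := (Complex.nonneg_iff.1 (tr_nonneg hR' R'.2)).1
    have hPP : (tr (P' : Op ι)).re = (tr (P : Op ι)).re / 2 := by
      have : tr (P' : Op ι) = (1 / 2 : ℂ) * tr (P : Op ι) := tr_smul _ _
      rw [this]; simp [Complex.mul_re]; ring
    have hRR : (tr (R' : Op ι)).re = (tr (R : Op ι)).re / 2 := by
      have : tr (R' : Op ι) = (1 / 2 : ℂ) * tr (R : Op ι) := tr_smul _ _
      rw [this]; simp [Complex.mul_re]; ring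
    have hxy : (⟪x, (X : Op ℕ) x⟫_ℂ).re + (⟪y, (X : Op ℕ) y⟫_ℂ).re =
        2 * (s ^ 2 * (⟪ket n, (X : Op ℕ) (ket n)⟫_ℂ).re +
          (s⁻¹) ^ 2 * (⟪ket m, (X : Op ℕ) (ket m)⟫_ℂ).re) := by
      rw [ex, ey, ← Complex.ofReal_pow, ← Complex.ofReal_pow]
      simp only [Complex.add_re, Complex.sub_re, Complex.re_ofReal_mul]
      ring
    have hn0 := diag_nonneg hX n
    have hm0 := diag_nonneg hX m
    have ht0 : 0 ≤ t := (add_nonneg hPn hRn).trans ht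
    have hsplit : ∑' k : ℕ, ENNReal.ofReal (((if k = n then s ^ 2 * t else 0) +
        (if k = m then (s⁻¹) ^ 2 * t else 0)) * (⟪ket k, (X : Op ℕ) (ket k)⟫_ℂ).re) =
        ENNReal.ofReal (s ^ 2 * t * (⟪ket n, (X : Op ℕ) (ket n)⟫_ℂ).re) +
        ENNReal.ofReal ((s⁻¹) ^ 2 * t * (⟪ket m, (X : Op ℕ) (ket m)⟫_ℂ).re) := by
      rw [← tsum_ite_eq n (fun _ => ENNReal.ofReal (s ^ 2 * t * (⟪ket n, (X : Op ℕ) (ket n)⟫_ℂ).re)),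
        ← tsum_ite_eq m (fun _ => ENNReal.ofReal
          ((s⁻¹) ^ 2 * t * (⟪ket m, (X : Op ℕ) (ket m)⟫_ℂ).re)), ← ENNReal.tsum_add]
      refine tsum_congr fun k => ?_
      have hk0 := diag_nonneg hX k
      rw [add_mul, ENNReal.ofReal_add (mul_nonneg (by split_ifs <;> positivity) hk0)
        (mul_nonneg (by split_ifs <;> positivity) hk0)]
      congr 1
      · split_ifs with h
        · rw [h]
        · simp
      · split_ifs with h
        · rw [h]
        · simp
    rw [e1, e2, posTrace_smulRight x hP' hX, posTrace_smulRight y hR' hX,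
      posTrace_smulRight y hP' hX, posTrace_smulRight x hR' hX, hsplit,
      ← ENNReal.ofReal_add (by positivity) (by positivity),
      ← ENNReal.ofReal_add (by positivity) (by positivity),
      ← ENNReal.ofReal_add (by positivity) (by positivity),
      ← ENNReal.ofReal_add (by positivity) (by positivity)]
    refine ENNReal.ofReal_le_ofReal ?_
    rw [hPP, hRR]
    have h3 := mul_le_mul_of_nonneg_left ht (by positivity :
      0 ≤ s ^ 2 * (⟪ket n, (X : Op ℕ) (ket n)⟫_ℂ).re +
        (s⁻¹) ^ 2 * (⟪ket m, (X : Op ℕ) (ket m)⟫_ℂ).re)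
    have h4 : (⟪x, (X : Op ℕ) x⟫_ℂ).re * ((tr (P : Op ι)).re / 2) +
        (⟪y, (X : Op ℕ) y⟫_ℂ).re * ((tr (R : Op ι)).re / 2) +
        ((⟪y, (X : Op ℕ) y⟫_ℂ).re * ((tr (P : Op ι)).re / 2) +
        (⟪x, (X : Op ℕ) x⟫_ℂ).re * ((tr (R : Op ι)).re / 2)) =
        (s ^ 2 * (⟪ket n, (X : Op ℕ) (ket n)⟫_ℂ).re +
        (s⁻¹) ^ 2 * (⟪ket m, (X : Op ℕ) (ket m)⟫_ℂ).re) *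
          ((tr (P : Op ι)).re + (tr (R : Op ι)).re) := by
      linear_combination ((tr (P : Op ι)).re + (tr (R : Op ι)).re) / 2 * hxy
    rw [h4]
    linarith

/-! ### Thermal weights, and the passage from matrix units to the diamond norm. -/

/-- The thermal weight `(1 - e^{-ω}) e^{-ω n}` of the `n`-th Fock state. -/
def thermalWeight (ω : ℝ) (n : ℕ) : ℝ := (1 - Real.exp (-ω)) * Real.exp (-(ω * n))

theorem one_sub_exp_pos {ω : ℝ} (hω : 0 < ω) : 0 < 1 - Real.exp (-ω) :=
  by simpa using hω

theorem thermalWeight_pos {ω : ℝ} (hω : 0 < ω) (n : ℕ) : 0 < thermalWeight ω n :=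
  mul_pos (one_sub_exp_pos hω) (Real.exp_pos _)

theorem dTilde_eq {ω : ℝ} (Ω : ℝ) : dTilde ω Ω = Ω / (1 - Real.exp (-ω)) := by
  have h1 : Real.exp (-ω) * Real.exp ω = 1 := by rw [← Real.exp_add]; simp
  have h2 := (Real.exp_pos ω).ne'
  rw [dTilde, ← mul_div_mul_right _ (1 - Real.exp (-ω)) h2, sub_mul, h1, one_mul]

/-- Two channels are close in the exponential cut-off diamond norm if their difference is small on
the truncated matrix units. -/
theorem expDiamondNorm_sub_le {ι : Type u} {ω Ω : ℝ} (hω : 0 < ω) (hΩ : 0 < Ω)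
    {Λ E : TraceClass ℕ →ₗ[ℂ] TraceClass ι} (hΛ : IsChannel Λ) (hE : IsChannel E) (d : ℕ) {κ : ℝ}
    (hκ : 0 ≤ κ) (T : ℕ → ℕ → Fin 2 → ℝ)
    (hT : ∀ n < d, ∀ m < d, ∀ b, ∃ P R : TraceClass ι, (P : Op ι).IsPositive ∧
      (R : Op ι).IsPositive ∧ (Λ - E) (hermUnit n m (phase b)) = P - R ∧
      (tr (P : Op ι)).re + (tr (R : Op ι)).re ≤ T n m b)
    (hTκ : ∀ n < d, ∀ m < d, √(thermalWeight ω n * thermalWeight ω m) *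
      (T n m 0 + T n m 1) ≤ 2 * √2 * κ) :
    expDiamondNorm.{u, w} ω Ω (Λ - E) ≤
      ENNReal.ofReal (4 * √(Ω * Real.exp (-(ω * d))) + √2 * κ * d * dTilde ω Ω) := by
  set lam := thermalWeight ω with hlam
  have hl (n : ℕ) : 0 < lam n := thermalWeight_pos hω n
  set τ : ℝ := √(Ω * Real.exp (-(ω * d))) with hτ
  have hτ0 : 0 < τ := Real.sqrt_pos.2 (by positivity)
  have hq := one_sub_exp_pos hω
  -- With `a² = τ/2` the tail weight is `2τ` below `d` and `τ/2 + 2/τ` from `d` on, hence at most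
  -- `2τ + (2/τ) e^{ω(n-d)}`. As `τ² = Ω e^{-ωd}`, each of the two terms contributes `2τ` to the
  -- norm.
  have htail := hΛ.dominated_tail hE d (a := √(τ / 2)) (Real.sqrt_pos.2 (by positivity))
  have hTnn : ∀ n < d, ∀ m < d, ∀ b, 0 ≤ T n m b := by
    intro n hn m hm b
    obtain ⟨P, R, hP, hR, -, h⟩ := hT n hn m hm b
    exact (add_nonneg (Complex.nonneg_iff.1 (tr_nonneg hP P.2)).1
      (Complex.nonneg_iff.1 (tr_nonneg hR R.2)).1).trans h
  -- This is the weight from `dominated_hermCoeff` at `s² = √(lam n * lam m) / lam n`. For both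
  -- indices it has the form `√(lam n * lam m) / lam k`, so that `hTκ` bounds it by a multiple of `1
  -- / lam k`.
  let v : ℕ → ℕ → Fin 2 → ℕ → ℝ := fun n m b k =>
    (if k = n then √(lam n * lam m) / lam n * (1 / 4 * T n m b) else 0) +
      (if k = m then √(lam n * lam m) / lam m * (1 / 4 * T n m b) else 0)
  have hv0 : ∀ n < d, ∀ m < d, ∀ b k, 0 ≤ v n m b k := by
    intro n hn m hm b k
    have h0 := hTnn n hn m hm b
    have h1 := hl n
    have h2 := hl m
    simp only [v]
    refine add_nonneg ?_ ?_ <;> split_ifs <;> positivity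
  have hdom : ∀ n < d, ∀ m < d, ∀ b, Dominated ((hermCoeff n m (phase b)).smulRight
      ((1 / 4 : ℂ) • (Λ - E) (hermUnit n m (phase b)))) (v n m b) := by
    intro n hn m hm b
    obtain ⟨P, R, hP, hR, e, h⟩ := hT n hn m hm b
    have hquarter : (0 : ℂ) ≤ 1 / 4 := by
      simp
    have htr (Q : TraceClass ι) : (tr (((1 / 4 : ℂ) • Q : TraceClass ι) : Op ι)).re =
        1 / 4 * (tr (Q : Op ι)).re := by
      have : tr (((1 / 4 : ℂ) • Q : TraceClass ι) : Op ι) = (1 / 4 : ℂ) * tr (Q : Op ι) :=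
        tr_smul _ _
      rw [this, show (1 / 4 : ℂ) = ((1 / 4 : ℝ) : ℂ) by norm_num, Complex.re_ofReal_mul]
    have hg : 0 < √(lam n * lam m) := Real.sqrt_pos.2 (mul_pos (hl n) (hl m))
    have hs : 0 < √(√(lam n * lam m) / lam n) := Real.sqrt_pos.2 (div_pos hg (hl n))
    have hdo := dominated_hermCoeff n m (norm_phase b) (P := (1 / 4 : ℂ) • P)
      (R := (1 / 4 : ℂ) • R) (hP.smul_of_nonneg hquarter) (hR.smul_of_nonneg hquarter) hs
      (t := 1 / 4 * T n m b) (by rw [htr, htr]; linarith)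
    rw [e, smul_sub]
    refine hdo.mono fun k => le_of_eq ?_
    simp only [v]
    have hs2 : √(√(lam n * lam m) / lam n) ^ 2 = √(lam n * lam m) / lam n :=
      Real.sq_sqrt (div_pos hg (hl n)).le
    have hs3 : (√(√(lam n * lam m) / lam n))⁻¹ ^ 2 = √(lam n * lam m) / lam m := by
      rw [inv_pow, hs2, inv_div, div_eq_div_iff hg.ne' (hl m).ne',
        Real.mul_self_sqrt (mul_pos (hl n) (hl m)).le]
    rw [hs2, hs3]
  have hsum := Dominated.sum (Finset.range d) (Φ := fun n => ∑ m ∈ Finset.range d, ∑ b,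
      (hermCoeff n m (phase b)).smulRight ((1 / 4 : ℂ) • (Λ - E) (hermUnit n m (phase b))))
      (v := fun n => ∑ m ∈ Finset.range d, ∑ b, v n m b)
      (fun n hn => Dominated.sum _ (fun m hm => Dominated.sum _
        (fun b _ => hdom n (Finset.mem_range.1 hn) m (Finset.mem_range.1 hm) b)
        (fun b _ => hv0 n (Finset.mem_range.1 hn) m (Finset.mem_range.1 hm) b))
        (fun m hm k => by
          rw [Finset.sum_apply]
          exact Finset.sum_nonneg fun b _ =>
            hv0 n (Finset.mem_range.1 hn) m (Finset.mem_range.1 hm) b k))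
      (fun n hn k => by
        simp only [Finset.sum_apply]
        exact Finset.sum_nonneg fun m hm => Finset.sum_nonneg fun b _ =>
            hv0 n (Finset.mem_range.1 hn) m (Finset.mem_range.1 hm) b k)
  have hsplit : Λ - E = (Λ - E) ∘ₗ (LinearMap.id - compress (truncProj d) (truncProj d)) +
      ∑ n ∈ Finset.range d, ∑ m ∈ Finset.range d, ∑ b,
        (hermCoeff n m (phase b)).smulRight
          ((1 / 4 : ℂ) • (Λ - E) (hermUnit n m (phase b))) := by
    refine LinearMap.ext fun X => ?_
    have h := congrArg (fun Z => (Λ - E) Z) (compress_truncProj_eq_hermUnit d X)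
    simp only [map_sum, map_smul] at h
    rw [LinearMap.add_apply, LinearMap.comp_apply, LinearMap.sub_apply LinearMap.id, map_sub, h]
    simp only [LinearMap.sum_apply, LinearMap.smulRight_apply, LinearMap.id_apply]
    rw [eq_comm, sub_add, sub_eq_self, sub_eq_zero]
    refine Finset.sum_congr rfl fun n _ => Finset.sum_congr rfl fun m _ =>
      Finset.sum_congr rfl fun b _ => smul_comm _ _ _
  have hvsum0 : ∀ k, 0 ≤ (∑ n ∈ Finset.range d, ∑ m ∈ Finset.range d, ∑ b, v n m b) k := by
    intro k
    simp only [Finset.sum_apply]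
    exact Finset.sum_nonneg fun n hn => Finset.sum_nonneg fun m hm => Finset.sum_nonneg fun b _ =>
      hv0 n (Finset.mem_range.1 hn) m (Finset.mem_range.1 hm) b k
  have htot := htail.add hsum (fun n => by split_ifs <;> positivity) hvsum0
  rw [← hsplit] at htot
  -- An index `k` occurs in at most `d` pairs as `n` and in `d` as `m`. Since `1 / lam k` is
  -- proportional to `e^{ωk}`, the total is a multiple of the energy weight.
  have hvk (k : ℕ) : (∑ n ∈ Finset.range d, ∑ m ∈ Finset.range d, ∑ b, v n m b) k ≤
      √2 * κ * d / (1 - Real.exp (-ω)) * Real.exp (ω * k) := by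
    have e1 : √2 * κ * d / (1 - Real.exp (-ω)) * Real.exp (ω * k) = √2 * κ * d / lam k := by
      rw [hlam, thermalWeight, Real.exp_neg (ω * k)]
      field_simp
    have hpt : ∀ n ∈ Finset.range d, ∀ m ∈ Finset.range d, ∑ b, v n m b k ≤
        (if k = n then √2 * κ / 2 / lam k else 0) +
          (if k = m then √2 * κ / 2 / lam k else 0) := by
      intro n hn m hm
      have h := hTκ n (Finset.mem_range.1 hn) m (Finset.mem_range.1 hm)
      simp only [v, Fin.sum_univ_two]
      have h' (j : ℕ) : √(lam n * lam m) / lam j * (1 / 4 * T n m 0) +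
          √(lam n * lam m) / lam j * (1 / 4 * T n m 1) ≤ √2 * κ / 2 / lam j := by
        rw [show √(lam n * lam m) / lam j * (1 / 4 * T n m 0) +
          √(lam n * lam m) / lam j * (1 / 4 * T n m 1) =
          (√(lam n * lam m) * (T n m 0 + T n m 1) / 4) / lam j by ring]
        exact div_le_div_of_nonneg_right (by linarith) (hl j).le
      by_cases h1 : k = n <;> by_cases h2 : k = m
      · have := h' k
        subst h1 h2
        simp only [if_true]
        linarith
      · have := h' n
        subst h1
        simp only [h2, if_true, if_false]
        linarith
      · have := h' m
        subst h2
        simp only [h1, if_true, if_false]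
        linarith
      · simp [h1, h2]
    simp only [Finset.sum_apply]
    refine (Finset.sum_le_sum fun n hn => Finset.sum_le_sum fun m hm => hpt n hn m hm).trans ?_
    rw [e1]
    simp only [Finset.sum_add_distrib, Finset.sum_const, Finset.card_range, Finset.sum_ite_eq,
      nsmul_eq_mul, ← Finset.mul_sum]
    have h0 : 0 ≤ √2 * κ / 2 / lam k := by have := hl k; positivity
    have hd : (0 : ℝ) ≤ d := Nat.cast_nonneg d
    have h1 : (if k ∈ Finset.range d then √2 * κ / 2 / lam k else 0) ≤ √2 * κ / 2 / lam k := by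
      split_ifs
      · exact le_rfl
      · exact h0
    calc _ ≤ d * (√2 * κ / 2 / lam k) + d * (√2 * κ / 2 / lam k) := by gcongr
      _ = _ := by ring
  have hfin := htot.expDiamondNorm_le (ω := ω) (Ω := Ω) (α := 2 * τ)
    (β := 2 / τ * Real.exp (-(ω * d)) + √2 * κ * d / (1 - Real.exp (-ω)))
    (by positivity) (by positivity) hΩ.le (fun n => ?_)
  · refine hfin.trans_eq ?_
    congr 1
    rw [dTilde_eq]
    have h1 : Ω * Real.exp (-(ω * d)) = τ * τ := (Real.mul_self_sqrt (by positivity)).symm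
    have h2 : 2 / τ * Real.exp (-(ω * d)) * Ω = 2 * τ := by
      rw [mul_assoc, mul_comm (Real.exp _), h1]; field_simp
    rw [add_mul, h2]
    ring
  · rw [Pi.add_apply, add_mul, ← add_assoc]
    refine add_le_add ?_ (hvk n)
    have ha2 : √(τ / 2) ^ 2 = τ / 2 := Real.sq_sqrt (by positivity)
    rw [inv_pow, ha2, mul_assoc, ← Real.exp_add]
    split_ifs with hn
    · have := Real.exp_pos (-(ω * d) + ω * n)
      have : 0 < 2 / τ * Real.exp (-(ω * d) + ω * n) := by positivity
      linarith
    · have h1 : 1 ≤ Real.exp (-(ω * d) + ω * n) := by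
        refine Real.one_le_exp ?_
        have : (d : ℝ) ≤ n := by exact_mod_cast not_lt.1 hn
        nlinarith
      have h2 : 2 / τ * 1 ≤ 2 / τ * Real.exp (-(ω * d) + ω * n) := by gcongr
      rw [inv_div]
      linarith

/-! ### Measure-and-prepare channels -/

theorem measurePrepare_apply {ι : Type u} {κ : Type v} {K : ℕ} (M : Fin K → Op ι)
    (σ : Fin K → TraceClass κ) (X : TraceClass ι) :
    measurePrepare M σ X = ∑ k, trMul (M k) X • σ k := by
  simp [measurePrepare]

theorem tr_sum_smul {κ : Type v} {α : Type*} (s : Finset α) (a : α → ℂ) (σ : α → TraceClass κ) :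
    tr ((∑ k ∈ s, a k • σ k : TraceClass κ) : Op κ) = ∑ k ∈ s, a k * tr (σ k : Op κ) := by
  have := map_sum (trMul (1 : Op κ)) (fun k => a k • σ k) s
  simpa only [map_smul, trMul_one, smul_eq_mul] using this

theorem isChannel_measurePrepare {ι : Type u} {κ : Type v} {K : ℕ} {M : Fin K → Op ι}
    (hM : IsPOVM M) {σ : Fin K → TraceClass κ} (hσ : ∀ k, IsState (σ k)) :
    IsChannel (measurePrepare M σ) := by
  refine ⟨IsCompletelyPositive.sum _ fun k _ =>
    IsCompletelyPositive.trMul_smulRight (hM.pos k) (hσ k).pos, fun X => ?_⟩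
  rw [measurePrepare_apply, tr_sum_smul, ← trMul_one, ← hM.sum_eq_one, trMul_sum]
  exact Finset.sum_congr rfl fun k _ => by rw [(hσ k).trace_one, mul_one]

theorem IsChannel.isState {ι : Type u} {κ : Type v} {Λ : TraceClass ι →ₗ[ℂ] TraceClass κ}
    (hΛ : IsChannel Λ) {ρ : TraceClass ι} (hρ : IsState ρ) : IsState (Λ ρ) :=
  ⟨hΛ.completelyPositive.isPositive hρ.pos, (hΛ.tracePreserving ρ).trans hρ.trace_one⟩

theorem inner_ket_ket (n m : ℕ) : ⟪ket n, ket m⟫_ℂ = if n = m then 1 else 0 := by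
  rw [inner_ket, coord_ket]
  congr

theorem tr_ketBra_ket (n m : ℕ) :
    tr (ketBra (ket n) (ket m) : Op ℕ) = if n = m then 1 else 0 := by
  rw [← trMul_one, trMul_ketBra]
  simp [inner_ket_ket, eq_comm]

theorem isState_ketBra_ket (n : ℕ) : IsState (ketBra (ket n) (ket n)) :=
  ⟨ketBra_self_isPositive _, by rw [tr_ketBra_ket, if_pos rfl]⟩

/-! ### Effects on the input system -/

theorem isStarProjection_truncProj (d : ℕ) : IsStarProjection (truncProj d) := by
  refine ⟨?_, adjoint_truncProj d⟩
  refine op_ext fun k i => ?_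
  change ⟪ket k, truncProj d (truncProj d (ket i))⟫_ℂ = _
  rw [truncProj_ket]
  split_ifs with h
  · rw [truncProj_ket, if_pos h]
  · simp

section Effects

variable {μ : Type u} (Λ : TraceClass ℕ →ₗ[ℂ] TraceClass μ) (d : ℕ)

/-- `Tr(Q Λ(|n⟩⟨m|))`. -/
def corner (Q : Op μ) (n m : ℕ) : ℂ := trMul Q (Λ (ketBra (ket n) (ket m)))

/-- The effect on the input that is `Λ†(Q)` on the first `d` Fock states and
`⟨0|Λ†(Q)|0⟩` times the identity on their complement. -/
def effect (Q : Op μ) : Op ℕ :=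
  ∑ n ∈ Finset.range d, ∑ m ∈ Finset.range d,
    corner Λ Q n m • InnerProductSpace.rankOne ℂ (ket m) (ket n) +
  corner Λ Q 0 0 • (1 - truncProj d)

variable {Λ d}

theorem corner_self_nonneg (hΛ : IsCompletelyPositive Λ) {Q : Op μ} (hQ : Q.IsPositive) (n : ℕ) :
    0 ≤ corner Λ Q n n :=
  trMul_nonneg hQ (hΛ.isPositive (ketBra_self_isPositive _))

/-- On the truncated block the quadratic form at `x` is `Tr(Q Λ(|y⟩⟨y|))`, where `y` is the
truncation of `x`. -/
theorem effect_isPositive (hΛ : IsCompletelyPositive Λ) {Q : Op μ} (hQ : Q.IsPositive) :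
    (effect Λ d Q).IsPositive := by
  refine ContinuousLinearMap.IsPositive.add (isPositive_of_inner_nonneg fun x => ?_)
    (ContinuousLinearMap.IsPositive.smul_of_nonneg ((ContinuousLinearMap.nonneg_iff_isPositive _).1
      (isStarProjection_truncProj d).one_sub.nonneg) (corner_self_nonneg hΛ hQ 0))
  set y : Hilb ℕ := ∑ n ∈ Finset.range d, ⟪ket n, x⟫_ℂ • ket n with hy
  have e : ketBra y y = ∑ n ∈ Finset.range d, ∑ m ∈ Finset.range d,
      (⟪ket n, x⟫_ℂ * ⟪x, ket m⟫_ℂ) • ketBra (ket n) (ket m) := by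
    refine Subtype.ext ?_
    simp only [ketBra, Submodule.coe_sum, Submodule.coe_smul, hy, map_sum, map_smulₛₗ,
      FunLike.coe_sum, Finset.sum_apply, inner_conj_symm, RingHom.id_apply,
      smul_apply]
    rw [Finset.sum_comm]
    refine Finset.sum_congr rfl fun n _ => ?_
    rw [Finset.smul_sum]
    exact Finset.sum_congr rfl fun m _ => by rw [smul_smul, mul_comm]
  refine (trMul_nonneg hQ (hΛ.isPositive (ketBra_self_isPositive y))).trans_eq ?_
  rw [e]
  simp only [map_sum, map_smul, FunLike.coe_sum, Finset.sum_apply, inner_sum, smul_apply,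
    InnerProductSpace.rankOne_apply, inner_smul_right, corner, smul_eq_mul]
  exact Finset.sum_congr rfl fun n _ => Finset.sum_congr rfl fun m _ => by ring

theorem inner_effect {Q : Op μ} {n m : ℕ} (hn : n < d) (hm : m < d) :
    ⟪ket m, effect Λ d Q (ket n)⟫_ℂ = corner Λ Q n m := by
  simp only [effect, add_apply, inner_add_right, FunLike.coe_sum, Finset.sum_apply, inner_sum,
    smul_apply, InnerProductSpace.rankOne_apply, inner_smul_right, inner_ket_ket, sub_apply,
    one_apply_eq_self, truncProj_ket, if_pos hn, sub_self, inner_zero_right, mul_zero, add_zero]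
  simp [hn, hm]

/-- Trace preservation makes the corners sum to the identity matrix; in particular the vacuum
corners sum to `1`, which fills the complement of the truncation. -/
theorem sum_effect {Z : Type*} [Fintype Z] {E : Z → Op μ} (hE : ∑ z, E z = 1)
    (hΛ : IsChannel Λ) : ∑ z, effect Λ d (E z) = 1 := by
  have hc (n m : ℕ) : ∑ z, corner Λ (E z) n m = if n = m then 1 else 0 := by
    simp only [corner]
    rw [← trMul_sum, hE, trMul_one, hΛ.tracePreserving, tr_ketBra_ket]
  simp only [effect, Finset.sum_add_distrib]
  rw [← Finset.sum_smul, hc, if_pos rfl, one_smul, Finset.sum_comm]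
  have h2 : ∑ n ∈ Finset.range d, ∑ z, ∑ m ∈ Finset.range d,
      corner Λ (E z) n m • InnerProductSpace.rankOne ℂ (ket m) (ket n) = truncProj d := by
    refine Finset.sum_congr rfl fun n hn => ?_
    rw [Finset.sum_comm]
    simp_rw [← Finset.sum_smul, hc]
    simp [Finset.mem_range.1 hn]
  rw [h2]
  abel

/-- For a truncation dimension above `n` and `m` the corners are matrix elements of the positive
operator `effect`. Hermitian symmetry, and the Cauchy–Schwarz bound that follows, are inherited from
it. -/
theorem corner_conj (hΛ : IsCompletelyPositive Λ) {Q : Op μ} (hQ : Q.IsPositive) (n m : ℕ) :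
    corner Λ Q m n = (starRingEnd ℂ) (corner Λ Q n m) := by
  have hn : n < max n m + 1 := by omega
  have hm : m < max n m + 1 := by omega
  rw [← inner_effect (Λ := Λ) hn hm, ← inner_effect (Λ := Λ) hm hn, inner_conj_symm]
  exact ((effect_isPositive hΛ hQ).inner_left_eq_inner_right _ _).symm

theorem norm_corner_sq_le (hΛ : IsCompletelyPositive Λ) {Q : Op μ} (hQ : Q.IsPositive) (n m : ℕ) :
    ‖corner Λ Q n m‖ ^ 2 ≤ (corner Λ Q n n).re * (corner Λ Q m m).re := by
  have hn : n < max n m + 1 := by omega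
  have hm : m < max n m + 1 := by omega
  rw [← inner_effect (Λ := Λ) hn hm, ← inner_effect (Λ := Λ) hn hn,
    ← inner_effect (Λ := Λ) hm hm]
  obtain ⟨R, hR, e⟩ := exists_sqrt (effect_isPositive (d := max n m + 1) hΛ hQ)
  rw [← e, re_inner_sq hR, re_inner_sq hR, ContinuousLinearMap.comp_apply,
    ← ContinuousLinearMap.adjoint_inner_left, hR, ← mul_pow, mul_comm]
  exact pow_le_pow_left₀ (norm_nonneg _) (norm_inner_le_norm _ _) 2

theorem corner_add (Q Q' : Op μ) (n m : ℕ) :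
    corner Λ (Q + Q') n m = corner Λ Q n m + corner Λ Q' n m := trMul_add _ _ _

/-! ### The purity potential -/

variable (Λ d) (lam : ℕ → ℝ)

/-- The probability of the effect `Q` on the output of the weighted mixture of the first `d` Fock
states. -/
def mass (Q : Op μ) : ℝ := ∑ n ∈ Finset.range d, lam n * (corner Λ Q n n).re

/-- The purity of the input conditioned on the effect `Q`, times the probability of `Q`. -/
def purity (Q : Op μ) : ℝ :=
  (∑ n ∈ Finset.range d, ∑ m ∈ Finset.range d, lam n * lam m * ‖corner Λ Q n m‖ ^ 2) /
    mass Λ d lam Q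

/-- The deviation of the part `Q` of the effect `Q₀` from being proportional to `Q₀`. -/
def deviation (Q₀ Q : Op μ) (n m : ℕ) : ℂ :=
  corner Λ Q n m - ((mass Λ d lam Q / mass Λ d lam Q₀ : ℝ) : ℂ) * corner Λ Q₀ n m

variable {Λ d lam}

theorem mass_add (Q Q' : Op μ) : mass Λ d lam (Q + Q') = mass Λ d lam Q + mass Λ d lam Q' := by
  simp only [mass, corner_add, Complex.add_re, mul_add, Finset.sum_add_distrib]

theorem mass_nonneg (hΛ : IsCompletelyPositive Λ) (hl : ∀ n, 0 < lam n) {Q : Op μ}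
    (hQ : Q.IsPositive) : 0 ≤ mass Λ d lam Q :=
  Finset.sum_nonneg fun n _ => mul_nonneg (hl n).le
    (Complex.nonneg_iff.1 (corner_self_nonneg hΛ hQ n)).1

theorem corner_eq_zero (hΛ : IsCompletelyPositive Λ) (hl : ∀ n, 0 < lam n) {Q : Op μ}
    (hQ : Q.IsPositive) (h : mass Λ d lam Q = 0) {n : ℕ} (hn : n < d) (m : ℕ) :
    corner Λ Q n m = 0 := by
  have h1 := (Finset.sum_eq_zero_iff_of_nonneg fun n _ => mul_nonneg (hl n).le
    (Complex.nonneg_iff.1 (corner_self_nonneg hΛ hQ n)).1).1 h n (Finset.mem_range.2 hn)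
  have h2 : (corner Λ Q n n).re = 0 := (mul_eq_zero.1 h1).resolve_left (hl n).ne'
  have h3 := norm_corner_sq_le hΛ hQ n m
  rw [h2, zero_mul] at h3
  exact norm_eq_zero.1 (pow_eq_zero_iff two_ne_zero |>.1 (le_antisymm h3 (sq_nonneg _)))

/-- This is `Tr σ² ≤ (Tr σ)²` for positive `σ`, by Cauchy–Schwarz on corners. Summed over the
outcomes it caps the potential by the total thermal weight. -/
theorem purity_le_mass (hΛ : IsCompletelyPositive Λ) (hl : ∀ n, 0 < lam n) {Q : Op μ}
    (hQ : Q.IsPositive) : purity Λ d lam Q ≤ mass Λ d lam Q := by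
  refine div_le_of_le_mul₀ (mass_nonneg hΛ hl hQ) (mass_nonneg hΛ hl hQ) ?_
  rw [mass, Finset.sum_mul_sum]
  refine Finset.sum_le_sum fun n _ => Finset.sum_le_sum fun m _ => ?_
  have := mul_le_mul_of_nonneg_left (norm_corner_sq_le hΛ hQ n m) (mul_pos (hl n) (hl m)).le
  linarith

/-- The decomposition of variance into a weighted mean of squares minus the square of the mean, with
weights `p₁`, `p₂`. The last two hypotheses make the convention `x / 0 = 0` harmless. -/
theorem div_add_div_sub_div_eq {c₁ c₂ : ℂ} {p₁ p₂ : ℝ} (hp₁ : 0 ≤ p₁) (hp₂ : 0 ≤ p₂)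
    (h₁ : p₁ = 0 → c₁ = 0) (h₂ : p₂ = 0 → c₂ = 0) :
    ‖c₁‖ ^ 2 / p₁ + ‖c₂‖ ^ 2 / p₂ - ‖c₁ + c₂‖ ^ 2 / (p₁ + p₂) =
      ‖c₁ - ((p₁ / (p₁ + p₂) : ℝ) : ℂ) * (c₁ + c₂)‖ ^ 2 / p₁ +
      ‖c₂ - ((p₂ / (p₁ + p₂) : ℝ) : ℂ) * (c₁ + c₂)‖ ^ 2 / p₂ := by
  rcases hp₁.eq_or_lt with rfl | hp₁
  · rw [h₁ rfl]
    rcases hp₂.eq_or_lt with rfl | hp₂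
    · simp
    · simp [hp₂.ne']
  rcases hp₂.eq_or_lt with rfl | hp₂
  · rw [h₂ rfl]
    simp [hp₁.ne']
  have hp : p₁ + p₂ ≠ 0 := (add_pos hp₁ hp₂).ne'
  simp only [← Complex.normSq_eq_norm_sq, Complex.normSq_apply, Complex.add_re, Complex.add_im,
    Complex.sub_re, Complex.sub_im, Complex.re_ofReal_mul, Complex.im_ofReal_mul]
  field_simp
  ring

/-- Refining an effect increases the purity potential. -/
theorem purity_gain (hΛ : IsCompletelyPositive Λ) (hl : ∀ n, 0 < lam n) {Q₁ Q₂ : Op μ}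
    (h₁ : Q₁.IsPositive) (h₂ : Q₂.IsPositive) :
    purity Λ d lam Q₁ + purity Λ d lam Q₂ - purity Λ d lam (Q₁ + Q₂) =
      ∑ n ∈ Finset.range d, ∑ m ∈ Finset.range d, lam n * lam m *
        (‖deviation Λ d lam (Q₁ + Q₂) Q₁ n m‖ ^ 2 / mass Λ d lam Q₁ +
          ‖deviation Λ d lam (Q₁ + Q₂) Q₂ n m‖ ^ 2 / mass Λ d lam Q₂) := by
  simp only [purity, Finset.sum_div, ← Finset.sum_add_distrib, ← Finset.sum_sub_distrib]
  refine Finset.sum_congr rfl fun n hn => Finset.sum_congr rfl fun m _ => ?_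
  have h := div_add_div_sub_div_eq (c₁ := corner Λ Q₁ n m) (c₂ := corner Λ Q₂ n m)
    (mass_nonneg (d := d) hΛ hl h₁) (mass_nonneg (d := d) hΛ hl h₂)
    (fun h => corner_eq_zero hΛ hl h₁ h (Finset.mem_range.1 hn) m)
    (fun h => corner_eq_zero hΛ hl h₂ h (Finset.mem_range.1 hn) m)
  simp only [deviation, mass_add, corner_add]
  rw [← h]
  ring

theorem deviation_comm (hΛ : IsCompletelyPositive Λ) {Q₀ Q : Op μ}
    (h₀ : Q₀.IsPositive) (h : Q.IsPositive) (n m : ℕ) :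
    deviation Λ d lam Q₀ Q m n = (starRingEnd ℂ) (deviation Λ d lam Q₀ Q n m) := by
  simp only [deviation, map_sub, map_mul, Complex.conj_ofReal]
  rw [corner_conj hΛ h₀ n m, corner_conj hΛ h n m]

/-- The gain in purity seen by a single matrix element. -/
theorem le_purity_gain (hΛ : IsCompletelyPositive Λ) (hl : ∀ n, 0 < lam n) {Q₁ Q₂ : Op μ}
    (h₁ : Q₁.IsPositive) (h₂ : Q₂.IsPositive) {n m : ℕ} (hn : n < d) (hm : m < d) :
    (if n = m then 1 else 2) * (lam n * lam m) *
        (‖deviation Λ d lam (Q₁ + Q₂) Q₁ n m‖ ^ 2 / mass Λ d lam Q₁ +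
          ‖deviation Λ d lam (Q₁ + Q₂) Q₂ n m‖ ^ 2 / mass Λ d lam Q₂) ≤
      purity Λ d lam Q₁ + purity Λ d lam Q₂ - purity Λ d lam (Q₁ + Q₂) := by
  rw [purity_gain hΛ hl h₁ h₂, ← Finset.sum_product']
  set g : ℕ × ℕ → ℝ := fun p => lam p.1 * lam p.2 *
        (‖deviation Λ d lam (Q₁ + Q₂) Q₁ p.1 p.2‖ ^ 2 / mass Λ d lam Q₁ +
          ‖deviation Λ d lam (Q₁ + Q₂) Q₂ p.1 p.2‖ ^ 2 / mass Λ d lam Q₂) with hg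
  have hg0 (p) : 0 ≤ g p := by
    have e1 := hl p.1
    have e2 := hl p.2
    have e3 := mass_nonneg (d := d) hΛ hl h₁
    have e4 := mass_nonneg (d := d) hΛ hl h₂
    positivity
  -- An off-diagonal element contributes to the gain at `(n, m)` and equally at `(m, n)`; hence the
  -- factor `2`.
  have hswap : g (m, n) = g (n, m) := by
    have h12 := h₁.add h₂
    simp only [hg]
    rw [deviation_comm hΛ h12 h₁ n m, deviation_comm hΛ h12 h₂ n m, RCLike.norm_conj,
      RCLike.norm_conj, mul_comm (lam m)]
  have hsub : ({(n, m), (m, n)} : Finset (ℕ × ℕ)) ⊆ Finset.range d ×ˢ Finset.range d := by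
    intro p hp
    simp only [Finset.mem_insert, Finset.mem_singleton] at hp
    rcases hp with rfl | rfl <;> simp [hn, hm]
  refine le_trans ?_ (Finset.sum_le_sum_of_subset_of_nonneg hsub fun p _ _ => hg0 p)
  by_cases h : n = m
  · subst h
    simp
  · have e : (2 : ℝ) * (lam n * lam m) *
        (‖deviation Λ d lam (Q₁ + Q₂) Q₁ n m‖ ^ 2 / mass Λ d lam Q₁ +
          ‖deviation Λ d lam (Q₁ + Q₂) Q₂ n m‖ ^ 2 / mass Λ d lam Q₂) = g (n, m) + g (m, n) := by
      rw [hswap]; simp only [hg]; ring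
    rw [Finset.sum_pair (by simp [h]), if_neg h, e]

end Effects

/-! ### Projective measurements of the fragments -/

section Measurement

variable {N : ℕ} {β : Fin N → Type u}

/-- A projective measurement that acts trivially on the fragments outside `J`. -/
structure IsMeasurement (J : Finset (Fin N)) {Z : Type*} [Fintype Z] (E : Z → Op (∀ i, β i)) :
    Prop where
  proj : ∀ z, IsStarProjection (E z)
  sum_eq_one : ∑ z, E z = 1
  comm : ∀ j ∉ J, ∀ Q z, Commute (E z) (lift j Q)

/-- The refinement of a measurement by two-outcome measurements `{Q z, 1 - Q z}` of the `j`-th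
fragment. -/
def refine {Z : Type*} (E : Z → Op (∀ i, β i)) (j : Fin N) (Q : Z → Op (β j)) :
    Z × Bool → Op (∀ i, β i) :=
  fun p => E p.1 * lift j (if p.2 then Q p.1 else 1 - Q p.1)

theorem refine_add_refine {Z : Type*} (E : Z → Op (∀ i, β i)) (j : Fin N) (Q : Z → Op (β j))
    (z : Z) : refine E j Q (z, true) + refine E j Q (z, false) = E z := by
  simp only [refine, if_true, Bool.false_eq_true, if_false]
  rw [← mul_add, ← lift_add, add_sub_cancel, lift_one, mul_one]

theorem IsMeasurement.refine {J : Finset (Fin N)} {Z : Type*} [Fintype Z] {E : Z → Op (∀ i, β i)}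
    (hE : IsMeasurement J E) {j : Fin N} (hj : j ∉ J) {Q : Z → Op (β j)}
    (hQ : ∀ z, IsStarProjection (Q z)) : IsMeasurement (insert j J) (refine E j Q) := by
  have hQb (p : Z × Bool) : IsStarProjection (if p.2 then Q p.1 else 1 - Q p.1) := by
    split_ifs
    · exact hQ _
    · exact (hQ _).one_sub
  refine ⟨fun p => ?_, ?_, fun i hi Q' p => ?_⟩
  · have h1 := hE.proj p.1
    have h2 := isStarProjection_lift j (hQb p)
    have hc := hE.comm j hj (if p.2 then Q p.1 else 1 - Q p.1) p.1
    exact ⟨h1.isIdempotentElem.mul_of_commute hc h2.isIdempotentElem,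
      (h1.isSelfAdjoint.commute_iff h2.isSelfAdjoint).1 hc⟩
  · rw [Fintype.sum_prod_type]
    simp only [Fintype.sum_bool, refine_add_refine]
    exact hE.sum_eq_one
  · rw [Finset.mem_insert, not_or] at hi
    exact (hE.comm i hi.2 Q' p.1).mul_left (lift_commute (Ne.symm hi.1) _ _)

theorem IsMeasurement.isPositive {J : Finset (Fin N)} {Z : Type*} [Fintype Z]
    {E : Z → Op (∀ i, β i)} (hE : IsMeasurement J E) (z : Z) : (E z).IsPositive :=
  (ContinuousLinearMap.nonneg_iff_isPositive _).1 (hE.proj z).nonneg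

theorem IsMeasurement.comp_equiv {J : Finset (Fin N)} {Z Z' : Type*} [Fintype Z] [Fintype Z']
    {E : Z → Op (∀ i, β i)} (hE : IsMeasurement J E) (e : Z' ≃ Z) : IsMeasurement J (E ∘ e) :=
  ⟨fun _ => hE.proj _, (Equiv.sum_comp e E).trans hE.sum_eq_one, fun j hj Q _ => hE.comm j hj Q _⟩

/-! ### Conditional maps and states -/

variable (Λ : TraceClass ℕ →ₗ[ℂ] TraceClass (∀ i, β i)) (d : ℕ) (lam : ℕ → ℝ)

/-- The dynamics of the `j`-th fragment on the outcome `E`. -/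
def condMap (j : Fin N) (E : Op (∀ i, β i)) : TraceClass ℕ →ₗ[ℂ] TraceClass (β j) :=
  traceAllBut β j ∘ₗ compress E E ∘ₗ Λ

/-- The weighted mixture of the first `d` Fock states. -/
def mixture : TraceClass ℕ := ∑ n ∈ Finset.range d, (lam n : ℂ) • ketBra (ket n) (ket n)

open Classical in
/-- The state of the `j`-th fragment conditioned on the outcome `E`. -/
def condState (j : Fin N) (E : Op (∀ i, β i)) : TraceClass (β j) :=
  if mass Λ d lam E = 0 then traceAllBut β j (Λ (ketBra (ket 0) (ket 0)))
  else ((mass Λ d lam E)⁻¹ : ℂ) • condMap Λ j E (mixture d lam)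

variable {Λ d lam}

theorem trMul_condMap {j : Fin N} {E : Op (∀ i, β i)} (hE : IsStarProjection E) (Q : Op (β j))
    (hc : Commute E (lift j Q)) (X : TraceClass ℕ) :
    trMul Q (condMap Λ j E X) = trMul (E * lift j Q) (Λ X) := by
  have h : adjoint E ∘L lift j Q ∘L E = E * lift j Q := by
    rw [show adjoint E = E from hE.isSelfAdjoint.star_eq]
    change E * (lift j Q * E) = _
    rw [← hc.eq, ← mul_assoc, hE.isIdempotentElem.eq]
  rw [condMap, LinearMap.comp_apply, LinearMap.comp_apply, trMul_traceAllBut, trMul_compress, h]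

theorem condMap_completelyPositive (hΛ : IsCompletelyPositive Λ) (j : Fin N)
    (E : Op (∀ i, β i)) : IsCompletelyPositive (condMap Λ j E) :=
  (IsCompletelyPositive.traceAllBut j).comp ((IsCompletelyPositive.compress E).comp hΛ)

/-- No signalling: a measurement that commutes with the operators on `B_j` leaves the dynamics of
`B_j` unchanged when its outcome is forgotten. -/
theorem sum_condMap {J : Finset (Fin N)} {Z : Type*} [Fintype Z] {E : Z → Op (∀ i, β i)}
    (hE : IsMeasurement J E) {j : Fin N} (hj : j ∉ J) (X : TraceClass ℕ) :
    ∑ z, condMap Λ j (E z) X = traceAllBut β j (Λ X) := by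
  refine traceClass_ext fun Q => ?_
  rw [map_sum, trMul_traceAllBut]
  simp_rw [fun z => trMul_condMap (Λ := Λ) (hE.proj z) Q (hE.comm j hj Q z) X]
  rw [← trMul_sum, ← Finset.sum_mul, hE.sum_eq_one, one_mul]

theorem mixture_isPositive (hl : ∀ n, 0 < lam n) : (mixture d lam : Op ℕ).IsPositive := by
  rw [mixture, Submodule.coe_sum]
  refine ContinuousLinearMap.isPositive_sum _ fun n _ => ?_
  exact (ketBra_self_isPositive _).smul_of_nonneg (by exact_mod_cast (hl n).le)

theorem trMul_mixture (hΛ : IsCompletelyPositive Λ) {Q : Op (∀ i, β i)} (hQ : Q.IsPositive) :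
    trMul Q (Λ (mixture d lam)) = (mass Λ d lam Q : ℂ) := by
  simp only [mixture, map_sum, map_smul, mass, Complex.ofReal_sum, Complex.ofReal_mul, smul_eq_mul]
  refine Finset.sum_congr rfl fun n _ => ?_
  have h := corner_self_nonneg hΛ hQ n
  congr 1
  exact Complex.ext (by simp [corner]) (by simpa [corner] using (Complex.nonneg_iff.1 h).2.symm)

theorem isState_condState (hΛ : IsChannel Λ) (hl : ∀ n, 0 < lam n) (j : Fin N)
    {E : Op (∀ i, β i)} (hE : IsStarProjection E) : IsState (condState Λ d lam j E) := by
  have hpos : E.IsPositive := (ContinuousLinearMap.nonneg_iff_isPositive _).1 hE.nonneg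
  have hΛc := hΛ.completelyPositive
  rw [condState]
  split_ifs with h
  · exact (hΛ.traceAllBut_comp j).isState (isState_ketBra_ket 0)
  · refine ⟨?_, ?_⟩
    · refine ContinuousLinearMap.IsPositive.smul_of_nonneg
        ((condMap_completelyPositive hΛc j E).isPositive (mixture_isPositive hl)) ?_
      rw [← Complex.ofReal_inv]
      exact_mod_cast inv_nonneg.2 (mass_nonneg hΛc hl hpos)
    · refine (tr_smul _ _).trans ?_
      rw [← trMul_one, trMul_condMap hE 1 (by rw [lift_one]; exact Commute.one_right E), lift_one,
        mul_one, trMul_mixture hΛc hpos]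
      exact inv_mul_cancel₀ (by exact_mod_cast h)

theorem isPositive_mul_lift {j : Fin N} {E : Op (∀ i, β i)} (hE : IsStarProjection E)
    {Q : Op (β j)} (hQ : IsStarProjection Q) (hc : Commute E (lift j Q)) :
    (E * lift j Q).IsPositive := by
  have h2 := isStarProjection_lift j hQ
  have : IsStarProjection (E * lift j Q) :=
    ⟨hE.isIdempotentElem.mul_of_commute hc h2.isIdempotentElem,
      (hE.isSelfAdjoint.commute_iff h2.isSelfAdjoint).1 hc⟩
  exact (ContinuousLinearMap.nonneg_iff_isPositive _).1 this.nonneg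

/-- The difference of the conditional dynamics of the `j`-th fragment and the preparation of the
conditional state. -/
def residual (Λ : TraceClass ℕ →ₗ[ℂ] TraceClass (∀ i, β i)) (d : ℕ) (lam : ℕ → ℝ) (j : Fin N)
    (E : Op (∀ i, β i)) (X : TraceClass ℕ) : TraceClass (β j) :=
  condMap Λ j E X - trMul E (Λ X) • condState Λ d lam j E

theorem trMul_hermUnit (Q : Op (∀ i, β i)) (n m : ℕ) (u : ℂ) :
    trMul Q (Λ (hermUnit n m u)) =
      u * corner Λ Q n m + (starRingEnd ℂ) u * corner Λ Q m n := by
  simp [hermUnit, corner]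

/-- The bridge between distance and purity: testing the residual with a projection of the fragment
yields exactly the deviations that `purity_gain` squares. -/
theorem trMul_residual (hΛ : IsCompletelyPositive Λ) (hl : ∀ n, 0 < lam n) {j : Fin N}
    {E : Op (∀ i, β i)} (hE : IsStarProjection E) {Q : Op (β j)} (hQ : IsStarProjection Q)
    (hc : Commute E (lift j Q)) {n m : ℕ} (hn : n < d) (hm : m < d) (u : ℂ) :
    trMul Q (residual Λ d lam j E (hermUnit n m u)) =
      u * deviation Λ d lam E (E * lift j Q) n m +
        (starRingEnd ℂ) u * deviation Λ d lam E (E * lift j Q) m n := by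
  have hpos : E.IsPositive := (ContinuousLinearMap.nonneg_iff_isPositive _).1 hE.nonneg
  rw [residual, map_sub, map_smul, trMul_condMap hE Q hc, trMul_hermUnit, trMul_hermUnit,
    smul_eq_mul]
  simp only [deviation]
  -- On an outcome of zero mass all truncated corners vanish, so the default choice in `condState`
  -- plays no role.
  by_cases h : mass Λ d lam E = 0
  · rw [corner_eq_zero hΛ hl hpos h hn m, corner_eq_zero hΛ hl hpos h hm n]
    ring
  · rw [condState, if_neg h, map_smul, trMul_condMap hE Q hc,
      trMul_mixture hΛ (isPositive_mul_lift hE hQ hc), smul_eq_mul]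
    push_cast
    ring

/-- Polarization into two positive operators, so that positivity of a map alone makes the image of
`hermUnit` self-adjoint. -/
theorem hermUnit_eq (n m : ℕ) (u : ℂ) : hermUnit n m u = (1 / 2 : ℂ) •
    (ketBra (u • ket n + ket m) (u • ket n + ket m) -
      ketBra (u • ket n - ket m) (u • ket n - ket m)) := by
  refine Subtype.ext ?_
  simp only [hermUnit, ketBra, Submodule.coe_add, Submodule.coe_smul, Submodule.coe_sub, map_add,
    map_sub, map_smulₛₗ, add_apply, sub_apply, smul_apply, RingHom.id_apply]
  module

theorem isSelfAdjoint_hermUnit {ι : Type v} {Θ : TraceClass ℕ →ₗ[ℂ] TraceClass ι}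
    (hΘ : IsCompletelyPositive Θ) (n m : ℕ) (u : ℂ) :
    IsSelfAdjoint (Θ (hermUnit n m u) : Op ι) := by
  rw [hermUnit_eq, map_smul, map_sub]
  refine IsSelfAdjoint.smul (by simp [IsSelfAdjoint]) ?_
  exact (hΘ.isPositive (ketBra_self_isPositive _)).isSelfAdjoint.sub
    (hΘ.isPositive (ketBra_self_isPositive _)).isSelfAdjoint

theorem isSelfAdjoint_residual (hΛ : IsChannel Λ) (hl : ∀ n, 0 < lam n) (j : Fin N)
    {E : Op (∀ i, β i)} (hE : IsStarProjection E) (n m : ℕ) (u : ℂ) :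
    IsSelfAdjoint (residual Λ d lam j E (hermUnit n m u) : Op (β j)) := by
  have hpos : E.IsPositive := (ContinuousLinearMap.nonneg_iff_isPositive _).1 hE.nonneg
  refine (isSelfAdjoint_hermUnit (condMap_completelyPositive hΛ.completelyPositive j E) n m u).sub
    (IsSelfAdjoint.smul ?_ (isState_condState hΛ hl j hE).pos.isSelfAdjoint)
  rw [trMul_hermUnit, corner_conj hΛ.completelyPositive hpos n m]
  simp [IsSelfAdjoint, add_comm]

theorem sum_mass {J : Finset (Fin N)} {Z : Type*} [Fintype Z] {E : Z → Op (∀ i, β i)}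
    (hΛ : IsChannel Λ) (hE : IsMeasurement J E) :
    ∑ z, mass Λ d lam (E z) = ∑ n ∈ Finset.range d, lam n := by
  simp only [mass]
  rw [Finset.sum_comm]
  refine Finset.sum_congr rfl fun n _ => ?_
  rw [← Finset.mul_sum, ← Complex.re_sum]
  simp only [corner]
  rw [← trMul_sum, hE.sum_eq_one, trMul_one, hΛ.tracePreserving, tr_ketBra_ket]
  simp

/-- If the residuals of the `j`-th fragment are large, then a measurement of this fragment
increases the purity. -/
theorem exists_refinement (hΛ : IsChannel Λ) (hl : ∀ n, 0 < lam n)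
    (hl1 : ∑ n ∈ Finset.range d, lam n ≤ 1) {J : Finset (Fin N)} {Z : Type*} [Fintype Z]
    {E : Z → Op (∀ i, β i)} (hE : IsMeasurement J E) {j : Fin N} (hj : j ∉ J) {n m : ℕ}
    (hn : n < d) (hm : m < d) {u : ℂ} (hu : ‖u‖ = 1) :
    ∃ (Q : Z → Op (β j)) (P R : Z → TraceClass (β j)), (∀ z, IsStarProjection (Q z)) ∧
      (∀ z, (P z : Op (β j)).IsPositive) ∧ (∀ z, (R z : Op (β j)).IsPositive) ∧
      (∀ z, residual Λ d lam j (E z) (hermUnit n m u) = P z - R z) ∧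
      (if n = m then 1 else 2) * (lam n * lam m) *
        (∑ z, ((tr (P z : Op (β j))).re + (tr (R z : Op (β j))).re)) ^ 2 ≤
      4 * (∑ p, purity Λ d lam (refine E j Q p) - ∑ z, purity Λ d lam (E z)) := by
  have hΛc := hΛ.completelyPositive
  -- The fragment is measured adaptively: for every earlier outcome `z` by the Jordan projection of
  -- the residual belonging to `z`. The traces of `P z` and `R z` are then read off from the two new
  -- outcomes.
  choose Q P R hQ hP hR hPR hPt hRt using fun z => exists_jordan _
    (isSelfAdjoint_residual (d := d) hΛ hl j (hE.proj z) n m u)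
  refine ⟨Q, P, R, hQ, hP, hR, hPR, ?_⟩
  have hE' := hE.refine hj hQ
  set D : Z × Bool → ℝ := fun p => ‖deviation Λ d lam (E p.1) (refine E j Q p) n m‖ with hD
  have hpos := hE'.isPositive
  have hm0 (p : Z × Bool) : 0 ≤ mass Λ d lam (refine E j Q p) := mass_nonneg hΛc hl (hpos p)
  have hdev {p : Z × Bool} (h : mass Λ d lam (refine E j Q p) = 0) : D p = 0 := by
    simp only [hD, deviation, h, corner_eq_zero hΛc hl (hpos p) h hn m]
    simp
  have hval (p : Z × Bool) : |(u * deviation Λ d lam (E p.1) (refine E j Q p) n m +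
      (starRingEnd ℂ) u * deviation Λ d lam (E p.1) (refine E j Q p) m n).re| ≤ 2 * D p := by
    refine (Complex.abs_re_le_norm _).trans ((norm_add_le _ _).trans ?_)
    rw [deviation_comm hΛc (hE.isPositive p.1) (hpos p) n m, norm_mul, norm_mul, RCLike.norm_conj,
      RCLike.norm_conj, hu]
    simp only [hD]
    linarith
  have htr (z : Z) : (tr (P z : Op (β j))).re + (tr (R z : Op (β j))).re ≤
      2 * (D (z, true) + D (z, false)) := by
    have e1 : tr (P z : Op (β j)) = _ := (hPt z).trans
      (trMul_residual hΛc hl (hE.proj z) (hQ z) (hE.comm j hj _ z) hn hm u)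
    have e2 : tr (R z : Op (β j)) = _ := (hRt z).trans (congrArg Neg.neg
      (trMul_residual hΛc hl (hE.proj z) (hQ z).one_sub (hE.comm j hj _ z) hn hm u))
    have h1 := hval (z, true)
    have h2 := hval (z, false)
    simp only [refine, if_true, Bool.false_eq_true, if_false] at h1 h2
    rw [e1, e2, Complex.neg_re]
    have h3 := le_abs_self (u * deviation Λ d lam (E z) (E z * lift j (Q z)) n m +
      (starRingEnd ℂ) u * deviation Λ d lam (E z) (E z * lift j (Q z)) m n).re
    have h4 := neg_le_abs (u * deviation Λ d lam (E z) (E z * lift j (1 - Q z)) n m +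
      (starRingEnd ℂ) u * deviation Λ d lam (E z) (E z * lift j (1 - Q z)) m n).re
    linarith
  have hsum : ∑ z, ((tr (P z : Op (β j))).re + (tr (R z : Op (β j))).re) ≤ 2 * ∑ p, D p := by
    rw [Fintype.sum_prod_type, Finset.mul_sum]
    simp only [Fintype.sum_bool]
    exact Finset.sum_le_sum fun z _ => htr z
  have hsum0 : 0 ≤ ∑ z, ((tr (P z : Op (β j))).re + (tr (R z : Op (β j))).re) :=
    Finset.sum_nonneg fun z _ => add_nonneg (Complex.nonneg_iff.1 (tr_nonneg (hP z) (P z).2)).1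
      (Complex.nonneg_iff.1 (tr_nonneg (hR z) (R z).2)).1
  -- Cauchy–Schwarz against the outcome masses, whose sum is at most `1`; outcomes of zero mass have
  -- zero deviation.
  have hcs : (∑ p, D p) ^ 2 ≤ ∑ p, D p ^ 2 / mass Λ d lam (refine E j Q p) := by
    have h := Finset.sum_sq_le_sum_mul_sum_of_sq_le_mul Finset.univ (r := D)
      (f := fun p => D p ^ 2 / mass Λ d lam (refine E j Q p))
      (g := fun p => mass Λ d lam (refine E j Q p))
      (fun p _ => div_nonneg (sq_nonneg _) (hm0 p)) (fun p _ => hm0 p) (fun p _ => by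
        by_cases h : mass Λ d lam (refine E j Q p) = 0
        · simp [hdev h, h]
        · rw [div_mul_cancel₀ _ h])
    rw [sum_mass hΛ hE'] at h
    refine h.trans (mul_le_of_le_one_right ?_ hl1)
    exact Finset.sum_nonneg fun p _ => div_nonneg (sq_nonneg _) (hm0 p)
  have hgain : (if n = m then 1 else 2) * (lam n * lam m) *
      ∑ p, D p ^ 2 / mass Λ d lam (refine E j Q p) ≤
      ∑ p, purity Λ d lam (refine E j Q p) - ∑ z, purity Λ d lam (E z) := by
    rw [Fintype.sum_prod_type, Fintype.sum_prod_type, Finset.mul_sum, ← Finset.sum_sub_distrib]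
    simp only [Fintype.sum_bool]
    refine Finset.sum_le_sum fun z _ => ?_
    have h := le_purity_gain hΛc hl (hpos (z, true)) (hpos (z, false)) hn hm
    rw [refine_add_refine] at h
    exact h
  have hk : (0 : ℝ) ≤ (if n = m then 1 else 2) * (lam n * lam m) := by
    have := mul_pos (hl n) (hl m)
    split_ifs <;> positivity
  calc _ ≤ (if n = m then 1 else 2) * (lam n * lam m) * (2 * ∑ p, D p) ^ 2 := by gcongr
    _ = 4 * ((if n = m then 1 else 2) * (lam n * lam m) * (∑ p, D p) ^ 2) := by ring
    _ ≤ 4 * ((if n = m then 1 else 2) * (lam n * lam m) *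
        ∑ p, D p ^ 2 / mass Λ d lam (refine E j Q p)) := by gcongr
    _ ≤ _ := by gcongr

end Measurement

/-! ### Greedy choice of the measured fragments -/

theorem sum_thermalWeight (ω : ℝ) (d : ℕ) :
    ∑ n ∈ Finset.range d, thermalWeight ω n = 1 - Real.exp (-(ω * d)) := by
  induction d with
  | zero => simp
  | succ d ih =>
    have : Real.exp (-(ω * (d + 1 : ℕ))) = Real.exp (-ω) * Real.exp (-(ω * d)) := by
      rw [← Real.exp_add]; push_cast; ring_nf
    rw [Finset.sum_range_succ, ih, thermalWeight, this]
    ring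

theorem sum_thermalWeight_le_one (ω : ℝ) (d : ℕ) :
    ∑ n ∈ Finset.range d, thermalWeight ω n ≤ 1 := by
  rw [sum_thermalWeight]
  have := Real.exp_pos (-(ω * d))
  linarith

section Greedy

variable {N : ℕ} {β : Fin N → Type u} {Λ : TraceClass ℕ →ₗ[ℂ] TraceClass (∀ i, β i)}

/-- On truncated matrix units the POVM reproduces the outcome functionals of the measurement of the
fragments; only there does the comparison with `residual` take place. -/
theorem trMul_effect_hermUnit {d : ℕ} (Q : Op (∀ i, β i)) {n m : ℕ} (hn : n < d) (hm : m < d)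
    (u : ℂ) : trMul (effect Λ d Q) (hermUnit n m u) = trMul Q (Λ (hermUnit n m u)) := by
  rw [trMul_hermUnit, hermUnit, map_add, map_smul, map_smul, trMul_ketBra, trMul_ketBra,
    inner_effect hn hm, inner_effect hm hn]
  rfl

theorem hermUnit_self_I (n : ℕ) : hermUnit n n Complex.I = 0 := by
  simp only [hermUnit, Complex.conj_I]
  rw [← add_smul]
  simp

theorem isPOVM_effect (hΛ : IsChannel Λ) {J : Finset (Fin N)} {K : ℕ}
    {E : Fin K → Op (∀ i, β i)} (hE : IsMeasurement J E) (d : ℕ) :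
    IsPOVM fun z => effect Λ d (E z) :=
  ⟨fun z => effect_isPositive hΛ.completelyPositive (hE.isPositive z),
    sum_effect hE.sum_eq_one hΛ⟩

/-- A fragment whose measurements hardly increase the purity is close to measure-and-prepare. -/
theorem expDiamondNorm_sub_measurePrepare_le (hΛ : IsChannel Λ) {ω Ω : ℝ} (hω : 0 < ω)
    (hΩ : 0 < Ω) (d : ℕ) {J : Finset (Fin N)} {K : ℕ} {E : Fin K → Op (∀ i, β i)}
    (hE : IsMeasurement J E) {j : Fin N} (hj : j ∉ J) {κ : ℝ} (hκ : 0 ≤ κ)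
    (hmax : ∀ Q : Fin K → Op (β j), (∀ z, IsStarProjection (Q z)) →
      ∑ p, purity Λ d (thermalWeight ω) (refine E j Q p) ≤
        ∑ z, purity Λ d (thermalWeight ω) (E z) + κ ^ 2) :
    expDiamondNorm.{u, w} ω Ω (traceAllBut β j ∘ₗ Λ -
        measurePrepare (fun z => effect Λ d (E z))
          (fun z => condState Λ d (thermalWeight ω) j (E z))) ≤
      ENNReal.ofReal (4 * √(Ω * Real.exp (-(ω * d))) + √2 * κ * d * dTilde ω Ω) := by
  have hl := thermalWeight_pos hω
  set lam := thermalWeight ω with hlam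
  have hσ (z) : IsState (condState Λ d lam j (E z)) := isState_condState hΛ hl j (hE.proj z)
  have hg (n m : ℕ) : 0 < √(lam n * lam m) := Real.sqrt_pos.2 (mul_pos (hl n) (hl m))
  refine expDiamondNorm_sub_le hω hΩ (hΛ.traceAllBut_comp j)
    (isChannel_measurePrepare (isPOVM_effect hΛ hE d) hσ) d hκ
    -- `exists_refinement` with gain at most `κ²` gives `2κ` on the diagonal and, through the factor
    -- `2`, `√2 κ` off it. The diagonal unit of phase `i` vanishes. The two phases together
    -- therefore never exceed `2 √2 κ`.
    (fun n m b => (if n = m then (if b = 0 then 2 * κ else 0) else √2 * κ) / √(lam n * lam m))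
    (fun n hn m hm b => ?_) (fun n hn m hm => ?_)
  · by_cases hz : n = m ∧ b = 1
    · obtain ⟨rfl, rfl⟩ := hz
      refine ⟨0, 0, ContinuousLinearMap.isPositive_zero, ContinuousLinearMap.isPositive_zero, ?_, ?_⟩
      · rw [show phase 1 = Complex.I from rfl, hermUnit_self_I, map_zero, sub_zero]
      · simp [tr]
    · obtain ⟨Q, P, R, hQ, hP, hR, hPR, hb⟩ := exists_refinement hΛ hl
        (sum_thermalWeight_le_one ω d) hE hj hn hm (norm_phase b)
      refine ⟨∑ z, P z, ∑ z, R z, ?_, ?_, ?_, ?_⟩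
      · rw [Submodule.coe_sum]
        exact ContinuousLinearMap.isPositive_sum _ fun z _ => hP z
      · rw [Submodule.coe_sum]
        exact ContinuousLinearMap.isPositive_sum _ fun z _ => hR z
      · rw [LinearMap.sub_apply, LinearMap.comp_apply, measurePrepare_apply, ← sum_condMap hE hj,
          ← Finset.sum_sub_distrib, ← Finset.sum_sub_distrib]
        refine Finset.sum_congr rfl fun z _ => ?_
        rw [trMul_effect_hermUnit _ hn hm, ← hPR, residual]
      · have htr (A : Fin K → TraceClass (β j)) : (tr ((∑ z, A z : TraceClass (β j)) :
            Op (β j))).re = ∑ z, (tr (A z : Op (β j))).re := by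
          have := map_sum (trMul (1 : Op (β j))) A Finset.univ
          simp only [trMul_one] at this
          rw [this, Complex.re_sum]
        rw [htr, htr, ← Finset.sum_add_distrib, le_div_iff₀ (hg n m)]
        have h1 := hmax Q hQ
        set S := ∑ z, ((tr (P z : Op (β j))).re + (tr (R z : Op (β j))).re) with hS
        have hsq : √(lam n * lam m) ^ 2 = lam n * lam m :=
          Real.sq_sqrt (mul_pos (hl n) (hl m)).le
        have h2 : (if n = m then 1 else 2) * (S * √(lam n * lam m)) ^ 2 ≤ 4 * κ ^ 2 := by
          rw [mul_pow, hsq]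
          linarith
        by_cases hnm : n = m
        · have hb0 : b = 0 := by
            have : b ≠ 1 := fun h => hz ⟨hnm, h⟩
            omega
          rw [if_pos hnm, if_pos hb0]
          rw [if_pos hnm] at h2
          refine abs_le_of_sq_le_sq' ?_ (by positivity) |>.2
          linarith
        · rw [if_neg hnm]
          rw [if_neg hnm] at h2
          refine abs_le_of_sq_le_sq' ?_ (by positivity) |>.2
          have h3 : (√2 * κ) ^ 2 = 2 * κ ^ 2 := by rw [mul_pow, Real.sq_sqrt (by norm_num)]
          rw [h3]
          linarith
  · rw [← add_div, mul_div_cancel₀ _ (hg n m).ne']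
    have h2 : 1 ≤ √2 := by rw [Real.one_le_sqrt]; norm_num
    by_cases hnm : n = m
    · simp only [hnm, if_true]
      simp
      nlinarith
    · simp only [hnm, if_false]
      linarith

theorem isMeasurement_one : IsMeasurement (β := β) ∅ fun _ : Fin 1 => 1 :=
  ⟨fun _ => IsStarProjection.one _, by simp, fun _ _ _ _ => Commute.one_left _⟩

/-- The vacuum term alone gives `lam 0 ^ 2`, and the mass in the denominator is at most `1`.
Starting here and not at `0` leaves a budget of only `1 - (1 - e^{-ω})² ≤ 2 e^{-ω}`, which is what
makes the entropy `s` sufficient in the final constants. -/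
theorem purity_one_ge (hΛ : IsChannel Λ) {ω : ℝ} (hω : 0 < ω) {d : ℕ} (hd : 0 < d) :
    (1 - Real.exp (-ω)) ^ 2 ≤ purity Λ d (thermalWeight ω) 1 := by
  have hl := thermalWeight_pos hω
  have hc (n m : ℕ) : corner Λ 1 n m = if n = m then 1 else 0 := by
    rw [corner, trMul_one, hΛ.tracePreserving, tr_ketBra_ket]
  have hmass : mass Λ d (thermalWeight ω) 1 = ∑ n ∈ Finset.range d, thermalWeight ω n := by
    simp [mass, hc]
  have hpos : 0 < mass Λ d (thermalWeight ω) 1 := by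
    rw [hmass]
    exact Finset.sum_pos (fun n _ => hl n) ⟨0, Finset.mem_range.2 hd⟩
  have h0 : thermalWeight ω 0 = 1 - Real.exp (-ω) := by simp [thermalWeight]
  have hnn (n m : ℕ) : 0 ≤ thermalWeight ω n * thermalWeight ω m * ‖corner Λ 1 n m‖ ^ 2 :=
    mul_nonneg (mul_pos (hl n) (hl m)).le (sq_nonneg _)
  rw [purity, le_div_iff₀ hpos]
  have hm1 : mass Λ d (thermalWeight ω) 1 ≤ 1 := hmass.trans_le (sum_thermalWeight_le_one ω d)
  calc _ ≤ (1 - Real.exp (-ω)) ^ 2 * 1 := by gcongr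
    _ = thermalWeight ω 0 * thermalWeight ω 0 * ‖corner Λ 1 0 0‖ ^ 2 := by
        rw [hc, if_pos rfl, h0]; simp; ring
    _ ≤ ∑ m ∈ Finset.range d, thermalWeight ω 0 * thermalWeight ω m * ‖corner Λ 1 0 m‖ ^ 2 :=
        Finset.single_le_sum (f := fun m => thermalWeight ω 0 * thermalWeight ω m *
          ‖corner Λ 1 0 m‖ ^ 2) (fun m _ => hnn 0 m) (Finset.mem_range.2 hd)
    _ ≤ _ := Finset.single_le_sum (f := fun n => ∑ m ∈ Finset.range d,
          thermalWeight ω n * thermalWeight ω m * ‖corner Λ 1 n m‖ ^ 2)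
          (fun n _ => Finset.sum_nonneg fun m _ => hnn n m) (Finset.mem_range.2 hd)

/-- Objectivity for a fixed truncation dimension. -/
theorem objectiveWithin_truncation (hΛ : IsChannel Λ) (hN : 0 < N) {δ ω Ω : ℝ} (hδ : 0 < δ)
    (hω : 0 < ω) (hΩ : 0 < Ω) {d : ℕ} (hd : 0 < d) :
    ObjectiveWithin.{u, w} Λ ω Ω δ (4 * √(Ω * Real.exp (-(ω * d))) +
      √2 * √(2 * Real.exp (-ω) / (δ * N)) * d * dTilde ω Ω) := by
  -- A gain of `κ²` in each of `δN` steps would spend the whole budget `2 e^{-ω}`.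
  set κ := √(2 * Real.exp (-ω) / (δ * N)) with hκdef
  have hN' : (0 : ℝ) < N := by exact_mod_cast hN
  have hκ : 0 < κ := Real.sqrt_pos.2 (by have := Real.exp_pos (-ω); positivity)
  have hκ2 : κ ^ 2 * (δ * N) = 2 * Real.exp (-ω) := by
    rw [hκdef, Real.sq_sqrt (by have := Real.exp_pos (-ω); positivity)]
    field_simp
  -- If no stage of the greedy procedure were good enough, it could be continued until it had
  -- measured `N + 1` distinct fragments.
  by_contra hobj
  have hgreedy (k : ℕ) : ∃ (J : Finset (Fin N)) (K : ℕ) (E : Fin K → Op (∀ i, β i)),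
      J.card = k ∧ IsMeasurement J E ∧ (1 - Real.exp (-ω)) ^ 2 + k * κ ^ 2 ≤
        ∑ z, purity Λ d (thermalWeight ω) (E z) := by
    induction k with
    | zero =>
      refine ⟨∅, 1, fun _ => 1, rfl, isMeasurement_one, ?_⟩
      simpa using purity_one_ge hΛ hω hd
    | succ k ih =>
      obtain ⟨J, K, E, hJ, hE, hpur⟩ := ih
      -- The potential is at most `1`, so `k κ² ≤ 2 e^{-ω} - e^{-2ω}`.
      have hkN : (k : ℝ) ≤ δ * N := by
        have h1 : ∑ z, purity Λ d (thermalWeight ω) (E z) ≤ 1 :=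
          (Finset.sum_le_sum fun z _ => purity_le_mass hΛ.completelyPositive
            (thermalWeight_pos hω) (hE.isPositive z)).trans
            ((sum_mass hΛ hE).trans_le (sum_thermalWeight_le_one ω d))
        by_contra hk
        have h2 := mul_lt_mul_of_pos_left (not_le.1 hk) (pow_pos hκ 2)
        have h3 := sq_nonneg (Real.exp (-ω))
        nlinarith
      have hex : ∃ j ∉ J, ∃ Q : Fin K → Op (β j), (∀ z, IsStarProjection (Q z)) ∧
          ∑ z, purity Λ d (thermalWeight ω) (E z) + κ ^ 2 <
            ∑ p, purity Λ d (thermalWeight ω) (refine E j Q p) := by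
        -- When no unmeasured fragment gains more than `κ²`, the complement of `J` is the required
        -- set `S`, of size at least `(1 - δ) N` by `hkN`.
        by_contra! hno
        refine hobj ⟨K, fun z => effect Λ d (E z), Jᶜ, isPOVM_effect hΛ hE d, ?_, fun j hj => ?_⟩
        · rw [Finset.card_compl, Fintype.card_fin, hJ, Nat.cast_sub
            (hJ ▸ (Finset.card_le_univ J).trans_eq (Fintype.card_fin N))]
          linarith
        · have hj' : j ∉ J := Finset.mem_compl.1 hj
          exact ⟨fun z => condState Λ d (thermalWeight ω) j (E z),
            fun z => isState_condState hΛ (thermalWeight_pos hω) j (hE.proj z),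
            expDiamondNorm_sub_measurePrepare_le hΛ hω hΩ d hE hj' hκ.le (hno j hj')⟩
      obtain ⟨j, hj, Q, hQ, hlt⟩ := hex
      have e := (Fintype.equivFin (Fin K × Bool)).symm
      refine ⟨insert j J, _, refine E j Q ∘ e, by rw [Finset.card_insert_of_notMem hj, hJ],
        (hE.refine hj hQ).comp_equiv e, ?_⟩
      have hs := Equiv.sum_comp e fun p => purity Λ d (thermalWeight ω) (refine E j Q p)
      simp only [Function.comp_apply]
      rw [hs]
      push_cast
      linarith
  obtain ⟨J, -, -, hJ, -⟩ := hgreedy (N + 1)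
  have := Finset.card_le_univ J
  rw [Fintype.card_fin, hJ] at this
  omega

/-! ### Cases in which nothing is measured. -/

theorem isPOVM_one : IsPOVM fun _ : Fin 1 => (1 : Op ℕ) :=
  ⟨fun _ => ContinuousLinearMap.isPositive_one, by simp⟩

/-- The trivial POVM together with the image of the vacuum. It serves bounds of at least `2`, inputs
near the vacuum, and the case of no fragments. -/
theorem objectiveWithin_one_outcome (hΛ : IsChannel Λ) {δ ω Ω ε : ℝ} (hδ : 0 < δ)
    (h : ∀ j, expDiamondNorm.{u, w} ω Ω (traceAllBut β j ∘ₗ Λ - measurePrepare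
      (fun _ : Fin 1 => (1 : Op ℕ)) fun _ => traceAllBut β j (Λ (ketBra (ket 0) (ket 0)))) ≤
        ENNReal.ofReal ε) : ObjectiveWithin.{u, w} Λ ω Ω δ ε := by
  refine ⟨1, fun _ => 1, Finset.univ, isPOVM_one, ?_, fun j _ =>
    ⟨fun _ => traceAllBut β j (Λ (ketBra (ket 0) (ket 0))),
      fun _ => (hΛ.traceAllBut_comp j).isState (isState_ketBra_ket 0), h j⟩⟩
  rw [Finset.card_univ, Fintype.card_fin]
  have : (0 : ℝ) ≤ N := Nat.cast_nonneg N
  nlinarith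

theorem isChannel_one_outcome (hΛ : IsChannel Λ) (j : Fin N) : IsChannel (measurePrepare
    (fun _ : Fin 1 => (1 : Op ℕ)) fun _ => traceAllBut β j (Λ (ketBra (ket 0) (ket 0)))) :=
  isChannel_measurePrepare isPOVM_one fun _ =>
    (hΛ.traceAllBut_comp j).isState (isState_ketBra_ket 0)

/-- The bound by the diameter of the set of channels. -/
theorem objectiveWithin_of_two_le (hΛ : IsChannel Λ) {δ ω Ω ε : ℝ} (hδ : 0 < δ) (hΩ : 0 ≤ Ω)
    (hε : 2 ≤ ε) : ObjectiveWithin.{u, w} Λ ω Ω δ ε := by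
  refine objectiveWithin_one_outcome hΛ hδ fun j => ?_
  refine (((hΛ.traceAllBut_comp j).dominated_sub (isChannel_one_outcome hΛ j)).expDiamondNorm_le
    (ω := ω) (α := 2) (β := 0) (by norm_num) le_rfl hΩ fun n => by simp).trans ?_
  exact ENNReal.ofReal_le_ofReal (by linarith)

/-- Inputs close to the vacuum need no measurement. -/
theorem objectiveWithin_vacuum (hΛ : IsChannel Λ) {δ ω Ω : ℝ} (hδ : 0 < δ) (hω : 0 < ω)
    (hΩ : 0 < Ω) : ObjectiveWithin.{u, w} Λ ω Ω δ (4 * √(Ω * Real.exp (-ω))) := by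
  refine objectiveWithin_one_outcome hΛ hδ fun j => ?_
  -- At truncation dimension `1` the only matrix unit is the vacuum, on which the two channels
  -- agree; so `κ = 0` and only the tail remains.
  refine (expDiamondNorm_sub_le hω hΩ (hΛ.traceAllBut_comp j) (isChannel_one_outcome hΛ j) 1
    (κ := 0) le_rfl (fun _ _ _ => 0) (fun n hn m hm b => ?_) (by simp)).trans_eq (by simp)
  obtain rfl : n = 0 := by omega
  obtain rfl : m = 0 := by omega
  refine ⟨0, 0, ContinuousLinearMap.isPositive_zero, ContinuousLinearMap.isPositive_zero, ?_,
    by simp [tr]⟩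
  have h : traceAllBut β j (Λ (ketBra (ket 0) (ket 0))) =
      measurePrepare (fun _ : Fin 1 => (1 : Op ℕ))
        (fun _ => traceAllBut β j (Λ (ketBra (ket 0) (ket 0)))) (ketBra (ket 0) (ket 0)) := by
    simp [measurePrepare_apply, trMul_one, tr_ketBra_ket]
  rw [LinearMap.sub_apply, hermUnit, map_add, map_smul, map_smul, map_add, map_smul, map_smul, ← h]
  simp

end Greedy

theorem ObjectiveWithin.mono {N : ℕ} {β : Fin N → Type u}
    {Λ : TraceClass ℕ →ₗ[ℂ] TraceClass (∀ i, β i)} {ω Ω δ ε ε' : ℝ}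
    (h : ObjectiveWithin.{u, w} Λ ω Ω δ ε) (hε : ε ≤ ε') : ObjectiveWithin.{u, w} Λ ω Ω δ ε' := by
  obtain ⟨K, M, S, hM, hS, hσ⟩ := h
  refine ⟨K, M, S, hM, hS, fun j hj => ?_⟩
  obtain ⟨σ, h1, h2⟩ := hσ j hj
  exact ⟨σ, h1, h2.trans (ENNReal.ofReal_le_ofReal hε)⟩

/-! ### Constants -/

/-- With `q = e^{-ω}` one has `s = -ln(1 - q) + ωq / (1 - q)`. Both terms are at least `q`, by `ln x
≤ x - 1` and by `1 - q ≤ ω`. -/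
theorem two_mul_exp_neg_le_thermalEntropy {ω : ℝ} (hω : 0 < ω) :
    2 * Real.exp (-ω) ≤ thermalEntropy ω := by
  have hq : Real.exp (-ω) * Real.exp ω = 1 := by rw [← Real.exp_add]; simp
  have hq0 := Real.exp_pos (-ω)
  have hq1 : 0 < 1 - Real.exp (-ω) := one_sub_exp_pos hω
  have he : 0 < Real.exp ω - 1 := by linarith [Real.add_one_lt_exp hω.ne']
  have hn : nTilde ω = Real.exp (-ω) * (1 - Real.exp (-ω))⁻¹ := by
    rw [nTilde]; field_simp; linarith
  have hn1 : nTilde ω + 1 = (1 - Real.exp (-ω))⁻¹ := by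
    rw [hn]; field_simp; ring
  have hlog : Real.log (nTilde ω) = -ω + Real.log (nTilde ω + 1) := by
    rw [hn1, hn, Real.log_mul hq0.ne' (inv_pos.2 hq1).ne', Real.log_exp]
  have hs : thermalEntropy ω = Real.log (nTilde ω + 1) + nTilde ω * ω := by
    rw [thermalEntropy, hlog]; ring
  have h1 : Real.exp (-ω) ≤ Real.log (nTilde ω + 1) := by
    rw [hn1, Real.log_inv]
    linarith [Real.log_le_sub_one_of_pos hq1]
  have h2 : Real.exp (-ω) ≤ nTilde ω * ω := by
    rw [hn, mul_assoc, ← div_eq_inv_mul]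
    refine le_mul_of_one_le_right hq0.le ((one_le_div hq1).2 ?_)
    linarith [Real.add_one_le_exp (-ω)]
  linarith

theorem thermalEntropy_pos {ω : ℝ} (hω : 0 < ω) : 0 < thermalEntropy ω :=
  (by have := Real.exp_pos (-ω); positivity : 0 < 2 * Real.exp (-ω)).trans_le
    (two_mul_exp_neg_le_thermalEntropy hω)

theorem log_two_mul_thermalEntropyBits (ω : ℝ) :
    Real.log 2 * thermalEntropyBits ω = thermalEntropy ω := by
  have : Real.log 2 ≠ 0 := (Real.log_pos one_lt_two).ne'
  rw [thermalEntropyBits, thermalEntropy, Real.logb, Real.logb]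
  field_simp

theorem le_dTilde {ω Ω : ℝ} (hω : 0 < ω) (hΩ : 0 < Ω) : Ω ≤ dTilde ω Ω := by
  rw [dTilde_eq, le_div_iff₀ (one_sub_exp_pos hω)]
  nlinarith [Real.exp_pos (-ω)]

theorem le_dTilde_sq {ω Ω : ℝ} (hω : 0 < ω) (hΩ : 1 < Ω) : Ω ≤ dTilde ω Ω ^ 2 := by
  have := le_dTilde hω (zero_lt_one.trans hΩ)
  nlinarith

theorem rpow_one_third_pow {x : ℝ} (hx : 0 ≤ x) : (x ^ (1 / 3 : ℝ)) ^ 3 = x := by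
  rw [← Real.rpow_natCast, ← Real.rpow_mul hx]; norm_num

theorem pow_rpow_one_third {x : ℝ} (hx : 0 ≤ x) : (x ^ 3) ^ (1 / 3 : ℝ) = x := by
  rw [← Real.rpow_natCast, ← Real.rpow_mul hx]; norm_num

/-- The square of the measurement error of a truncation is governed by the thermal entropy. -/
theorem measurementError_sq_le {ω D δ n d : ℝ} (hω : 0 < ω) (hδ : 0 < δ) (hn : 0 < n) :
    (√2 * √(2 * Real.exp (-ω) / (δ * n)) * d * D) ^ 2 ≤
      2 * d ^ 2 * D ^ 2 * (thermalEntropy ω / n) / δ := by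
  have hq := Real.exp_pos (-ω)
  have hs := two_mul_exp_neg_le_thermalEntropy hω
  rw [mul_pow, mul_pow, mul_pow, Real.sq_sqrt (by norm_num), Real.sq_sqrt (by positivity)]
  calc _ = 2 * d ^ 2 * D ^ 2 * (2 * Real.exp (-ω) / n) / δ := by field_simp
    _ ≤ _ := by gcongr

/-! ### The two explicit bounds. -/

section Bounds

variable {N : ℕ} {β : Fin N → Type u} {Λ : TraceClass ℕ →ₗ[ℂ] TraceClass (∀ i, β i)}

/-- Let `a` be the cube root in `zeta`. The measurement error is a square root: its square is at
most `(2/27) a³ / δ`. Unless `a / δ ≥ 2`, where the diameter bound suffices, `a < 2` and this is at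
most `(a / δ)²`. -/
theorem objectiveWithin_zeta (hΛ : IsChannel Λ) (hN : 0 < N) {δ ω Ω : ℝ} (hδ₀ : 0 < δ)
    (hδ₁ : δ < 1) (hω : 0 < ω) (hΩ : 1 < Ω) {d : ℕ} (hd : 0 < d) :
    ObjectiveWithin.{u, w} Λ ω Ω δ (1 / δ * zeta ω Ω N d) := by
  have hΩ0 : 0 < Ω := zero_lt_one.trans hΩ
  have hN' : (0 : ℝ) < N := by exact_mod_cast hN
  have hd' : (1 : ℝ) ≤ d := by exact_mod_cast hd
  have hD : 0 < dTilde ω Ω := hΩ0.trans_le (le_dTilde hω hΩ0)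
  have hs := thermalEntropy_pos hω
  have hδi : 1 ≤ 1 / δ := (one_le_div hδ₀).2 hδ₁.le
  have hT : 27 * Real.log 2 * dTilde ω Ω ^ 2 * (d : ℝ) ^ 4 * thermalEntropyBits ω / N =
      27 * dTilde ω Ω ^ 2 * (d : ℝ) ^ 4 * (thermalEntropy ω / N) := by
    rw [← log_two_mul_thermalEntropyBits]; ring
  rw [zeta, hT]
  set a := (27 * dTilde ω Ω ^ 2 * (d : ℝ) ^ 4 * (thermalEntropy ω / N)) ^ (1 / 3 : ℝ) with ha
  have ha3 : a ^ 3 = 27 * dTilde ω Ω ^ 2 * (d : ℝ) ^ 4 * (thermalEntropy ω / N) :=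
    rpow_one_third_pow (by positivity)
  have ha0 : 0 < a := Real.rpow_pos_of_pos (by positivity) _
  rcases le_or_gt 2 (1 / δ * a) with h2 | h2
  · refine objectiveWithin_of_two_le hΛ hδ₀ hΩ0.le (h2.trans ?_)
    gcongr
    exact le_add_of_nonneg_right (by positivity)
  · refine (objectiveWithin_truncation hΛ hN hδ₀ hω hΩ0 hd).mono ?_
    rw [add_comm, mul_add]
    refine add_le_add ?_ ?_
    · refine (abs_le_of_sq_le_sq' ((measurementError_sq_le hω hδ₀ hN').trans ?_)
        (by positivity)).2
      have ha2 : a < 2 := by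
        have := mul_le_mul_of_nonneg_right hδi ha0.le
        linarith
      have hdd : (d : ℝ) ^ 2 ≤ (d : ℝ) ^ 4 := pow_le_pow_right₀ hd' (by norm_num)
      calc _ ≤ 2 * (d : ℝ) ^ 4 * dTilde ω Ω ^ 2 * (thermalEntropy ω / N) / δ := by gcongr
        _ = (2 / 27 * a) * a ^ 2 / δ := by
            rw [show (2 / 27 * a) * a ^ 2 = 2 / 27 * a ^ 3 by ring, ha3]; ring
        _ ≤ 1 * a ^ 2 / δ := by gcongr; linarith
        _ = 1 / δ * 1 * a ^ 2 := by ring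
        _ ≤ 1 / δ * (1 / δ) * a ^ 2 := by gcongr
        _ = _ := by ring
    · have : √(Ω * Real.exp (-(ω * d))) ≤ √(dTilde ω Ω ^ 2 / Real.exp (ω * d)) := by
        rw [Real.exp_neg, ← div_eq_mul_inv]
        gcongr
        exact le_dTilde_sq hω hΩ
      calc _ ≤ 1 * (4 * √(dTilde ω Ω ^ 2 / Real.exp (ω * d))) := by rw [one_mul]; gcongr
        _ ≤ _ := by gcongr

/-- With `r = (γ₂ N)^{1/3}` and `P = |ln(γ₂ N)|^{4/3}` the bound is `4 d̃ / (δ r) + d̃ P / (δ r)`.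
The truncation `d ≈ 2 ln r / ω` balances the errors: the first term absorbs the tail, the second the
measurement error. -/
theorem objectiveWithin_log (hΛ : IsChannel Λ) (hN : 0 < N) {δ ω Ω : ℝ} (hδ₀ : 0 < δ)
    (hδ₁ : δ < 1) (hω : 0 < ω) (hΩ : 1 < Ω) :
    ObjectiveWithin.{u, w} Λ ω Ω δ (8 / δ * (gamma₁ ω Ω / N) ^ (1 / 3 : ℝ) *
      (1 + 1 / 4 * |Real.log (gamma₂ ω Ω * N)| ^ (4 / 3 : ℝ))) := by
  have hΩ0 : 0 < Ω := zero_lt_one.trans hΩ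
  have hN' : (0 : ℝ) < N := by exact_mod_cast hN
  set D := dTilde ω Ω with hDdef
  have hD1 : 1 < D := hΩ.trans_le (le_dTilde hω hΩ0)
  have hs := thermalEntropy_pos hω
  set y := gamma₂ ω Ω * N with hy
  have hy0 : 0 < y := by rw [hy, gamma₂]; positivity
  set r := y ^ (1 / 3 : ℝ) with hr
  have hr0 : 0 < r := Real.rpow_pos_of_pos hy0 _
  have hr3 : r ^ 3 = y := rpow_one_third_pow hy0.le
  have hsN : thermalEntropy ω / N = 3 * D * ω ^ 4 / (16 * r ^ 3) := by
    rw [hr3, hy, gamma₂, ← hDdef]; field_simp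
  have hγ : (gamma₁ ω Ω / N) ^ (1 / 3 : ℝ) = D / (2 * r) := by
    rw [← pow_rpow_one_third (x := D / (2 * r)) (by positivity)]
    congr 1
    calc gamma₁ ω Ω / N = 2 * D ^ 2 / (3 * ω ^ 4) * (thermalEntropy ω / N) := by
          rw [gamma₁]; ring
      _ = _ := by rw [hsN]; field_simp; norm_num
  set P := |Real.log y| ^ (4 / 3 : ℝ) with hP
  have hP0 : 0 ≤ P := Real.rpow_nonneg (abs_nonneg _) _
  have hP3 : P ^ 3 = Real.log y ^ 4 := by
    rw [hP, ← Real.rpow_natCast, ← Real.rpow_mul (abs_nonneg _)]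
    norm_num
    exact Even.pow_abs (by decide) _
  have hB : 8 / δ * (D / (2 * r)) * (1 + 1 / 4 * P) = 4 * (1 / δ * (D / r)) + 1 / δ * (D * P / r) :=
    by field_simp; ring
  rw [hγ, hB]
  have hδi : 1 ≤ 1 / δ := (one_le_div hδ₀).2 hδ₁.le
  have hmul {t : ℝ} (ht : 0 ≤ t) : t ≤ 1 / δ * t := le_mul_of_one_le_left ht hδi
  have ht1 := hmul (t := D / r) (by positivity)
  have ht2 := hmul (t := D * P / r) (by positivity)
  -- Past the diameter bound, `D P / r < 2` and `r > 1` become available; the second makes `ln r`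
  -- positive.
  rcases le_or_gt 2 (4 * (D / r) + D * P / r) with h2 | h2
  · exact objectiveWithin_of_two_le hΛ hδ₀ hΩ0.le (by linarith)
  have h3 : D * (4 + P) < 2 * r := by
    have : 4 * (D / r) + D * P / r = D * (4 + P) / r := by ring
    rwa [this, div_lt_iff₀ hr0] at h2
  have hDP : 0 ≤ D * P := by positivity
  have hr1 : 1 < r := by nlinarith
  have hL : Real.log y = 3 * Real.log r := by rw [← hr3, Real.log_pow]; norm_num
  have hlr : 0 < Real.log r := Real.log_pos hr1
  have htail {x : ℝ} (hx : 2 * Real.log r ≤ x) : √(Ω * Real.exp (-x)) ≤ D / r := by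
    rw [← Real.sqrt_sq (show 0 ≤ D / r by positivity), div_pow]
    refine Real.sqrt_le_sqrt ?_
    rw [div_eq_mul_inv]
    refine mul_le_mul (le_dTilde_sq hω hΩ) ?_ (Real.exp_pos _).le (by positivity)
    calc Real.exp (-x) ≤ Real.exp (-(2 * Real.log r)) := Real.exp_le_exp.2 (by linarith)
      _ = _ := by
        rw [Real.exp_neg, two_mul, Real.exp_add, Real.exp_log hr0, sq]
  -- For `2 ln r ≤ ω` rounding up would give `d = 1`, with `ω d` not controlled by `ln r`; but then
  -- the vacuum bound needs no measurement error at all.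
  rcases le_or_gt (2 * Real.log r) ω with hcase | hcase
  · refine (objectiveWithin_vacuum hΛ hδ₀ hω hΩ0).mono ?_
    have := htail hcase
    have : 0 ≤ 1 / δ * (D * P / r) := by positivity
    linarith
  -- The least `d` with `e^{-ωd} ≤ r⁻²`. Rounding adds less than `ω < 2 ln r`, so `ω d ≤ 4 ln r`.
  · set d := ⌈2 * Real.log r / ω⌉₊ with hd
    have hx : 0 < 2 * Real.log r / ω := by positivity
    have hd0 : 0 < d := Nat.ceil_pos.2 hx
    have hdl : 2 * Real.log r ≤ ω * d := by
      rw [← div_le_iff₀' hω]; exact Nat.le_ceil _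
    have hdu : ω * d ≤ 4 * Real.log r := by
      have h := mul_lt_mul_of_pos_left (Nat.ceil_lt_add_one hx.le) hω
      rw [mul_add, mul_div_cancel₀ _ hω.ne'] at h
      linarith
    refine (objectiveWithin_truncation hΛ hN hδ₀ hω hΩ0 hd0).mono ?_
    refine add_le_add (by linarith [htail hdl]) ?_
    refine (abs_le_of_sq_le_sq' ((measurementError_sq_le hω hδ₀ hN').trans ?_) (by positivity)).2
    -- From `ω < 2 ln r` and `ω d ≤ 4 ln r`, with `ln r = ln y / 3` and `P³ = (ln y)⁴`; hence `4 ·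
    -- 16 / 3⁴`.
    have hpow : ω ^ 4 * (d : ℝ) ^ 2 ≤ 64 / 81 * P ^ 3 := by
      calc ω ^ 4 * (d : ℝ) ^ 2 = ω ^ 2 * (ω * d) ^ 2 := by ring
        _ ≤ (2 * Real.log r) ^ 2 * (4 * Real.log r) ^ 2 := by gcongr
        _ = _ := by rw [hP3, hL]; ring
    calc _ = 3 / 8 * D ^ 3 * (ω ^ 4 * (d : ℝ) ^ 2) / r ^ 3 / δ := by
          rw [hsN, ← hDdef]; field_simp; ring
      _ ≤ 3 / 8 * D ^ 3 * (64 / 81 * P ^ 3) / r ^ 3 / δ := by gcongr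
      _ = (D * P / r) ^ 2 * (8 / 27 * (D * P / r)) / δ := by ring
      -- Here `D P / r < 2` trades the third power for a square, since `(8/27) · 2 < 1`.
      _ ≤ (D * P / r) ^ 2 * 1 / δ := by
          gcongr
          have : 0 < D / r := by positivity
          linarith
      _ = 1 / δ * 1 * (D * P / r) ^ 2 := by ring
      _ ≤ 1 / δ * (1 / δ) * (D * P / r) ^ 2 := by gcongr
      _ = _ := by ring

end Bounds

end QDarwin

end

theorem theorem2 (N : ℕ) (β : Fin N → Type u)
    (Λ : TraceClass ℕ →ₗ[ℂ] TraceClass (∀ j, β j)) (hΛ : IsChannel Λ)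
    (δ : ℝ) (hδ₀ : 0 < δ) (hδ₁ : δ < 1) (ω Ω : ℝ) (hω : 0 < ω) (hΩ : 1 < Ω) :
    ObjectiveWithin.{u, w} Λ ω Ω δ
        (8 / δ * (gamma₁ ω Ω / N) ^ (1 / 3 : ℝ) *
          (1 + 1 / 4 * |Real.log (gamma₂ ω Ω * N)| ^ (4 / 3 : ℝ))) ∧
      ∀ d : ℕ, 0 < d → ObjectiveWithin.{u, w} Λ ω Ω δ (1 / δ * zeta ω Ω N d) := by
  -- Without fragments only the existence of a POVM is claimed, while the constants divide by `N =
  -- 0`.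
  rcases N.eq_zero_or_pos with rfl | hN
  · exact ⟨objectiveWithin_one_outcome hΛ hδ₀ fun j => j.elim0,
      fun _ _ => objectiveWithin_one_outcome hΛ hδ₀ fun j => j.elim0⟩
  · exact ⟨objectiveWithin_log hΛ hN hδ₀ hδ₁ hω hΩ,
      fun _ hd => objectiveWithin_zeta hΛ hN hδ₀ hδ₁ hω hΩ hd⟩
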